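/- Let $A$ be a noetherian ring, let $X$ be a scheme of finite type over $A$, and let $\mathcal{E}^*$ be a bounded complex of locally free sheaves of finite rank on $X$, with $\mathcal{E}^i=0$ unless $a\le i\le b$ (where $a\le b$). Write $\Theta_{X/A}=\mathcal{D}er_A(\mathcal{O}_X,\mathcal{O}_X)$. For a sheaf of $\mathcal{O}_X$-modules $\mathcal{F}$, let $\mathcal{D}_A(X,\mathcal{F})$ be the sheaf of Lie algebras of pairs $(h,u)$ with $h\in\Theta_{X/A}$ and $u\colon\mathcal{F}\to\mathcal{F}$ an $A$-linear map such that $u(rm)-ru(m)=h(r)m$, with componentwise commutators as bracket; its anchor is $\alpha(h,u)=h$. Let $\mathcal{D}^*_A(X,\mathcal{E}^*)$ be the sheaf of DG-Lie algebras with $\mathcal{D}^i_A(X,\mathcal{E}^*)=\mathcal{H}om^i_{\mathcal{O}_X}(\mathcal{E}^*,\mathcal{E}^*)$ for $i\ne0$ and $\mathcal{D}^0_A(X,\mathcal{E}^*)=\{(h,(u_i)_i) : (h,u_i)\in\mathcal{D}_A(X,\mathcal{E}^i)\ \forall i\}$, with componentwise graded commutators as bracket, differential $[(0,d_{\mathcal{E}}),-]$,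 and anchor $\alpha(h,(u_i))=h$ in degree $0$, $\alpha=0$ in the other degrees. Let $$\det\mathcal{E}^*=\bigotimes_{i=a}^{b}(\det\mathcal{E}^i)^{(-1)^i},$$ where $\det\mathcal{E}^i$ is the top exterior power of $\mathcal{E}^i$ and $(\;)^{-1}$ is the dual. Let $\mathcal{O}_X$ carry the trivial bracket; regard sheaves of Lie algebras as sheaves of DG-Lie algebras in degree $0$. Call a sheaf of DG-Lie algebras coherent if its terms are coherent sheaves of $\mathcal{O}_X$-modules and all but finitely many of them vanish; its morphisms are the morphisms of complexes of $\mathcal{O}_X$-modules that preserve the brackets. Then there is a commutative diagram of morphisms of coherent sheaves of DG-Lie algebras over $X/A$, with exact rows, $$\begin{array}{ccccccccc} 0&\to&\mathcal{H}om^*_{\mathcal{O}_X}(\mathcal{E}^*,\mathcal{E}^*)&\to&\mathcal{D}^*_A(X,\mathcal{E}^*)&\xrightarrow{\alpha}&\Theta_{X/A}&\to&0\\ &&\downarrow{\scriptstyle\mathrm{Tr}}&&\downarrow{\scriptstyle\mathrm{Tr}}&&\|&&\\ 0&\to&\mathcal{O}_X&\to&\mathcal{D}_A(X,\det\mathcal{E}^*)&\xrightarrow{\alpha}&\Theta_{X/A}&\to&0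 \end{array}$$ in which the horizontal maps on the left are $u\mapsto(0,u)$ and $r\mapsto(0,r\cdot)$, and the vertical maps are as follows. * On $\mathcal{H}om^*_{\mathcal{O}_X}(\mathcal{E}^*,\mathcal{E}^*)$, $\mathrm{Tr}$ vanishes in nonzero degrees, and $\mathrm{Tr}((f_j)_j)=\sum_j(-1)^j\,\mathrm{Tr}(f_j)$ in degree $0$, where $\mathrm{Tr}(f_j)$ is the usual trace of an endomorphism of a locally free sheaf. * On $\mathcal{D}^*_A(X,\mathcal{E}^*)$, $\mathrm{Tr}$ vanishes in nonzero degrees. In degree $0$ it sends $(h,(u_i)_i)$ to the tensor product over $a\le i\le b$ of the derivations $(h,v_i)$ for $i$ even and $(h,v_i^T)$ for $i$ odd. Here $(h,v_i)\in\mathcal{D}_A(X,\det\mathcal{E}^i)$ is the Leibniz extension of $(h,u_i)$, given by $v_i(m_1\wedge\dots\wedge m_n)=\sum_j m_1\wedge\dots\wedge u_i(m_j)\wedge\dots\wedge m_n$ wherever $\mathcal{E}^i$ is free of rank $n$; the transpose $v^T$ of a derivation $(h,v)$ of $(X,\mathcal{L})$ acts on the dual of $\mathcal{L}$ by $v^T(\varphi)=h\varphi-\varphi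 v$; and the tensor product of $(h,v)$ and $(h,w)$ is $(h,\;v\otimes1+1\otimes w)$. -/

import Mathlib

open CategoryTheory AlgebraicGeometry TopologicalSpace Opposite

universe u

noncomputable section

namespace DGPair

section

variable {X : Scheme.{u}}

/-- Restriction of functions. -/
def resO {U V : X.Opens} (h : V ≤ U) : Γ(X, U) →+* Γ(X, V) :=
  (X.presheaf.map (homOfLE h).op).hom

/-- Restriction of sections of a sheaf of modules. -/
def res (M : X.Modules) {U V : X.Opens} (h : V ≤ U) : Γ(M, U) →+ Γ(M, V) :=
  (M.presheaf.map (homOfLE h).op).hom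

theorem resO_self {U : X.Opens} (x : Γ(X, U)) : resO (le_refl U) x = x := by
  change (X.presheaf.map (𝟙 (op U))).hom x = x
  simp

theorem resO_resO {U V W : X.Opens} (h : V ≤ U) (h' : W ≤ V) (x : Γ(X, U)) :
    resO h' (resO h x) = resO (h'.trans h) x := by
  change (X.presheaf.map (homOfLE h').op).hom ((X.presheaf.map (homOfLE h).op).hom x) = _
  rw [← CommRingCat.comp_apply, ← X.presheaf.map_comp]
  rfl

theorem res_self (M : X.Modules) {U : X.Opens} (x : Γ(M, U)) : res M (le_refl U) x = x := by
  change (M.presheaf.map (𝟙 (op U))).hom x = x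
  simp

theorem res_res (M : X.Modules) {U V W : X.Opens} (h : V ≤ U) (h' : W ≤ V) (x : Γ(M, U)) :
    res M h' (res M h x) = res M (h'.trans h) x := by
  change (M.presheaf.map (homOfLE h').op).hom ((M.presheaf.map (homOfLE h).op).hom x) = _
  rw [← AddCommGrpCat.comp_apply, ← M.presheaf.map_comp]
  rfl

theorem res_smul (M : X.Modules) {U V : X.Opens} (h : V ≤ U) (r : Γ(X, U)) (x : Γ(M, U)) :
    res M h (r • x) = resO h r • res M h x :=
  Scheme.Modules.map_smul M (homOfLE h) r x

/-- Sections of a sheaf of modules that agree on an open cover agree. -/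
theorem res_ext (M : X.Modules) {U : X.Opens} {ι : Type u} (W : ι → X.Opens)
    (hW : ∀ i, W i ≤ U) (hU : U ≤ iSup W) (s t : Γ(M, U))
    (h : ∀ i, res M (hW i) s = res M (hW i) t) : s = t :=
  TopCat.Sheaf.eq_of_locally_eq' ⟨M.presheaf, M.isSheaf⟩ W U (fun i => homOfLE (hW i)) hU s t h

/-- Sections of a sheaf of modules glue. -/
theorem res_glue (M : X.Modules) {U : X.Opens} {ι : Type u} (W : ι → X.Opens)
    (hW : ∀ i, W i ≤ U) (hU : U ≤ iSup W) (s : ∀ i, Γ(M, W i))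
    (h : ∀ i j, res M (inf_le_left : W i ⊓ W j ≤ W i) (s i)
      = res M (inf_le_right : W i ⊓ W j ≤ W j) (s j)) :
    ∃ t : Γ(M, U), ∀ i, res M (hW i) t = s i := by
  obtain ⟨t, ht, -⟩ := TopCat.Sheaf.existsUnique_gluing' ⟨M.presheaf, M.isSheaf⟩ W U
    (fun i => homOfLE (hW i)) hU s (fun i j => h i j)
  exact ⟨t, ht⟩

/-- A presheaf of `𝒪_X`-modules presented concretely: modules of sections and restriction maps. -/
structure PreData (X : Scheme.{u}) where
  S : X.Opens → Type u
  [grp : ∀ U, AddCommGroup (S U)]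
  [mod : ∀ U, Module Γ(X, U) (S U)]
  r : ∀ {U V : X.Opens}, V ≤ U → S U →+ S V
  r_smul : ∀ {U V : X.Opens} (h : V ≤ U) (a : Γ(X, U)) (x : S U), r h (a • x) = resO h a • r h x
  r_self : ∀ {U : X.Opens} (x : S U), r (le_refl U) x = x
  r_r : ∀ {U V W : X.Opens} (h : V ≤ U) (h' : W ≤ V) (x : S U), r h' (r h x) = r (h'.trans h) x

/-- A sheaf of `𝒪_X`-modules presented concretely: modules of sections, restriction maps,
and the two halves of the sheaf condition. -/
structure SheafData (X : Scheme.{u}) extends PreData X where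
  sep : ∀ {ι : Type u} (W : ι → X.Opens) (s t : S (iSup W)),
    (∀ i, r (le_iSup W i) s = r (le_iSup W i) t) → s = t
  glue : ∀ {ι : Type u} (W : ι → X.Opens) (s : ∀ i, S (W i)),
    (∀ i j, r (inf_le_left : W i ⊓ W j ≤ W i) (s i) = r (inf_le_right : W i ⊓ W j ≤ W j) (s j)) →
    ∃ t : S (iSup W), ∀ i, r (le_iSup W i) t = s i

namespace PreData

attribute [instance] PreData.grp PreData.mod

/-- The underlying presheaf of abelian groups. -/
def abPresheaf (D : PreData X) : TopCat.Presheaf Ab.{u} X where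
  obj U := AddCommGrpCat.of (D.S U.unop)
  map f := AddCommGrpCat.ofHom (D.r (leOfHom f.unop))
  map_id U := by ext x; exact D.r_self x
  map_comp f g := by ext x; exact (D.r_r (leOfHom f.unop) (leOfHom g.unop) x).symm

instance (D : PreData X) (U : (Opens X)ᵒᵖ) :
    Module (X.ringCatSheaf.obj.obj U) (D.abPresheaf.obj U) :=
  inferInstanceAs (Module Γ(X, U.unop) (D.S U.unop))

/-- The presheaf of `𝒪_X`-modules with the given sections and restriction maps. -/
def toPresheafOfModules (D : PreData X) : PresheafOfModules X.ringCatSheaf.obj :=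
  PresheafOfModules.ofPresheaf (R := X.ringCatSheaf.obj) D.abPresheaf
    (fun _ _ f a x => D.r_smul (leOfHom f.unop) a x)

end PreData

namespace SheafData

theorem abPresheaf_isSheaf (D : SheafData X) : D.abPresheaf.IsSheaf := by
  rw [TopCat.Presheaf.isSheaf_iff_isSheaf_comp (forget Ab.{u}),
    TopCat.Presheaf.isSheaf_iff_isSheafUniqueGluing_types]
  intro ι W s hs
  obtain ⟨t, ht⟩ := D.glue W s hs
  exact ⟨t, ht, fun t' ht' => D.sep W _ _ fun i => (ht' i).trans (ht i).symm⟩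

/-- The sheaf of `𝒪_X`-modules with the given sections and restriction maps. -/
def toModules (D : SheafData X) : X.Modules where
  val := D.toPresheafOfModules
  isSheaf := D.abPresheaf_isSheaf

end SheafData

/-- A morphism of sheaves of modules from its action on sections. -/
def homMk {M N : X.Modules} (φ : ∀ U : X.Opens, Γ(M, U) →+ Γ(N, U))
    (hl : ∀ U (a : Γ(X, U)) (x : Γ(M, U)), φ U (a • x) = a • φ U x)
    (hr : ∀ {U V : X.Opens} (h : V ≤ U) (x : Γ(M, U)), res N h (φ U x) = φ V (res M h x)) :
    M ⟶ N where
  val := PresheafOfModules.homMk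
    { app := fun U => AddCommGrpCat.ofHom (φ U.unop)
      naturality := fun U V f => by ext x; exact (hr (leOfHom f.unop) x).symm }
    (fun U a x => hl U.unop a x)

theorem homMk_app {M N : X.Modules} (φ : ∀ U : X.Opens, Γ(M, U) →+ Γ(N, U))
    (hl : ∀ U (a : Γ(X, U)) (x : Γ(M, U)), φ U (a • x) = a • φ U x)
    (hr : ∀ {U V : X.Opens} (h : V ≤ U) (x : Γ(M, U)), res N h (φ U x) = φ V (res M h x))
    (U : X.Opens) (x : Γ(M, U)) :
    (homMk φ hl hr).app U x = φ U x := rfl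

end

section

variable {X : Scheme.{u}}

namespace SheafData

/-- Product of a family of sheaves of modules. -/
def pi {I : Type} (D : I → SheafData X) : SheafData X where
  S U := ∀ i, (D i).S U
  r h := AddMonoidHom.mk' (fun x i => (D i).r h (x i)) fun x y => by ext i; simp
  r_smul h a x := by ext i; exact (D i).r_smul h a (x i)
  r_self x := by ext i; exact (D i).r_self (x i)
  r_r h h' x := by ext i; exact (D i).r_r h h' (x i)
  sep W s t h := by
    funext i
    exact (D i).sep W _ _ fun j => congrFun (h j) i
  glue W s h := by
    choose t ht using fun i => (D i).glue W (fun j => s j i) fun j k => congrFun (h j k) i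
    exact ⟨t, fun j => by funext i; exact ht i j⟩

/-- Product of two sheaves of modules. -/
def prod (D E : SheafData X) : SheafData X where
  S U := D.S U × E.S U
  r h := AddMonoidHom.prodMap (D.r h) (E.r h)
  r_smul h a x := Prod.ext (D.r_smul h a x.1) (E.r_smul h a x.2)
  r_self x := Prod.ext (D.r_self x.1) (E.r_self x.2)
  r_r h h' x := Prod.ext (D.r_r h h' x.1) (E.r_r h h' x.2)
  sep W s t h := Prod.ext (D.sep W _ _ fun j => congrArg Prod.fst (h j))
    (E.sep W _ _ fun j => congrArg Prod.snd (h j))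
  glue W s h := by
    obtain ⟨t, ht⟩ := D.glue W (fun j => (s j).1) fun j k => congrArg Prod.fst (h j k)
    obtain ⟨t', ht'⟩ := E.glue W (fun j => (s j).2) fun j k => congrArg Prod.snd (h j k)
    exact ⟨(t, t'), fun j => Prod.ext (ht j) (ht' j)⟩

/-- The subsheaf of modules cut out by a local condition. -/
def sub (D : SheafData X) (P : ∀ U : X.Opens, Submodule Γ(X, U) (D.S U))
    (hres : ∀ {U V : X.Opens} (h : V ≤ U) (x : D.S U), x ∈ P U → D.r h x ∈ P V)
    (hloc : ∀ {ι : Type u} (W : ι → X.Opens) (x : D.S (iSup W)),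
      (∀ i, D.r (le_iSup W i) x ∈ P (W i)) → x ∈ P (iSup W)) : SheafData X where
  S U := P U
  r h := AddMonoidHom.mk' (fun x => ⟨D.r h x.1, hres h x.1 x.2⟩) fun x y => Subtype.ext (by simp)
  r_smul h a x := Subtype.ext (D.r_smul h a x.1)
  r_self x := Subtype.ext (D.r_self x.1)
  r_r h h' x := Subtype.ext (D.r_r h h' x.1)
  sep W s t h := Subtype.ext (D.sep W _ _ fun j => congrArg Subtype.val (h j))
  glue W s h := by
    obtain ⟨t, ht⟩ := D.glue W (fun j => (s j).1) fun j k => congrArg Subtype.val (h j k)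
    exact ⟨⟨t, hloc W t fun i => by rw [ht i]; exact (s i).2⟩, fun i => Subtype.ext (ht i)⟩

end SheafData

/-- Sections over `U` of the sheaf of additive operators `M → N`: compatible families of additive
maps `Γ(M, V) → Γ(N, V)` for all open `V ⊆ U`, that is, homomorphisms of sheaves of abelian groups
`M|_U → N|_U`. -/
def opGroup (M N : X.Modules) (U : X.Opens) :
    AddSubgroup (∀ V : {V : X.Opens // V ≤ U}, (Γ(M, V.1) →+ Γ(N, V.1))) where
  carrier := {φ | ∀ (V W : X.Opens) (hV : V ≤ U) (h : W ≤ V) (x : Γ(M, V)),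
    res N h (φ ⟨V, hV⟩ x) = φ ⟨W, h.trans hV⟩ (res M h x)}
  zero_mem' := by intro V W hV h x; simp
  add_mem' := by
    intro φ ψ hφ hψ V W hV h x
    have := hφ V W hV h x
    have := hψ V W hV h x
    simp_all
  neg_mem' := by
    intro φ hφ V W hV h x
    have := hφ V W hV h x
    simp_all

/-- Homomorphisms of sheaves of abelian groups `M|_U → N|_U`. -/
abbrev Op (M N : X.Modules) (U : X.Opens) : Type u := opGroup M N U

namespace Op

variable {M N K : X.Modules} {U V W : X.Opens}

instance : AddCommGroup (Op M N U) := inferInstance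

instance : AddCommMonoid (Op M N U) := inferInstance

instance : AddZeroClass (Op M N U) := inferInstance

/-- The action of an operator over `U` on sections over `V ⊆ U`. -/
def app (φ : Op M N U) (h : V ≤ U) : Γ(M, V) →+ Γ(N, V) := φ.1 ⟨V, h⟩

theorem res_app (φ : Op M N U) (hV : V ≤ U) (h : W ≤ V) (x : Γ(M, V)) :
    res N h (φ.app hV x) = φ.app (h.trans hV) (res M h x) := φ.2 V W hV h x

theorem ext {φ ψ : Op M N U} (h : ∀ (V : X.Opens) (hV : V ≤ U) (x : Γ(M, V)),
    φ.app hV x = ψ.app hV x) : φ = ψ :=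
  Subtype.ext (funext fun V => AddMonoidHom.ext (h V.1 V.2))

@[simp] theorem add_app (φ ψ : Op M N U) (h : V ≤ U) (x : Γ(M, V)) :
    (φ + ψ).app h x = φ.app h x + ψ.app h x := rfl

@[simp] theorem sub_app (φ ψ : Op M N U) (h : V ≤ U) (x : Γ(M, V)) :
    (φ - ψ).app h x = φ.app h x - ψ.app h x := rfl

@[simp] theorem neg_app (φ : Op M N U) (h : V ≤ U) (x : Γ(M, V)) :
    (-φ).app h x = -φ.app h x := rfl

@[simp] theorem zero_app (h : V ≤ U) (x : Γ(M, V)) : (0 : Op M N U).app h x = 0 := rfl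

/-- Functions act on operators through the target. -/
instance : Module Γ(X, U) (Op M N U) where
  smul a φ := ⟨fun V => AddMonoidHom.mk' (fun x => resO V.2 a • φ.app V.2 x) (by simp),
    fun V W hV h x => by
      simp only [AddMonoidHom.mk'_apply, res_smul, resO_resO, res_app]⟩
  one_smul φ := ext fun V hV x => by
    change resO hV 1 • φ.app hV x = _; simp
  mul_smul a b φ := ext fun V hV x => by
    change resO hV (a * b) • φ.app hV x = resO hV a • resO hV b • φ.app hV x
    rw [map_mul, mul_smul]
  smul_zero a := ext fun V hV x => by
    change resO hV a • (0 : Op M N U).app hV x = _; simp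
  smul_add a φ ψ := ext fun V hV x => by
    change resO hV a • (φ + ψ).app hV x = resO hV a • φ.app hV x + resO hV a • ψ.app hV x
    simp
  add_smul a b φ := ext fun V hV x => by
    change resO hV (a + b) • φ.app hV x = resO hV a • φ.app hV x + resO hV b • φ.app hV x
    rw [map_add, add_smul]
  zero_smul φ := ext fun V hV x => by
    change resO hV 0 • φ.app hV x = _; simp

@[simp] theorem smul_app (a : Γ(X, U)) (φ : Op M N U) (h : V ≤ U) (x : Γ(M, V)) :
    (a • φ).app h x = resO h a • φ.app h x := rfl

/-- Restriction of operators to a smaller open set. -/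
def restrict (h : V ≤ U) : Op M N U →+ Op M N V :=
  AddMonoidHom.mk' (fun φ => ⟨fun W => φ.app (W.2.trans h),
    fun _ _ hV' hW x => φ.res_app (hV'.trans h) hW x⟩) fun _ _ => rfl

@[simp] theorem restrict_app (φ : Op M N U) (h : V ≤ U) (h' : W ≤ V) (x : Γ(M, W)) :
    (restrict h φ).app h' x = φ.app (h'.trans h) x := rfl

/-- Composition of operators. -/
def comp (ψ : Op N K U) (φ : Op M N U) : Op M K U :=
  ⟨fun V => (ψ.app V.2).comp (φ.app V.2), fun V W hV h x => by
    simp only [AddMonoidHom.comp_apply, res_app]⟩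

@[simp] theorem comp_app (ψ : Op N K U) (φ : Op M N U) (h : V ≤ U) (x : Γ(M, V)) :
    (ψ.comp φ).app h x = ψ.app h (φ.app h x) := rfl

/-- A morphism of sheaves of modules, as an operator over `U`. -/
def ofHom (f : M ⟶ N) (U : X.Opens) : Op M N U :=
  ⟨fun V => (f.app V.1).hom, fun _ _ _ h x =>
    (CategoryTheory.congr_fun (f.mapPresheaf.naturality (homOfLE h).op) x).symm⟩

@[simp] theorem ofHom_app (f : M ⟶ N) (h : V ≤ U) (x : Γ(M, V)) :
    (ofHom f U).app h x = f.app V x := rfl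

theorem app_zsmul_unit (ε : ℤˣ) (φ : Op M N U) (h : V ≤ U) (x : Γ(M, V)) :
    (ε • φ).app h x = ε • φ.app h x := by
  rcases Int.units_eq_one_or ε with rfl | rfl <;> simp

end Op

/-- The sheaf of additive operators `M → N`. -/
def opData (M N : X.Modules) : SheafData X where
  S U := Op M N U
  r h := Op.restrict h
  r_smul h a φ := Op.ext fun V hV x => by simp [resO_resO]
  r_self φ := rfl
  r_r h h' φ := rfl
  sep {ι} W s t h := Op.ext fun V hV x => by
    refine res_ext N (fun i => V ⊓ W i) (fun i => inf_le_left) ?_ _ _ fun i => ?_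
    · rw [← inf_iSup_eq]; exact le_inf le_rfl hV
    · rw [Op.res_app, Op.res_app]
      exact congrArg (fun φ : Op M N (W i) => φ.app inf_le_right (res M inf_le_left x)) (h i)
  glue {ι} W s h := by
    have hcov : ∀ V : X.Opens, V ≤ iSup W → V ≤ ⨆ i, V ⊓ W i := fun V hV => by
      rw [← inf_iSup_eq]; exact le_inf le_rfl hV
    have hc : ∀ i j (V : X.Opens) (hi : V ≤ W i) (hj : V ≤ W j) (x : Γ(M, V)),
        (s i).app hi x = (s j).app hj x := fun i j V hi hj x =>
      congrArg (fun φ : Op M N (W i ⊓ W j) => φ.app (le_inf hi hj) x) (h i j)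
    have key : ∀ (V : X.Opens) (hV : V ≤ iSup W) (x : Γ(M, V)), ∃ y : Γ(N, V), ∀ i,
        res N (inf_le_left : V ⊓ W i ≤ V) y = (s i).app inf_le_right (res M inf_le_left x) := by
      intro V hV x
      refine res_glue N (fun i => V ⊓ W i) (fun i => inf_le_left) (hcov V hV) _ fun i j => ?_
      rw [Op.res_app, Op.res_app, res_res, res_res]
      exact hc i j _ _ _ _
    choose t ht using key
    have ht' : ∀ (V : X.Opens) (hV : V ≤ iSup W) (x : Γ(M, V)) (i) (Z : X.Opens) (hZ : Z ≤ V)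
        (hZi : Z ≤ W i), res N hZ (t V hV x) = (s i).app hZi (res M hZ x) := by
      intro V hV x i Z hZ hZi
      rw [← res_res N (inf_le_left : V ⊓ W i ≤ V) (le_inf hZ hZi), ht, Op.res_app, res_res]
    refine ⟨⟨fun V => AddMonoidHom.mk' (t V.1 V.2) fun x y => ?_, fun V V' hV h' x => ?_⟩,
      fun i => Op.ext fun V hV x => ?_⟩
    · refine res_ext N (fun i => V.1 ⊓ W i) (fun i => inf_le_left) (hcov V.1 V.2) _ _ fun i => ?_
      rw [ht, map_add, map_add, map_add, ht, ht]
    · refine res_ext N (fun i => V' ⊓ W i) (fun i => inf_le_left) (hcov V' (h'.trans hV)) _ _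
        fun i => ?_
      simp only [AddMonoidHom.mk'_apply]
      rw [res_res, ht' V hV x i _ _ inf_le_right, ht, res_res]
    · change t V _ x = _
      rw [← res_self N (t V _ x), ht' V _ x i V le_rfl hV, res_self]

end

section

variable {X : Scheme.{u}}

/-- Additive cochains of degree `i` over `U`: families of additive operators
`E^p|_U → E^q|_U`, one for each pair `(p, q)` with `p + i = q`. -/
abbrev Coch (E : CochainComplex X.Modules ℤ) (i : ℤ) (U : X.Opens) : Type u :=
  ∀ x : {x : ℤ × ℤ // x.1 + i = x.2}, Op (E.X x.1.1) (E.X x.1.2) U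

namespace Coch

variable {E : CochainComplex X.Modules ℤ} {U V : X.Opens} {i j k l m n : ℤ}

instance : AddCommGroup (Coch E i U) := inferInstance

instance : AddCommMonoid (Coch E i U) := inferInstance

instance : AddZeroClass (Coch E i U) := inferInstance

/-- The component `E^p|_U → E^q|_U` of a cochain. -/
def at' (u : Coch E i U) (p q : ℤ) (h : p + i = q) : Op (E.X p) (E.X q) U := u ⟨(p, q), h⟩

theorem ext {u v : Coch E i U} (h : ∀ p q (hpq : p + i = q), u.at' p q hpq = v.at' p q hpq) :
    u = v := funext fun ⟨⟨p, q⟩, hpq⟩ => h p q hpq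

/-- Composition of cochains. -/
def mul (h : i + j = k) (u : Coch E i U) (v : Coch E j U) : Coch E k U :=
  fun x => (u.at' (x.1.1 + j) x.1.2 (by have := x.2; omega)).comp (v.at' x.1.1 _ rfl)

theorem mul_at (h : i + j = k) (u : Coch E i U) (v : Coch E j U) (p q r : ℤ) (hpr : p + k = r)
    (hpq : p + j = q) (hqr : q + i = r) :
    (mul h u v).at' p r hpr = (u.at' q r hqr).comp (v.at' p q hpq) := by
  subst hpq; rfl

theorem mul_assoc (hij : i + j = l) (hjk : j + k = m) (h : l + k = n) (h' : i + m = n)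
    (u : Coch E i U) (v : Coch E j U) (w : Coch E k U) :
    mul h (mul hij u v) w = mul h' u (mul hjk v w) := by
  refine ext fun p s hps => ?_
  rw [mul_at h _ _ p (p + k) s hps rfl (by omega),
    mul_at hij _ _ (p + k) (p + k + j) s (by omega) rfl (by omega),
    mul_at h' _ _ p (p + k + j) s hps (by omega) (by omega),
    mul_at hjk _ _ p (p + k) (p + k + j) (by omega) rfl rfl]
  rfl

theorem add_mul (h : i + j = k) (u u' : Coch E i U) (v : Coch E j U) :
    mul h (u + u') v = mul h u v + mul h u' v := rfl

theorem mul_add (h : i + j = k) (u : Coch E i U) (v v' : Coch E j U) :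
    mul h u (v + v') = mul h u v + mul h u v' :=
  funext fun x => Op.ext fun _ hV _ => map_add ((u.at' (x.1.1 + j) x.1.2 _).app hV) _ _

theorem neg_mul (h : i + j = k) (u : Coch E i U) (v : Coch E j U) :
    mul h (-u) v = -mul h u v := rfl

theorem mul_neg (h : i + j = k) (u : Coch E i U) (v : Coch E j U) :
    mul h u (-v) = -mul h u v :=
  funext fun x => Op.ext fun _ hV _ => map_neg ((u.at' (x.1.1 + j) x.1.2 _).app hV) _

theorem sub_mul (h : i + j = k) (u u' : Coch E i U) (v : Coch E j U) :
    mul h (u - u') v = mul h u v - mul h u' v := rfl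

theorem mul_sub (h : i + j = k) (u : Coch E i U) (v v' : Coch E j U) :
    mul h u (v - v') = mul h u v - mul h u v' := by
  rw [sub_eq_add_neg, mul_add, mul_neg, ← sub_eq_add_neg]

theorem zero_mul (h : i + j = k) (v : Coch E j U) : mul h (0 : Coch E i U) v = 0 := rfl

theorem mul_zero (h : i + j = k) (u : Coch E i U) : mul h u (0 : Coch E j U) = 0 :=
  funext fun x => Op.ext fun _ hV _ => map_zero ((u.at' (x.1.1 + j) x.1.2 _).app hV)

/-- The graded commutator `[u, v] = u v - (-1)^{ij} v u`. -/
def br (h : i + j = k) (u : Coch E i U) (v : Coch E j U) : Coch E k U :=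
  mul h u v - (i * j).negOnePow • mul ((add_comm j i).trans h) v u

theorem br_at (h : i + j = k) (u : Coch E i U) (v : Coch E j U) (p r : ℤ) (hpr : p + k = r)
    {V : X.Opens} (hV : V ≤ U) (x : Γ(E.X p, V)) :
    ((br h u v).at' p r hpr).app hV x =
      (u.at' (p + j) r (by omega)).app hV ((v.at' p (p + j) rfl).app hV x) -
        (i * j).negOnePow •
          (v.at' (p + i) r (by omega)).app hV ((u.at' p (p + i) rfl).app hV x) := by
  rw [← Op.comp_app, ← Op.comp_app, ← mul_at h u v p _ r hpr, ← mul_at (by omega) v u p _ r hpr,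
    ← Op.app_zsmul_unit]
  rfl

theorem br_skew (h : i + j = k) (h' : j + i = k) (u : Coch E i U) (v : Coch E j U) :
    br h u v = -((i * j).negOnePow • br h' v u) := by
  unfold br
  rw [mul_comm j i]
  rcases Int.units_eq_one_or (i * j).negOnePow with e | e <;> rw [e] <;> simp

theorem br_self (hi : Even i) (h : i + i = k) (u : Coch E i U) : br h u u = 0 := by
  unfold br
  rw [Int.negOnePow_even _ (hi.mul_left i)]
  simp

theorem br_br_self (hi : Odd i) (h : i + i = k) (h' : i + k = l) (u : Coch E i U) :
    br h' u (br h u u) = 0 := by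
  have hk : Even k := h ▸ hi.add_odd hi
  unfold br
  rw [Int.negOnePow_even _ (hk.mul_left i), Int.negOnePow_odd _ (hi.mul hi)]
  simp only [one_smul, Units.neg_smul, sub_neg_eq_add, mul_add, add_mul]
  rw [mul_assoc h h ((add_comm k i).trans h') h']
  simp

theorem br_jacobi (hij : i + j = l) (hjk : j + k = m) {o : ℤ} (hik : i + k = o) (h : l + k = n)
    (h' : i + m = n) (h'' : j + o = n) (u : Coch E i U) (v : Coch E j U) (w : Coch E k U) :
    br h' u (br hjk v w) = br h (br hij u v) w +
      (i * j).negOnePow • br h'' v (br hik u w) := by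
  have hji := (add_comm j i).trans hij
  have hkj := (add_comm k j).trans hjk
  have hki := (add_comm k i).trans hik
  have hkl := (add_comm k l).trans h
  have hmi := (add_comm m i).trans h'
  have hoj := (add_comm o j).trans h''
  have e1 : (i * m).negOnePow = (i * j).negOnePow * (i * k).negOnePow := by
    rw [← hjk, _root_.mul_add, Int.negOnePow_add]
  have e2 : (l * k).negOnePow = (i * k).negOnePow * (j * k).negOnePow := by
    rw [← hij, _root_.add_mul, Int.negOnePow_add]
  have e3 : (j * o).negOnePow = (i * j).negOnePow * (j * k).negOnePow := by
    rw [← hik, _root_.mul_add, Int.negOnePow_add, mul_comm j i]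
  unfold br
  rw [e1, e2, e3]
  rcases Int.units_eq_one_or (i * j).negOnePow with a | a <;>
  rcases Int.units_eq_one_or (i * k).negOnePow with b | b <;>
  rcases Int.units_eq_one_or (j * k).negOnePow with c | c <;>
  · rw [a, b, c]
    simp only [one_smul, Units.neg_smul, mul_one, _root_.mul_neg, neg_neg,
      sub_mul, mul_sub, sub_neg_eq_add, mul_add, add_mul, smul_sub, smul_add]
    rw [mul_assoc hij hjk h h', mul_assoc hji hik h h'', mul_assoc hjk hki hmi h'',
      mul_assoc hkj hji hmi hkl, mul_assoc hik hkj hoj h', mul_assoc hki hij hoj hkl]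
    abel

end Coch

end

section

variable {X : Scheme.{u}} {A : Type u} [CommRing A]

/-- The ring homomorphism `A → Γ(X, U)` given by a scheme `X` over `A`. -/
def baseMap (f : X ⟶ Spec (CommRingCat.of A)) (U : X.Opens) : A →+* Γ(X, U) :=
  (resO (le_top : U ≤ ⊤)).comp (f.appTop.hom.comp (Scheme.ΓSpecIso (CommRingCat.of A)).inv.hom)

theorem resO_baseMap (f : X ⟶ Spec (CommRingCat.of A)) {U V : X.Opens} (h : V ≤ U) (a : A) :
    resO h (baseMap f U a) = baseMap f V a := resO_resO _ _ _

/-! ### Sheaves of Lie algebras and of DG-Lie algebras -/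

/-- A sheaf of DG-Lie algebras over `X/A`: a complex of sheaves of `𝒪_X`-modules with an `A`-bilinear
bracket (not `𝒪_X`-bilinear in general) satisfying the axioms of a DG-Lie algebra over `A` on
sections, equivalently on stalks. -/
structure DGLieSheaf (f : X ⟶ Spec (CommRingCat.of A)) where
  cx : CochainComplex X.Modules ℤ
  br : ∀ {i j k : ℤ}, i + j = k → ∀ U : X.Opens,
    Γ(cx.X i, U) →+ Γ(cx.X j, U) →+ Γ(cx.X k, U)
  res_br : ∀ {i j k : ℤ} (h : i + j = k) {U V : X.Opens} (hV : V ≤ U)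
    (x : Γ(cx.X i, U)) (y : Γ(cx.X j, U)),
    res (cx.X k) hV (br h U x y) = br h V (res (cx.X i) hV x) (res (cx.X j) hV y)
  smul_br : ∀ {i j k : ℤ} (h : i + j = k) {U : X.Opens} (a : A)
    (x : Γ(cx.X i, U)) (y : Γ(cx.X j, U)),
    br h U (baseMap f U a • x) y = baseMap f U a • br h U x y
  br_smul : ∀ {i j k : ℤ} (h : i + j = k) {U : X.Opens} (a : A)
    (x : Γ(cx.X i, U)) (y : Γ(cx.X j, U)),
    br h U x (baseMap f U a • y) = baseMap f U a • br h U x y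
  skew : ∀ {i j k : ℤ} (h : i + j = k) (h' : j + i = k) {U : X.Opens}
    (x : Γ(cx.X i, U)) (y : Γ(cx.X j, U)),
    br h U x y = -((i * j).negOnePow • br h' U y x)
  br_self : ∀ {i k : ℤ} (h : i + i = k), Even i → ∀ {U : X.Opens} (x : Γ(cx.X i, U)),
    br h U x x = 0
  br_br_self : ∀ {i k l : ℤ} (h : i + i = k) (h' : i + k = l), Odd i →
    ∀ {U : X.Opens} (x : Γ(cx.X i, U)), br h' U x (br h U x x) = 0
  jacobi : ∀ {i j k ij jk ik n : ℤ} (hij : i + j = ij) (hjk : j + k = jk) (hik : i + k = ik)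
    (h : ij + k = n) (h' : i + jk = n) (h'' : j + ik = n) {U : X.Opens}
    (x : Γ(cx.X i, U)) (y : Γ(cx.X j, U)) (z : Γ(cx.X k, U)),
    br h' U x (br hjk U y z) =
      br h U (br hij U x y) z + (i * j).negOnePow • br h'' U y (br hik U x z)
  leibniz : ∀ {i j k i' j' k' : ℤ} (_ : i + 1 = i') (_ : j + 1 = j') (_ : k + 1 = k')
    (h : i + j = k) (h₁ : i' + j = k') (h₂ : i + j' = k') {U : X.Opens}
    (x : Γ(cx.X i, U)) (y : Γ(cx.X j, U)),
    (cx.d k k').app U (br h U x y) =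
      br h₁ U ((cx.d i i').app U x) y + i.negOnePow • br h₂ U x ((cx.d j j').app U y)

/-- A morphism of sheaves of DG-Lie algebras: a morphism of complexes of `𝒪_X`-modules commuting with
the brackets. -/
structure DGLieSheaf.Hom {f : X ⟶ Spec (CommRingCat.of A)} (L M : DGLieSheaf f) where
  hom : L.cx ⟶ M.cx
  map_br : ∀ {i j k : ℤ} (h : i + j = k) {U : X.Opens} (x : Γ(L.cx.X i, U)) (y : Γ(L.cx.X j, U)),
    (hom.f k).app U (L.br h U x y) = M.br h U ((hom.f i).app U x) ((hom.f j).app U y)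

/-- A sheaf of Lie algebras over `X/A`: a sheaf of `𝒪_X`-modules with an `A`-bilinear Lie bracket. -/
structure LieSheaf (f : X ⟶ Spec (CommRingCat.of A)) where
  mod : X.Modules
  br : ∀ U : X.Opens, Γ(mod, U) →+ Γ(mod, U) →+ Γ(mod, U)
  res_br : ∀ {U V : X.Opens} (hV : V ≤ U) (x y : Γ(mod, U)),
    res mod hV (br U x y) = br V (res mod hV x) (res mod hV y)
  smul_br : ∀ {U : X.Opens} (a : A) (x y : Γ(mod, U)),
    br U (baseMap f U a • x) y = baseMap f U a • br U x y
  br_self : ∀ {U : X.Opens} (x : Γ(mod, U)), br U x x = 0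
  jacobi : ∀ {U : X.Opens} (x y z : Γ(mod, U)),
    br U x (br U y z) = br U (br U x y) z + br U y (br U x z)

namespace LieSheaf

variable {f : X ⟶ Spec (CommRingCat.of A)} (L : LieSheaf f)

theorem skew {U : X.Opens} (x y : Γ(L.mod, U)) : L.br U x y = -L.br U y x := by
  have := L.br_self (x + y)
  simp only [map_add, AddMonoidHom.add_apply, L.br_self, zero_add, add_zero] at this
  rw [eq_neg_iff_add_eq_zero, add_comm]; exact this

/-- The complex with a single sheaf, in degree zero. -/
abbrev cx₀ (M : X.Modules) : CochainComplex X.Modules ℤ :=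
  (HomologicalComplex.single X.Modules (ComplexShape.up ℤ) 0).obj M

open Classical in
/-- The projection of the terms of the complex `M[0]` to `M`; zero in nonzero degree. -/
def proj (M : X.Modules) (i : ℤ) : (cx₀ M).X i ⟶ M :=
  if h : i = 0 then (HomologicalComplex.singleObjXIsoOfEq (ComplexShape.up ℤ) 0 M i h).hom else 0

open Classical in
/-- The inclusion of `M` in the terms of the complex `M[0]`; zero in nonzero degree. -/
def incl (M : X.Modules) (i : ℤ) : M ⟶ (cx₀ M).X i :=
  if h : i = 0 then (HomologicalComplex.singleObjXIsoOfEq (ComplexShape.up ℤ) 0 M i h).inv else 0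

theorem proj_ne (M : X.Modules) {i : ℤ} (h : i ≠ 0) : proj M i = 0 := dif_neg h

theorem incl_ne (M : X.Modules) {i : ℤ} (h : i ≠ 0) : incl M i = 0 := dif_neg h

theorem proj_incl (M : X.Modules) {U : X.Opens} (x : Γ(M, U)) :
    (proj M 0).app U ((incl M 0).app U x) = x := by
  rw [← AddCommGrpCat.comp_apply, ← Scheme.Modules.Hom.comp_app]
  simp [proj, incl]

theorem incl_proj (M : X.Modules) (i : ℤ) {U : X.Opens} (x : Γ((cx₀ M).X i, U)) :
    (incl M i).app U ((proj M i).app U x) = x := by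
  rw [← AddCommGrpCat.comp_apply, ← Scheme.Modules.Hom.comp_app]
  by_cases h : i = 0
  · simp [proj, incl, h]
  · have : 𝟙 ((cx₀ M).X i) = 0 :=
      (HomologicalComplex.isZero_single_obj_X (ComplexShape.up ℤ) 0 M i h).eq_of_src _ _
    have e : proj M i ≫ incl M i = 𝟙 _ := by rw [this]; simp [proj, incl, h]
    rw [e]; rfl

theorem res_hom {M N : X.Modules} (g : M ⟶ N) {U V : X.Opens} (h : V ≤ U) (x : Γ(M, U)) :
    res N h (g.app U x) = g.app V (res M h x) :=
  (Op.ofHom g U).res_app le_rfl h x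

theorem proj_incl' (M : X.Modules) {i : ℤ} (hi : i = 0) {U : X.Opens} (x : Γ(M, U)) :
    (proj M i).app U ((incl M i).app U x) = x := by
  subst hi; exact proj_incl M x

/-- The bracket of a sheaf of Lie algebras, on the complex concentrated in degree zero. -/
def brDG (i j k : ℤ) (U : X.Opens) :
    Γ((cx₀ L.mod).X i, U) →+ Γ((cx₀ L.mod).X j, U) →+ Γ((cx₀ L.mod).X k, U) :=
  AddMonoidHom.mk' (fun x => AddMonoidHom.mk' (fun y =>
    (incl L.mod k).app U (L.br U ((proj L.mod i).app U x) ((proj L.mod j).app U y)))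
      (by simp)) (fun x y => by ext; simp)

theorem brDG_apply (i j k : ℤ) (U : X.Opens) (x : Γ((cx₀ L.mod).X i, U))
    (y : Γ((cx₀ L.mod).X j, U)) : L.brDG i j k U x y =
      (incl L.mod k).app U (L.br U ((proj L.mod i).app U x) ((proj L.mod j).app U y)) := rfl

theorem brDG_left {i : ℤ} (hi : i ≠ 0) (j k : ℤ) (U : X.Opens) (x : Γ((cx₀ L.mod).X i, U))
    (y : Γ((cx₀ L.mod).X j, U)) : L.brDG i j k U x y = 0 := by
  simp [brDG_apply, proj_ne _ hi]

theorem brDG_right {j : ℤ} (hj : j ≠ 0) (i k : ℤ) (U : X.Opens) (x : Γ((cx₀ L.mod).X i, U))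
    (y : Γ((cx₀ L.mod).X j, U)) : L.brDG i j k U x y = 0 := by
  simp [brDG_apply, proj_ne _ hj]

/-- A sheaf of Lie algebras, as a sheaf of DG-Lie algebras concentrated in degree zero. -/
def toDG : DGLieSheaf f where
  cx := cx₀ L.mod
  br {i j k} _ U := L.brDG i j k U
  res_br h U V hV x y := by simp only [brDG_apply, res_hom, L.res_br]
  smul_br h U a x y := by simp only [brDG_apply, Scheme.Modules.Hom.app_smul, L.smul_br]
  br_smul h U a x y := by
    simp only [brDG_apply, Scheme.Modules.Hom.app_smul]
    rw [L.skew, L.smul_br, L.skew ((proj L.mod _).app U x), map_neg, map_neg,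
      Scheme.Modules.Hom.app_smul, smul_neg]
  skew {i j k} h h' U x y := by
    by_cases hi : i = 0
    · have e : (i * j).negOnePow = 1 := by simp [hi]
      rw [e, one_smul, brDG_apply, brDG_apply, L.skew, map_neg]
    · rw [brDG_left _ hi, brDG_right _ hi, smul_zero, neg_zero]
  br_self h hi U x := by rw [brDG_apply, L.br_self, map_zero]
  br_br_self {i k l} h h' hi U x := by
    have : i ≠ 0 := by rintro rfl; simp at hi
    rw [brDG_left _ this]
  jacobi {i j k ij jk ik n} hij hjk hik h h' h'' U x y z := by
    by_cases hi : i = 0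
    · by_cases hj : j = 0
      · by_cases hk : k = 0
        · have e : (i * j).negOnePow = 1 := by simp [hi]
          simp only [brDG_apply]
          rw [e, one_smul, proj_incl' _ (by omega : jk = 0), proj_incl' _ (by omega : ij = 0),
            proj_incl' _ (by omega : ik = 0), L.jacobi, map_add]
        · rw [brDG_right _ hk, brDG_right _ hk, brDG_right _ hk]; simp
      · rw [brDG_left _ hj, brDG_right _ hj, brDG_left _ hj]; simp
    · rw [brDG_left _ hi, brDG_left _ hi, brDG_left _ hi]; simp
  leibniz {i j k i' j' k'} _ _ _ h h₁ h₂ U x y := by simp [cx₀]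

end LieSheaf

/-- A coherent sheaf (on a noetherian scheme): quasi-coherent and of finite type. -/
def IsCoherent (M : X.Modules) : Prop :=
  SheafOfModules.IsQuasicoherent (R := X.ringCatSheaf) M ∧
    SheafOfModules.IsFiniteType (R := X.ringCatSheaf) M

/-- A sheaf of DG-Lie algebras is coherent if all its terms are coherent and only finitely many of
them are nonzero; on a quasi-compact scheme this means that the direct sum of the terms is
coherent. -/
def DGLieSheaf.Coherent {f : X ⟶ Spec (CommRingCat.of A)} (L : DGLieSheaf f) : Prop :=
  (∀ i, IsCoherent (L.cx.X i)) ∧ {i | ¬ Limits.IsZero (L.cx.X i)}.Finite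

end

section

variable {X : Scheme.{u}} {A : Type u} [CommRing A]

/-! ### Functions, derivations, linear operators, pairs -/

variable (X) in
/-- The structure sheaf as a module over itself. -/
def OO : X.Modules := SheafOfModules.unit X.ringCatSheaf

/-- Sections of the structure sheaf are functions. -/
def fn (U : X.Opens) : Γ(OO X, U) ≃+ Γ(X, U) := ⟨Equiv.refl _, fun _ _ => rfl⟩

theorem fn_smul {U : X.Opens} (a : Γ(X, U)) (x : Γ(OO X, U)) : fn U (a • x) = a * fn U x := rfl

theorem fn_res {U V : X.Opens} (h : V ≤ U) (x : Γ(OO X, U)) :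
    fn V (res (OO X) h x) = resO h (fn U x) := rfl

namespace Op

variable {M N K : X.Modules} {U V W : X.Opens}

/-- The action on functions of an operator `𝒪_U → 𝒪_U`. -/
def onFun (h : Op (OO X) (OO X) U) (hV : V ≤ U) : Γ(X, V) →+ Γ(X, V) :=
  ((fn V).toAddMonoidHom.comp (h.app hV)).comp (fn V).symm.toAddMonoidHom

theorem fn_app (h : Op (OO X) (OO X) U) (hV : V ≤ U) (x : Γ(OO X, V)) :
    fn V (h.app hV x) = h.onFun hV (fn V x) := rfl

theorem resO_onFun (h : Op (OO X) (OO X) U) (hV : V ≤ U) (hW : W ≤ V) (a : Γ(X, V)) :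
    resO hW (h.onFun hV a) = h.onFun (hW.trans hV) (resO hW a) := h.res_app hV hW a

@[simp] theorem onFun_add (h k : Op (OO X) (OO X) U) (hV : V ≤ U) (a : Γ(X, V)) :
    (h + k).onFun hV a = h.onFun hV a + k.onFun hV a := rfl

@[simp] theorem onFun_sub (h k : Op (OO X) (OO X) U) (hV : V ≤ U) (a : Γ(X, V)) :
    (h - k).onFun hV a = h.onFun hV a - k.onFun hV a := rfl

@[simp] theorem onFun_zero (hV : V ≤ U) (a : Γ(X, V)) :
    (0 : Op (OO X) (OO X) U).onFun hV a = 0 := rfl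

@[simp] theorem onFun_smul (b : Γ(X, U)) (h : Op (OO X) (OO X) U) (hV : V ≤ U) (a : Γ(X, V)) :
    (b • h).onFun hV a = resO hV b * h.onFun hV a := rfl

@[simp] theorem onFun_comp (h k : Op (OO X) (OO X) U) (hV : V ≤ U) (a : Γ(X, V)) :
    (h.comp k).onFun hV a = h.onFun hV (k.onFun hV a) := rfl

@[simp] theorem onFun_restrict (hVU : V ≤ U) (h : Op (OO X) (OO X) U) (hW : W ≤ V) (a : Γ(X, W)) :
    (restrict hVU h).onFun hW a = h.onFun (hW.trans hVU) a := rfl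

/-- `h` is an `A`-linear derivation of the structure sheaf: it is additive, satisfies the Leibniz
rule and vanishes on the image of `A`. -/
structure IsDer (f : X ⟶ Spec (CommRingCat.of A)) (h : Op (OO X) (OO X) U) : Prop where
  mul : ∀ (V : X.Opens) (hV : V ≤ U) (a b : Γ(X, V)),
    h.onFun hV (a * b) = a * h.onFun hV b + b * h.onFun hV a
  base : ∀ (V : X.Opens) (hV : V ≤ U) (a : A), h.onFun hV (baseMap f V a) = 0

/-- `u` is `𝒪_X`-linear. -/
def IsLin (u : Op M N U) : Prop :=
  ∀ (V : X.Opens) (hV : V ≤ U) (a : Γ(X, V)) (m : Γ(M, V)), u.app hV (a • m) = a • u.app hV m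

/-- The condition `u (r m) - r u (m) = h (r) m` on a pair `(h, u)`. -/
def IsPair (h : Op (OO X) (OO X) U) (u : Op M M U) : Prop :=
  ∀ (V : X.Opens) (hV : V ≤ U) (a : Γ(X, V)) (m : Γ(M, V)),
    u.app hV (a • m) - a • u.app hV m = h.onFun hV a • m

theorem IsPair.app_smul {h : Op (OO X) (OO X) U} {u : Op M M U} (hu : IsPair h u) (hV : V ≤ U)
    (a : Γ(X, V)) (m : Γ(M, V)) : u.app hV (a • m) = a • u.app hV m + h.onFun hV a • m :=
  sub_eq_iff_eq_add'.1 (hu V hV a m)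

/-- In a derivation of a pair, the operator on the module is automatically `A`-linear. -/
theorem IsPair.app_base_smul {f : X ⟶ Spec (CommRingCat.of A)} {h : Op (OO X) (OO X) U}
    (hh : IsDer f h) {u : Op M M U} (hu : IsPair h u) (hV : V ≤ U) (a : A) (m : Γ(M, V)) :
    u.app hV (baseMap f V a • m) = baseMap f V a • u.app hV m := by
  rw [hu.app_smul, hh.base, zero_smul, add_zero]

theorem isPair_zero {u : Op M M U} : IsPair 0 u ↔ IsLin u := by
  simp [IsPair, IsLin, sub_eq_zero]

/-- The commutator of two operators. -/
def comm (u v : Op M M U) : Op M M U := u.comp v - v.comp u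

@[simp] theorem comm_app (u v : Op M M U) (hV : V ≤ U) (m : Γ(M, V)) :
    (comm u v).app hV m = u.app hV (v.app hV m) - v.app hV (u.app hV m) := rfl

@[simp] theorem comm_onFun (u v : Op (OO X) (OO X) U) (hV : V ≤ U) (m : Γ(X, V)) :
    (comm u v).onFun hV m = u.onFun hV (v.onFun hV m) - v.onFun hV (u.onFun hV m) := rfl

theorem comm_self (u : Op M M U) : comm u u = 0 := sub_self _

theorem comm_skew (u v : Op M M U) : comm u v = -comm v u := (neg_sub _ _).symm

theorem comm_jacobi (u v w : Op M M U) :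
    comm u (comm v w) = comm (comm u v) w + comm v (comm u w) :=
  ext fun V hV m => by simp only [comm_app, add_app, map_sub]; abel

theorem comm_zero (u : Op M M U) : comm u 0 = 0 := ext fun V hV m => by simp

theorem zero_comm (u : Op M M U) : comm 0 u = 0 := ext fun V hV m => by simp

theorem comm_add (u v w : Op M M U) : comm u (v + w) = comm u v + comm u w :=
  ext fun V hV m => by simp only [comm_app, add_app, map_add]; abel

theorem add_comm' (u v w : Op M M U) : comm (u + v) w = comm u w + comm v w :=
  ext fun V hV m => by simp only [comm_app, add_app, map_add]; abel

theorem IsDer.comm {f : X ⟶ Spec (CommRingCat.of A)} {h k : Op (OO X) (OO X) U} (hh : IsDer f h)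
    (hk : IsDer f k) : IsDer f (comm h k) where
  mul V hV a b := by simp only [comm_onFun, hh.mul, hk.mul, map_add]; ring
  base V hV a := by simp [hh.base, hk.base]

theorem IsPair.comm {h k : Op (OO X) (OO X) U} {u v : Op M M U} (hu : IsPair h u)
    (hv : IsPair k v) : IsPair (comm h k) (comm u v) := fun V hV a m => by
  simp only [comm_app, comm_onFun, hu.app_smul, hv.app_smul, map_add, smul_sub, sub_smul]
  abel

theorem IsDer.restrict {f : X ⟶ Spec (CommRingCat.of A)} {h : Op (OO X) (OO X) U} (hh : IsDer f h)
    (hV : V ≤ U) : IsDer f (restrict hV h) :=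
  ⟨fun W hW => hh.mul W (hW.trans hV), fun W hW => hh.base W (hW.trans hV)⟩

theorem IsPair.restrict {h : Op (OO X) (OO X) U} {u : Op M M U} (hu : IsPair h u) (hV : V ≤ U) :
    IsPair (restrict hV h) (restrict hV u) := fun W hW => hu W (hW.trans hV)

theorem IsLin.restrict {u : Op M N U} (hu : IsLin u) (hV : V ≤ U) :
    IsLin (restrict hV u) := fun W hW => hu W (hW.trans hV)

/-- An identity of sections may be checked on the members of an open cover. -/
theorem local_eq {ι : Type u} {W : ι → X.Opens} {V : X.Opens} (hV : V ≤ iSup W) {s t : Γ(N, V)}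
    (h : ∀ i, res N (inf_le_left : V ⊓ W i ≤ V) s = res N inf_le_left t) : s = t :=
  res_ext N (fun i => V ⊓ W i) (fun _ => inf_le_left)
    (by rw [← inf_iSup_eq]; exact le_inf le_rfl hV) s t h

theorem IsDer.of_local {f : X ⟶ Spec (CommRingCat.of A)} {ι : Type u} {W : ι → X.Opens}
    {h : Op (OO X) (OO X) (iSup W)} (hh : ∀ i, IsDer f (Op.restrict (le_iSup W i) h)) :
    IsDer f h where
  mul V hV a b := by
    apply (fn V).symm.injective
    refine local_eq hV fun i => ?_
    have := (hh i).mul (V ⊓ W i) inf_le_right (resO inf_le_left a) (resO inf_le_left b)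
    simp only [onFun_restrict] at this
    rw [← map_mul, ← resO_onFun, ← resO_onFun, ← resO_onFun, ← map_mul, ← map_mul, ← map_add]
      at this
    exact this
  base V hV a := by
    apply (fn V).symm.injective
    refine local_eq hV fun i => ?_
    have := (hh i).base (V ⊓ W i) inf_le_right a
    simp only [onFun_restrict] at this
    rw [← resO_baseMap f inf_le_left, ← resO_onFun h hV] at this
    exact this.trans (map_zero _).symm

theorem IsPair.of_local {ι : Type u} {W : ι → X.Opens} {h : Op (OO X) (OO X) (iSup W)}
    {u : Op M M (iSup W)}
    (hu : ∀ i, IsPair (Op.restrict (le_iSup W i) h) (Op.restrict (le_iSup W i) u)) :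
    IsPair h u := fun V hV a m => by
  refine local_eq hV fun i => ?_
  have := hu i (V ⊓ W i) inf_le_right (resO inf_le_left a) (res M inf_le_left m)
  simp only [onFun_restrict, restrict_app] at this
  rw [map_sub, res_smul, res_smul, res_app, res_app, res_smul, resO_onFun, this]

theorem IsLin.of_local {ι : Type u} {W : ι → X.Opens} {u : Op M N (iSup W)}
    (hu : ∀ i, IsLin (Op.restrict (le_iSup W i) u)) : IsLin u := fun V hV a m => by
  refine local_eq hV fun i => ?_
  have := hu i (V ⊓ W i) inf_le_right (resO inf_le_left a) (res M inf_le_left m)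
  simp only [restrict_app] at this
  rw [res_smul, res_app, res_app, res_smul, this]

theorem IsLin.comp {v : Op N K U} {u : Op M N U} (hv : IsLin v) (hu : IsLin u) :
    IsLin (v.comp u) := fun V hV a m => by simp [hu V hV, hv V hV]

theorem IsLin.add {u v : Op M N U} (hu : IsLin u) (hv : IsLin v) : IsLin (u + v) :=
  fun V hV a m => by simp [hu V hV, hv V hV]

theorem IsLin.sub {u v : Op M N U} (hu : IsLin u) (hv : IsLin v) : IsLin (u - v) :=
  fun V hV a m => by simp [hu V hV, hv V hV, smul_sub]

theorem isLin_zero : IsLin (0 : Op M N U) := fun V hV a m => by simp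

theorem IsLin.smul (b : Γ(X, U)) {u : Op M N U} (hu : IsLin u) : IsLin (b • u) :=
  fun V hV a m => by simp only [smul_app, hu V hV]; rw [smul_comm]

theorem IsLin.neg {u : Op M N U} (hu : IsLin u) : IsLin (-u) :=
  fun V hV a m => by simp [hu V hV]

theorem IsLin.units_smul (ε : ℤˣ) {u : Op M N U} (hu : IsLin u) : IsLin (ε • u) := by
  rcases Int.units_eq_one_or ε with rfl | rfl
  · simpa using hu
  · simpa using hu.neg

theorem isLin_ofHom (g : M ⟶ N) : IsLin (ofHom g U) := fun _ _ a m =>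
  Scheme.Modules.Hom.app_smul g a m

theorem isDer_zero (f : X ⟶ Spec (CommRingCat.of A)) : IsDer f (0 : Op (OO X) (OO X) U) where
  mul V hV a b := by simp
  base V hV a := by simp

theorem IsDer.add {f : X ⟶ Spec (CommRingCat.of A)} {h k : Op (OO X) (OO X) U} (hh : IsDer f h)
    (hk : IsDer f k) : IsDer f (h + k) where
  mul V hV a b := by simp only [onFun_add, hh.mul, hk.mul]; ring
  base V hV a := by simp [hh.base, hk.base]

theorem IsDer.smul {f : X ⟶ Spec (CommRingCat.of A)} (c : Γ(X, U)) {h : Op (OO X) (OO X) U}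
    (hh : IsDer f h) : IsDer f (c • h) where
  mul V hV a b := by simp only [onFun_smul, hh.mul]; ring
  base V hV a := by simp [hh.base]

theorem isPair_add {h k : Op (OO X) (OO X) U} {u v : Op M M U} (hu : IsPair h u)
    (hv : IsPair k v) : IsPair (h + k) (u + v) := fun V hV a m => by
  simp only [add_app, onFun_add, hu.app_smul, hv.app_smul, smul_add, add_smul]; abel

theorem IsPair.smul (c : Γ(X, U)) {h : Op (OO X) (OO X) U} {u : Op M M U} (hu : IsPair h u) :
    IsPair (c • h) (c • u) := fun V hV a m => by
  simp only [smul_app, onFun_smul, hu.app_smul, smul_add, mul_smul]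
  rw [smul_comm a]; abel

/-- A derivation `h` gives the derivation `(h, h)` of the pair `(𝒪_X, 𝒪_X)`. -/
theorem IsDer.isPair {f : X ⟶ Spec (CommRingCat.of A)} {h : Op (OO X) (OO X) U} (hh : IsDer f h) :
    IsPair h h := fun V hV a m => by
  apply (fn V).injective
  have e := hh.mul V hV a (fn V m)
  rw [map_sub, fn_app, fn_smul, fn_smul, fn_app, fn_smul, e]; ring

theorem smul_comm_base {f : X ⟶ Spec (CommRingCat.of A)} (a : A) (u v : Op M M U)
    (hv : ∀ (V : X.Opens) (hV : V ≤ U) (m : Γ(M, V)),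
      v.app hV (baseMap f V a • m) = baseMap f V a • v.app hV m) :
    Op.comm (baseMap f U a • u) v = baseMap f U a • Op.comm u v := ext fun V hV m => by
  simp only [comm_app, smul_app, resO_baseMap, hv, smul_sub]

end Op

/-! ### The tangent sheaf -/

/-- The relative tangent sheaf: `A`-linear derivations of the structure sheaf. -/
def thetaData (f : X ⟶ Spec (CommRingCat.of A)) : SheafData X :=
  (opData (OO X) (OO X)).sub
    (fun U =>
      { carrier := {h : Op (OO X) (OO X) U | Op.IsDer f h}
        zero_mem' := Op.isDer_zero f
        add_mem' := Op.IsDer.add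
        smul_mem' := fun a _ hh => Op.IsDer.smul a hh })
    (fun hV _ hh => Op.IsDer.restrict hh hV)
    (fun _ _ hh => Op.IsDer.of_local hh)

/-- Sections of the tangent sheaf. -/
abbrev Der (f : X ⟶ Spec (CommRingCat.of A)) (U : X.Opens) : Type u := (thetaData f).S U

/-- The tangent sheaf as a sheaf of Lie algebras. -/
def theta (f : X ⟶ Spec (CommRingCat.of A)) : LieSheaf f where
  mod := (thetaData f).toModules
  br U := AddMonoidHom.mk' (fun h : Der f U => AddMonoidHom.mk' (fun k : Der f U =>
      (⟨Op.comm h.1 k.1, h.2.comm k.2⟩ : Der f U))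
      (fun _ _ => Subtype.ext (Op.comm_add _ _ _)))
      (fun _ _ => AddMonoidHom.ext fun _ => Subtype.ext (Op.add_comm' _ _ _))
  res_br hV h k := rfl
  smul_br {U} a h k := Subtype.ext (Op.smul_comm_base a _ _ fun _ hV m =>
    (Op.IsDer.isPair k.2).app_base_smul k.2 hV a m)
  br_self h := Subtype.ext (Op.comm_self _)
  jacobi h k l := Subtype.ext (Op.comm_jacobi _ _ _)


/-! ### Derivations of a pair (scheme, sheaf of modules) -/

/-- The sheaf of `A`-derivations of the pair `(X, M)`: pairs `(h, u)` of an `A`-linear derivation of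
`𝒪_X` and an (automatically `A`-linear) operator on `M` with `u (r m) - r u (m) = h (r) m`. -/
def pairData (f : X ⟶ Spec (CommRingCat.of A)) (M : X.Modules) : SheafData X :=
  ((opData (OO X) (OO X)).prod (opData M M)).sub
    (fun U =>
      { carrier := {x : Op (OO X) (OO X) U × Op M M U | Op.IsDer f x.1 ∧ Op.IsPair x.1 x.2}
        zero_mem' := ⟨Op.isDer_zero f, Op.isPair_zero.2 Op.isLin_zero⟩
        add_mem' := fun hx hy => ⟨Op.IsDer.add hx.1 hy.1, Op.isPair_add hx.2 hy.2⟩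
        smul_mem' := fun a _ hx => ⟨Op.IsDer.smul a hx.1, Op.IsPair.smul a hx.2⟩ })
    (fun hV _ hx => ⟨Op.IsDer.restrict hx.1 hV, Op.IsPair.restrict hx.2 hV⟩)
    (fun _ _ hx => ⟨Op.IsDer.of_local fun i => (hx i).1, Op.IsPair.of_local fun i => (hx i).2⟩)

/-- Derivations of the pair `(U, M|_U)`. -/
abbrev PairDer (f : X ⟶ Spec (CommRingCat.of A)) (M : X.Modules) (U : X.Opens) : Type u :=
  (pairData f M).S U

/-- The derivation of the structure sheaf in a derivation of a pair. -/
def PairDer.der {f : X ⟶ Spec (CommRingCat.of A)} {M : X.Modules} {U : X.Opens}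
    (x : PairDer f M U) : Op (OO X) (OO X) U := x.1.1

/-- The operator on the module in a derivation of a pair. -/
def PairDer.op {f : X ⟶ Spec (CommRingCat.of A)} {M : X.Modules} {U : X.Opens}
    (x : PairDer f M U) : Op M M U := x.1.2

/-- The sheaf of derivations of a pair as a sheaf of Lie algebras. -/
def pairLie (f : X ⟶ Spec (CommRingCat.of A)) (M : X.Modules) : LieSheaf f where
  mod := (pairData f M).toModules
  br U := AddMonoidHom.mk' (fun x : PairDer f M U => AddMonoidHom.mk' (fun y : PairDer f M U =>
      (⟨(Op.comm x.1.1 y.1.1, Op.comm x.1.2 y.1.2), x.2.1.comm y.2.1, x.2.2.comm y.2.2⟩ :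
        PairDer f M U))
      (fun _ _ => Subtype.ext (Prod.ext (Op.comm_add _ _ _) (Op.comm_add _ _ _))))
      (fun _ _ => AddMonoidHom.ext fun _ =>
        Subtype.ext (Prod.ext (Op.add_comm' _ _ _) (Op.add_comm' _ _ _)))
  res_br _ _ _ := rfl
  smul_br {U} a x y := Subtype.ext (Prod.ext
    (Op.smul_comm_base a _ _ fun _ hV m => (Op.IsDer.isPair y.2.1).app_base_smul y.2.1 hV a m)
    (Op.smul_comm_base a _ _ fun _ hV m => y.2.2.app_base_smul y.2.1 hV a m))
  br_self x := Subtype.ext (Prod.ext (Op.comm_self _) (Op.comm_self _))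
  jacobi x y z := Subtype.ext (Prod.ext (Op.comm_jacobi _ _ _) (Op.comm_jacobi _ _ _))

/-- The structure sheaf with the trivial bracket. -/
def trivialLie (f : X ⟶ Spec (CommRingCat.of A)) : LieSheaf f where
  mod := OO X
  br _ := 0
  res_br _ _ _ := map_zero _
  smul_br _ _ _ := (smul_zero _).symm
  br_self _ := rfl
  jacobi _ _ _ := (add_zero _).symm

/-- The sheaf of `𝒪_X`-linear maps `M → N`. -/
def linData (M N : X.Modules) : SheafData X :=
  (opData M N).sub
    (fun U =>
      { carrier := {u : Op M N U | Op.IsLin u}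
        zero_mem' := Op.isLin_zero
        add_mem' := Op.IsLin.add
        smul_mem' := fun a _ hu => Op.IsLin.smul a hu })
    (fun hV _ hu => Op.IsLin.restrict hu hV)
    (fun _ _ hu => Op.IsLin.of_local hu)

/-- The dual of a sheaf of modules. -/
def dual (M : X.Modules) : X.Modules := (linData M (OO X)).toModules

end

section

variable {X : Scheme.{u}} {A : Type u} [CommRing A]

/-! ### Complexes of sheaves given by sections -/

/-- A complex of sheaves of modules presented concretely. -/
structure CxData (X : Scheme.{u}) where
  D : ℤ → SheafData X
  d : ∀ {i j : ℤ}, i + 1 = j → ∀ U : X.Opens, (D i).S U →+ (D j).S U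
  d_smul : ∀ {i j : ℤ} (h : i + 1 = j) (U : X.Opens) (a : Γ(X, U)) (x : (D i).S U),
    d h U (a • x) = a • d h U x
  r_d : ∀ {i j : ℤ} (h : i + 1 = j) {U V : X.Opens} (hV : V ≤ U) (x : (D i).S U),
    (D j).r hV (d h U x) = d h V ((D i).r hV x)
  d_d : ∀ {i j k : ℤ} (h : i + 1 = j) (h' : j + 1 = k) (U : X.Opens) (x : (D i).S U),
    d h' U (d h U x) = 0

/-- The associated cochain complex. -/
def CxData.toCx (C : CxData X) : CochainComplex X.Modules ℤ where
  X i := (C.D i).toModules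
  d i j := if h : i + 1 = j then homMk (C.d h) (C.d_smul h) (C.r_d h) else 0
  shape _ _ h := dif_neg h
  d_comp_d' i j k h h' := by
    change i + 1 = j at h
    change j + 1 = k at h'
    rw [dif_pos h, dif_pos h']
    ext U x
    exact C.d_d h h' U x

theorem CxData.toCx_d_app (C : CxData X) {i j : ℤ} (h : i + 1 = j) (U : X.Opens)
    (x : (C.D i).S U) : (C.toCx.d i j).app U x = C.d h U x := by
  change (dite _ _ _ : (C.D i).toModules ⟶ (C.D j).toModules).app U x = _
  rw [dif_pos h]
  rfl

/-- A sheaf of DG-Lie algebras presented concretely. -/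
structure DGData (f : X ⟶ Spec (CommRingCat.of A)) (C : CxData X) where
  br : ∀ {i j k : ℤ}, i + j = k → ∀ U : X.Opens, (C.D i).S U → (C.D j).S U → (C.D k).S U
  add_br : ∀ {i j k : ℤ} (h : i + j = k) (U : X.Opens) (x x' : (C.D i).S U) (y : (C.D j).S U),
    br h U (x + x') y = br h U x y + br h U x' y
  br_add : ∀ {i j k : ℤ} (h : i + j = k) (U : X.Opens) (x : (C.D i).S U) (y y' : (C.D j).S U),
    br h U x (y + y') = br h U x y + br h U x y'
  res_br : ∀ {i j k : ℤ} (h : i + j = k) {U V : X.Opens} (hV : V ≤ U) (x : (C.D i).S U)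
    (y : (C.D j).S U), (C.D k).r hV (br h U x y) = br h V ((C.D i).r hV x) ((C.D j).r hV y)
  smul_br : ∀ {i j k : ℤ} (h : i + j = k) {U : X.Opens} (a : A) (x : (C.D i).S U)
    (y : (C.D j).S U), br h U (baseMap f U a • x) y = baseMap f U a • br h U x y
  br_smul : ∀ {i j k : ℤ} (h : i + j = k) {U : X.Opens} (a : A) (x : (C.D i).S U)
    (y : (C.D j).S U), br h U x (baseMap f U a • y) = baseMap f U a • br h U x y
  skew : ∀ {i j k : ℤ} (h : i + j = k) (h' : j + i = k) {U : X.Opens} (x : (C.D i).S U)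
    (y : (C.D j).S U), br h U x y = -((i * j).negOnePow • br h' U y x)
  br_self : ∀ {i k : ℤ} (h : i + i = k), Even i → ∀ {U : X.Opens} (x : (C.D i).S U),
    br h U x x = 0
  br_br_self : ∀ {i k l : ℤ} (h : i + i = k) (h' : i + k = l), Odd i → ∀ {U : X.Opens}
    (x : (C.D i).S U), br h' U x (br h U x x) = 0
  jacobi : ∀ {i j k ij jk ik n : ℤ} (hij : i + j = ij) (hjk : j + k = jk) (hik : i + k = ik)
    (h : ij + k = n) (h' : i + jk = n) (h'' : j + ik = n) {U : X.Opens} (x : (C.D i).S U)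
    (y : (C.D j).S U) (z : (C.D k).S U),
    br h' U x (br hjk U y z) =
      br h U (br hij U x y) z + (i * j).negOnePow • br h'' U y (br hik U x z)
  leibniz : ∀ {i j k i' j' k' : ℤ} (hi : i + 1 = i') (hj : j + 1 = j') (hk : k + 1 = k')
    (h : i + j = k) (h₁ : i' + j = k') (h₂ : i + j' = k') {U : X.Opens} (x : (C.D i).S U)
    (y : (C.D j).S U),
    C.d hk U (br h U x y) = br h₁ U (C.d hi U x) y + i.negOnePow • br h₂ U x (C.d hj U y)

/-- The associated sheaf of DG-Lie algebras. -/
def DGData.toDG {f : X ⟶ Spec (CommRingCat.of A)} {C : CxData X} (L : DGData f C) :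
    DGLieSheaf f where
  cx := C.toCx
  br {i j k} h U := AddMonoidHom.mk' (fun x : (C.D i).S U =>
    AddMonoidHom.mk' (fun y : (C.D j).S U => (L.br h U x y : (C.D k).S U)) (L.br_add h U x))
    fun x x' => AddMonoidHom.ext fun y => L.add_br h U x x' y
  res_br h _ _ hV x y := L.res_br h hV x y
  smul_br h _ a x y := L.smul_br h a x y
  br_smul h _ a x y := L.br_smul h a x y
  skew h h' _ x y := L.skew h h' x y
  br_self h hi _ x := L.br_self h hi x
  br_br_self h h' hi _ x := L.br_br_self h h' hi x
  jacobi hij hjk hik h h' h'' _ x y z := L.jacobi hij hjk hik h h' h'' x y z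
  leibniz {i j k i' j' k'} hi hj hk h h₁ h₂ U x y := by
    refine (C.toCx_d_app hk U (L.br h U x y)).trans ((L.leibniz hi hj hk h h₁ h₂ x y).trans ?_)
    exact congrArg₂ (fun (s : (C.D i').S U) (t : (C.D j').S U) =>
      L.br h₁ U s y + i.negOnePow • L.br h₂ U x t)
      (C.toCx_d_app hi U x).symm (C.toCx_d_app hj U y).symm

namespace Coch

variable {E : CochainComplex X.Modules ℤ} {U V : X.Opens} {i j k l m n : ℤ}

/-- All components of the cochain are `𝒪_X`-linear. -/
def IsLin (u : Coch E i U) : Prop := ∀ (p q : ℤ) (h : p + i = q), Op.IsLin (u.at' p q h)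

/-- The differential of the complex, as a cochain of degree one. -/
def diff (E : CochainComplex X.Modules ℤ) (U : X.Opens) : Coch E 1 U :=
  fun x => Op.ofHom (E.d x.1.1 x.1.2) U

theorem diff_isLin : IsLin (diff E U) := fun _ _ _ => Op.isLin_ofHom _

theorem diff_diff (h : (1 : ℤ) + 1 = k) : mul h (diff E U) (diff E U) = 0 :=
  funext fun x => Op.ext fun V hV y => by
    change (E.d _ _).app V ((E.d _ _).app V y) = 0
    rw [← AddCommGrpCat.comp_apply, ← Scheme.Modules.Hom.comp_app, E.d_comp_d]
    rfl

theorem diff_br_br (hi : 1 + i = j) (hj : 1 + j = k) (u : Coch E i U) :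
    br hj (diff E U) (br hi (diff E U) u) = 0 := by
  have h2 : (1 : ℤ) + 1 = 2 := rfl
  have hk : 2 + i = k := by omega
  have hi' := (add_comm i 1).trans hi
  have hj' := (add_comm j 1).trans hj
  have e : (1 * j).negOnePow = -(1 * i).negOnePow := by
    rw [one_mul, one_mul, ← hi, Int.negOnePow_add, Int.negOnePow_one, neg_one_mul]
  unfold br
  rw [e, mul_sub, sub_mul]
  rw [← mul_assoc h2 hi hk hj, diff_diff, zero_mul]
  rcases Int.units_eq_one_or (1 * i).negOnePow with a | a <;> rw [a] <;>
    simp only [one_smul, Units.neg_smul, neg_neg, mul_neg, neg_mul] <;>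
    rw [mul_assoc hi' h2 hj' (by omega : i + 2 = k), diff_diff, mul_zero,
      mul_assoc hi hi' hj' hj] <;> abel

theorem IsLin.mul {h : i + j = k} {u : Coch E i U} {v : Coch E j U} (hu : IsLin u) (hv : IsLin v) :
    IsLin (mul h u v) := fun p r hpr => by
  rw [mul_at h u v p (p + j) r hpr rfl (by omega)]
  exact (hu _ _ _).comp (hv _ _ _)

theorem IsLin.br {h : i + j = k} {u : Coch E i U} {v : Coch E j U} (hu : IsLin u) (hv : IsLin v) :
    IsLin (br h u v) := fun p r hpr =>
  ((hu.mul hv) p r hpr).sub (((hv.mul hu) p r hpr).units_smul _)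

theorem br_zero (h : i + j = k) (u : Coch E i U) : br h u (0 : Coch E j U) = 0 := by
  unfold br; rw [mul_zero, zero_mul]; simp

theorem br_add (h : i + j = k) (u : Coch E i U) (v w : Coch E j U) :
    br h u (v + w) = br h u v + br h u w := by
  unfold br; rw [mul_add, add_mul, smul_add]; abel

theorem add_br (h : i + j = k) (u v : Coch E i U) (w : Coch E j U) :
    br h (u + v) w = br h u w + br h v w := by
  unfold br; rw [mul_add, add_mul, smul_add]; abel

/-- `A`-linearity of a cochain with respect to one scalar function, and its restrictions. -/
def CommutesWith (a : Γ(X, U)) (u : Coch E i U) : Prop :=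
  ∀ (p q : ℤ) (h : p + i = q) (V : X.Opens) (hV : V ≤ U) (m : Γ(E.X p, V)),
    (u.at' p q h).app hV (resO hV a • m) = resO hV a • (u.at' p q h).app hV m

theorem smul_br (h : i + j = k) (a : Γ(X, U)) (u : Coch E i U) (v : Coch E j U)
    (hv : CommutesWith a v) : br h (a • u) v = a • br h u v :=
  ext fun p r hpr => Op.ext fun V hV x => by
    rw [br_at]
    change resO hV a • _ - _ = resO hV a • ((br h u v).at' p r hpr).app hV x
    rw [br_at, smul_sub]
    congr 1
    change _ • (v.at' (p + i) r _).app hV (resO hV a • (u.at' p _ _).app hV x) = _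
    rw [hv, smul_comm]

theorem br_smul (h : i + j = k) (a : Γ(X, U)) (u : Coch E i U) (v : Coch E j U)
    (hu : CommutesWith a u) : br h u (a • v) = a • br h u v := by
  have h' := (add_comm j i).trans h
  rw [br_skew h h', smul_br h' a v u hu, br_skew h h' u v, smul_neg, smul_comm]

theorem IsLin.commutesWith {u : Coch E i U} (hu : IsLin u) (a : Γ(X, U)) : CommutesWith a u :=
  fun p q h V hV m => hu p q h V hV _ m

theorem restrict_br (h : i + j = k) (hV : V ≤ U) (u : Coch E i U) (v : Coch E j U) :
    (fun x => Op.restrict hV (br h u v x) : Coch E k V) =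
      br h (fun x => Op.restrict hV (u x)) (fun x => Op.restrict hV (v x)) :=
  ext fun p r hpr => Op.ext fun W hW x => by
    rw [br_at]
    change ((br h u v).at' p r hpr).app (hW.trans hV) x = _
    rw [br_at]
    rfl

end Coch

/-! ### The DG-Lie algebra of endomorphisms of a complex -/

/-- The sheaf of additive cochains of degree `i`. -/
def cochData (E : CochainComplex X.Modules ℤ) (i : ℤ) : SheafData X :=
  SheafData.pi fun x : {x : ℤ × ℤ // x.1 + i = x.2} => opData (E.X x.1.1) (E.X x.1.2)

/-- The sheaf `ℋom^i(E, E)` of `𝒪_X`-linear cochains of degree `i`. -/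
def homData (E : CochainComplex X.Modules ℤ) (i : ℤ) : SheafData X :=
  (cochData E i).sub
    (fun U =>
      { carrier := {u : Coch E i U | Coch.IsLin u}
        zero_mem' := fun _ _ _ => Op.isLin_zero
        add_mem' := fun hu hv p q h => Op.IsLin.add (hu p q h) (hv p q h)
        smul_mem' := fun a _ hu p q h => Op.IsLin.smul a (hu p q h) })
    (fun hV _ hu p q h => Op.IsLin.restrict (hu p q h) hV)
    (fun _ _ hu p q h => Op.IsLin.of_local fun s => hu s p q h)

/-- The complex `ℋom^*(E, E)`, with differential the graded commutator with the differential of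
`E`. -/
def homCx (E : CochainComplex X.Modules ℤ) : CxData X where
  D := homData E
  d {i j} h U := AddMonoidHom.mk' (fun u : (homData E i).S U =>
      (⟨Coch.br ((add_comm 1 i).trans h) (Coch.diff E U) u.1, Coch.diff_isLin.br u.2⟩ :
        (homData E j).S U)) fun _ _ => Subtype.ext (Coch.br_add _ _ _ _)
  d_smul _ _ a _ := Subtype.ext (Coch.br_smul _ a _ _ (Coch.diff_isLin.commutesWith a))
  r_d _ _ _ hV u := Subtype.ext (Coch.restrict_br _ hV _ u.1)
  d_d _ _ _ _ := Subtype.ext (Coch.diff_br_br _ _ _)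

/-- The graded Leibniz rule for the graded commutator with the differential of `E`. -/
theorem Coch.br_leibniz {E : CochainComplex X.Modules ℤ} {U : X.Opens} {i j k i' j' k' : ℤ}
    (hi : 1 + i = i') (hj : 1 + j = j') (hk : 1 + k = k') (h : i + j = k) (h₁ : i' + j = k')
    (h₂ : i + j' = k') (u : Coch E i U) (v : Coch E j U) :
    br hk (diff E U) (br h u v) = br h₁ (br hi (diff E U) u) v +
      i.negOnePow • br h₂ u (br hj (diff E U) v) := by
  have := br_jacobi hi h hj h₁ hk h₂ (diff E U) u v
  rwa [one_mul] at this

/-- The graded commutator on `ℋom^*(E, E)`. -/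
def homDGData (f : X ⟶ Spec (CommRingCat.of A)) (E : CochainComplex X.Modules ℤ) :
    DGData f (homCx E) where
  br {i j k} h U (u : (homData E i).S U) (v : (homData E j).S U) :=
    (⟨Coch.br h u.1 v.1, u.2.br v.2⟩ : (homData E k).S U)
  add_br _ _ _ _ _ := Subtype.ext (Coch.add_br _ _ _ _)
  br_add _ _ _ _ _ := Subtype.ext (Coch.br_add _ _ _ _)
  res_br h _ _ hV u v := Subtype.ext (Coch.restrict_br h hV u.1 v.1)
  smul_br h _ a u v := Subtype.ext (Coch.smul_br h _ u.1 v.1 (Coch.IsLin.commutesWith v.2 _))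
  br_smul h _ a u v := Subtype.ext (Coch.br_smul h _ u.1 v.1 (Coch.IsLin.commutesWith u.2 _))
  skew h h' _ u v := Subtype.ext (Coch.br_skew h h' u.1 v.1)
  br_self h hi _ u := Subtype.ext (Coch.br_self hi h u.1)
  br_br_self h h' hi _ u := Subtype.ext (Coch.br_br_self hi h h' u.1)
  jacobi hij hjk hik h h' h'' _ u v w :=
    Subtype.ext (Coch.br_jacobi hij hjk hik h h' h'' u.1 v.1 w.1)
  leibniz _ _ _ h h₁ h₂ _ u v := Subtype.ext (Coch.br_leibniz _ _ _ h h₁ h₂ u.1 v.1)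

/-- The sheaf of DG-Lie algebras `ℋom^*(E, E)`, with the graded commutator. -/
def homDG (f : X ⟶ Spec (CommRingCat.of A)) (E : CochainComplex X.Modules ℤ) : DGLieSheaf f :=
  (homDGData f E).toDG

end

section

variable {X : Scheme.{u}} {A : Type u} [CommRing A]

/-! ### The DG-Lie algebra of derivations of a pair (scheme, complex) -/

/-- Derivations of degree `i` of the pair `(X, E)`: pairs `(h, u)` where `h` is a derivation of
degree `i` of `𝒪_X`, which is concentrated in degree zero, so that `h = 0` unless `i = 0`, and `u` is
a cochain of degree `i` with `u (r m) - r u (m) = h (r) m`. -/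
structure IsDerCoch (f : X ⟶ Spec (CommRingCat.of A)) {E : CochainComplex X.Modules ℤ} {i : ℤ}
    {U : X.Opens} (h : Op (OO X) (OO X) U) (u : Coch E i U) : Prop where
  der : Op.IsDer f h
  zero : i ≠ 0 → h = 0
  lin : i ≠ 0 → u.IsLin
  pair : ∀ (p : ℤ) (hp : p + i = p), Op.IsPair h (u.at' p p hp)

namespace IsDerCoch

variable {f : X ⟶ Spec (CommRingCat.of A)} {E : CochainComplex X.Modules ℤ} {i j k : ℤ}
  {U V : X.Opens}

theorem of_isLin {u : Coch E i U} (hu : u.IsLin) : IsDerCoch f 0 u where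
  der := Op.isDer_zero f
  zero _ := rfl
  lin _ := hu
  pair p hp := Op.isPair_zero.2 (hu p p hp)

theorem isLin {u : Coch E i U} (hu : IsDerCoch f 0 u) : u.IsLin := by
  by_cases hi : i = 0
  · subst hi
    intro p q h
    obtain rfl : p = q := by omega
    exact Op.isPair_zero.1 (hu.pair p h)
  · exact hu.lin hi

theorem add {h k : Op (OO X) (OO X) U} {u v : Coch E i U} (hu : IsDerCoch f h u)
    (hv : IsDerCoch f k v) : IsDerCoch f (h + k) (u + v) where
  der := hu.der.add hv.der
  zero hi := by rw [hu.zero hi, hv.zero hi, add_zero]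
  lin hi p q e := (hu.lin hi p q e).add (hv.lin hi p q e)
  pair p hp := Op.isPair_add (hu.pair p hp) (hv.pair p hp)

theorem smul (a : Γ(X, U)) {h : Op (OO X) (OO X) U} {u : Coch E i U} (hu : IsDerCoch f h u) :
    IsDerCoch f (a • h) (a • u) where
  der := hu.der.smul a
  zero hi := by rw [hu.zero hi, smul_zero]
  lin hi p q e := (hu.lin hi p q e).smul a
  pair p hp := (hu.pair p hp).smul a

theorem restrict (hV : V ≤ U) {h : Op (OO X) (OO X) U} {u : Coch E i U} (hu : IsDerCoch f h u) :
    IsDerCoch f (Op.restrict hV h) (fun x => Op.restrict hV (u x) : Coch E i V) where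
  der := hu.der.restrict hV
  zero hi := by rw [hu.zero hi, map_zero]
  lin hi p q e := (hu.lin hi p q e).restrict hV
  pair p hp := (hu.pair p hp).restrict hV

theorem of_local {ι : Type u} {W : ι → X.Opens} {h : Op (OO X) (OO X) (iSup W)}
    {u : Coch E i (iSup W)} (hu : ∀ s, IsDerCoch f (Op.restrict (le_iSup W s) h)
      (fun x => Op.restrict (le_iSup W s) (u x) : Coch E i (W s))) : IsDerCoch f h u where
  der := Op.IsDer.of_local fun s => (hu s).der
  zero hi := (opData (OO X) (OO X)).sep W h 0 fun s => ((hu s).zero hi).trans (map_zero _).symm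
  lin hi p q e := Op.IsLin.of_local fun s => (hu s).lin hi p q e
  pair p hp := Op.IsPair.of_local fun s => (hu s).pair p hp

theorem br_aux (hij : i + j = k) (hi : i = 0) (hj : j ≠ 0) {h h' : Op (OO X) (OO X) U}
    {u : Coch E i U} {v : Coch E j U} (hu : IsDerCoch f h u) (hv : IsDerCoch f h' v) :
    (Coch.br hij u v).IsLin := by
  subst hi
  obtain rfl : j = k := by omega
  intro p r hpr V hV a m
  subst hpr
  have e : ((0 : ℤ) * j).negOnePow = 1 := by simp
  have key : ∀ m : Γ(E.X p, V), ((Coch.br hij u v).at' p (p + j) rfl).app hV m =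
      (u.at' (p + j) (p + j) (by omega)).app hV ((v.at' p (p + j) rfl).app hV m) -
        (v.at' p (p + j) rfl).app hV ((u.at' p p (by omega)).app hV m) := by
    intro m
    change ((Coch.mul hij u v).at' p (p + j) rfl).app hV m - (((0 : ℤ) * j).negOnePow •
      (Coch.mul ((add_comm j 0).trans hij) v u).at' p (p + j) rfl).app hV m = _
    rw [e, one_smul, Coch.mul_at hij u v p (p + j) (p + j) rfl rfl (by omega),
      Coch.mul_at _ v u p p (p + j) rfl (by omega) rfl]
    rfl
  have lv := hv.lin hj p (p + j) rfl V hV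
  rw [key, key, lv, (hu.pair (p + j) _).app_smul, (hu.pair p _).app_smul, map_add, lv, lv,
    smul_sub]
  abel

theorem br (hij : i + j = k) {h h' : Op (OO X) (OO X) U} {u : Coch E i U} {v : Coch E j U}
    (hu : IsDerCoch f h u) (hv : IsDerCoch f h' v) :
    IsDerCoch f (Op.comm h h') (Coch.br hij u v) := by
  by_cases hi : i = 0
  · by_cases hj : j = 0
    · subst hi hj
      obtain rfl : k = 0 := by omega
      refine ⟨hu.der.comm hv.der, fun h => absurd rfl h, fun h => absurd rfl h, fun p hp => ?_⟩
      have : (Coch.br hij u v).at' p p hp = Op.comm (u.at' p p hp) (v.at' p p hp) := by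
        have e : ((0 : ℤ) * 0).negOnePow = 1 := by simp
        change (Coch.mul hij u v).at' p p hp - ((0 : ℤ) * 0).negOnePow •
          (Coch.mul ((add_comm 0 0).trans hij) v u).at' p p hp = _
        rw [e, one_smul, Coch.mul_at hij u v p p p hp hp hp, Coch.mul_at _ v u p p p hp hp hp]
        rfl
      rw [this]
      exact (hu.pair p hp).comm (hv.pair p hp)
    · rw [hv.zero hj, Op.comm_zero]
      exact of_isLin (br_aux hij hi hj hu hv)
  · rw [hu.zero hi, Op.zero_comm]
    refine of_isLin ?_
    by_cases hj : j = 0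
    · have hji := (add_comm j i).trans hij
      rw [Coch.br_skew hij hji]
      exact fun p q e => ((br_aux hji hj hi hv hu p q e).units_smul _).neg
    · exact (hu.lin hi).br (hv.lin hj)

theorem commutesWith {h : Op (OO X) (OO X) U} {u : Coch E i U} (hu : IsDerCoch f h u) (a : A) :
    Coch.CommutesWith (baseMap f U a) u := fun p q e V hV m => by
  by_cases hi : i = 0
  · subst hi
    obtain rfl : p = q := by omega
    rw [resO_baseMap]
    exact (hu.pair p e).app_base_smul hu.der hV a m
  · exact hu.lin hi p q e V hV _ m

end IsDerCoch

/-- The sheaf `𝒟^i_A(X, E)` of derivations of degree `i` of the pair `(X, E)`. -/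
def derData (f : X ⟶ Spec (CommRingCat.of A)) (E : CochainComplex X.Modules ℤ) (i : ℤ) :
    SheafData X :=
  ((opData (OO X) (OO X)).prod (cochData E i)).sub
    (fun U =>
      { carrier := {x : Op (OO X) (OO X) U × Coch E i U | IsDerCoch f x.1 x.2}
        zero_mem' := IsDerCoch.of_isLin fun _ _ _ => Op.isLin_zero
        add_mem' := IsDerCoch.add
        smul_mem' := fun a _ hx => IsDerCoch.smul a hx })
    (fun hV _ hx => IsDerCoch.restrict hV hx)
    (fun _ _ hx => IsDerCoch.of_local hx)

/-- Derivations of degree `i` of the pair `(U, E|_U)`. -/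
abbrev DerCoch (f : X ⟶ Spec (CommRingCat.of A)) (E : CochainComplex X.Modules ℤ) (i : ℤ)
    (U : X.Opens) : Type u := (derData f E i).S U

/-- The bracket of derivations of `(X, E)`: componentwise graded commutator. -/
def derBr (f : X ⟶ Spec (CommRingCat.of A)) (E : CochainComplex X.Modules ℤ) {i j k : ℤ}
    (h : i + j = k) {U : X.Opens} (x : DerCoch f E i U) (y : DerCoch f E j U) : DerCoch f E k U :=
  ⟨(Op.comm x.1.1 y.1.1, Coch.br h x.1.2 y.1.2), x.2.br h y.2⟩

/-- The differential of the complex `𝒟^*_A(X, E)`: graded commutator with `(0, d_E)`. -/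
def derDiff (f : X ⟶ Spec (CommRingCat.of A)) (E : CochainComplex X.Modules ℤ) {i j : ℤ}
    (h : i + 1 = j) {U : X.Opens} (x : DerCoch f E i U) : DerCoch f E j U :=
  ⟨(0, Coch.br ((add_comm 1 i).trans h) (Coch.diff E U) x.1.2), by
    have := (IsDerCoch.of_isLin (f := f) (Coch.diff_isLin (E := E) (U := U))).br
      ((add_comm 1 i).trans h) x.2
    rwa [Op.zero_comm] at this⟩

/-- The complex `𝒟^*_A(X, E)`. -/
def derCx (f : X ⟶ Spec (CommRingCat.of A)) (E : CochainComplex X.Modules ℤ) : CxData X where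
  D := derData f E
  d {i j} h U := AddMonoidHom.mk' (fun x : DerCoch f E i U => (derDiff f E h x : DerCoch f E j U))
    fun _ _ => Subtype.ext (Prod.ext (add_zero _).symm (Coch.br_add _ _ _ _))
  d_smul _ _ a _ := Subtype.ext (Prod.ext (smul_zero a).symm
    (Coch.br_smul _ a _ _ (Coch.diff_isLin.commutesWith a)))
  r_d _ _ _ hV x := Subtype.ext (Prod.ext (map_zero (Op.restrict hV))
    (Coch.restrict_br _ hV _ x.1.2))
  d_d _ _ _ _ := Subtype.ext (Prod.ext rfl (Coch.diff_br_br _ _ _))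

/-- A derivation of the structure sheaf has degree zero; signs do not matter. -/
theorem comm_skew_of_zero {U : X.Opens} {i j : ℤ} {h k : Op (OO X) (OO X) U} (hz : i ≠ 0 → h = 0) :
    Op.comm h k = -((i * j).negOnePow • Op.comm k h) := by
  by_cases hi : i = 0
  · have e : (i * j).negOnePow = 1 := by simp [hi]
    rw [e, one_smul, Op.comm_skew]
  · rw [hz hi, Op.comm_zero, Op.zero_comm, smul_zero, neg_zero]

theorem comm_jacobi_of_zero {U : X.Opens} {i j : ℤ} {h k l : Op (OO X) (OO X) U}
    (hz : i ≠ 0 → h = 0) : Op.comm h (Op.comm k l) = Op.comm (Op.comm h k) l +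
      (i * j).negOnePow • Op.comm k (Op.comm h l) := by
  by_cases hi : i = 0
  · have e : (i * j).negOnePow = 1 := by simp [hi]
    rw [e, one_smul, Op.comm_jacobi]
  · rw [hz hi]
    simp only [Op.zero_comm, Op.comm_zero, smul_zero, add_zero]

theorem comm_leibniz_zero {U : X.Opens} {i : ℤ} (h k : Op (OO X) (OO X) U) :
    0 = Op.comm 0 k + i.negOnePow • Op.comm h 0 := by
  rw [Op.zero_comm, Op.comm_zero, smul_zero, add_zero]

theorem Op.IsDer.smul_comm {f : X ⟶ Spec (CommRingCat.of A)} {U : X.Opens} (a : A)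
    (h : Op (OO X) (OO X) U) {k : Op (OO X) (OO X) U} (hk : Op.IsDer f k) :
    Op.comm (baseMap f U a • h) k = baseMap f U a • Op.comm h k :=
  Op.smul_comm_base a _ _ fun _ hV m => (Op.IsDer.isPair hk).app_base_smul hk hV a m

theorem Op.IsDer.comm_smul {f : X ⟶ Spec (CommRingCat.of A)} {U : X.Opens} (a : A)
    {h : Op (OO X) (OO X) U} (k : Op (OO X) (OO X) U) (hh : Op.IsDer f h) :
    Op.comm h (baseMap f U a • k) = baseMap f U a • Op.comm h k := by
  rw [Op.comm_skew, Op.IsDer.smul_comm a k hh, Op.comm_skew h, smul_neg]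

theorem derBr_skew (f : X ⟶ Spec (CommRingCat.of A)) (E : CochainComplex X.Modules ℤ) {i j k : ℤ}
    (h : i + j = k) (h' : j + i = k) {U : X.Opens} (x : DerCoch f E i U) (y : DerCoch f E j U) :
    derBr f E h x y = -((i * j).negOnePow • derBr f E h' y x) := by
  exact Subtype.ext (Prod.ext (comm_skew_of_zero x.2.zero) (Coch.br_skew h h' x.1.2 y.1.2))

theorem derBr_jacobi (f : X ⟶ Spec (CommRingCat.of A)) (E : CochainComplex X.Modules ℤ)
    {i j k ij jk ik n : ℤ} (hij : i + j = ij) (hjk : j + k = jk) (hik : i + k = ik)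
    (h : ij + k = n) (h' : i + jk = n) (h'' : j + ik = n) {U : X.Opens}
    (x : DerCoch f E i U) (y : DerCoch f E j U) (z : DerCoch f E k U) :
    derBr f E h' x (derBr f E hjk y z) = derBr f E h (derBr f E hij x y) z +
      (i * j).negOnePow • derBr f E h'' y (derBr f E hik x z) := by
  exact Subtype.ext (Prod.ext (comm_jacobi_of_zero x.2.zero)
    (Coch.br_jacobi hij hjk hik h h' h'' x.1.2 y.1.2 z.1.2))

theorem derBr_leibniz (f : X ⟶ Spec (CommRingCat.of A)) (E : CochainComplex X.Modules ℤ)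
    {i j k i' j' k' : ℤ} (hi : i + 1 = i') (hj : j + 1 = j') (hk : k + 1 = k') (h : i + j = k)
    (h₁ : i' + j = k') (h₂ : i + j' = k') {U : X.Opens}
    (x : DerCoch f E i U) (y : DerCoch f E j U) :
    derDiff f E hk (derBr f E h x y) = derBr f E h₁ (derDiff f E hi x) y +
      i.negOnePow • derBr f E h₂ x (derDiff f E hj y) := by
  exact Subtype.ext (Prod.ext (comm_leibniz_zero _ _)
    (Coch.br_leibniz _ _ _ h h₁ h₂ x.1.2 y.1.2))

/-- The bracket on `𝒟^*_A(X, E)`. -/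
def derDGData (f : X ⟶ Spec (CommRingCat.of A)) (E : CochainComplex X.Modules ℤ) :
    DGData f (derCx f E) where
  br {i j k} h U (x : DerCoch f E i U) (y : DerCoch f E j U) := (derBr f E h x y : DerCoch f E k U)
  add_br _ _ _ _ _ := Subtype.ext (Prod.ext (Op.add_comm' _ _ _) (Coch.add_br _ _ _ _))
  br_add _ _ _ _ _ := Subtype.ext (Prod.ext (Op.comm_add _ _ _) (Coch.br_add _ _ _ _))
  res_br h _ _ hV x y := Subtype.ext (Prod.ext rfl (Coch.restrict_br h hV x.1.2 y.1.2))
  smul_br h _ a x y := Subtype.ext (Prod.ext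
    (Op.IsDer.smul_comm a _ (IsDerCoch.der y.2))
    (Coch.smul_br h _ x.1.2 y.1.2 (IsDerCoch.commutesWith y.2 a)))
  br_smul h _ a x y := Subtype.ext (Prod.ext
    (Op.IsDer.comm_smul a _ (IsDerCoch.der x.2))
    (Coch.br_smul h _ x.1.2 y.1.2 (IsDerCoch.commutesWith x.2 a)))
  skew h h' _ x y := derBr_skew f E h h' x y
  br_self h hi _ x := Subtype.ext (Prod.ext (Op.comm_self _) (Coch.br_self hi h x.1.2))
  br_br_self h h' hi _ x := Subtype.ext (Prod.ext
    ((congrArg (Op.comm x.1.1) (Op.comm_self _)).trans (Op.comm_zero _))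
    (Coch.br_br_self hi h h' x.1.2))
  jacobi hij hjk hik h h' h'' _ x y z := derBr_jacobi f E hij hjk hik h h' h'' x y z
  leibniz hi hj hk h h₁ h₂ _ x y := derBr_leibniz f E hi hj hk h h₁ h₂ x y

/-- The sheaf of DG-Lie algebras `𝒟^*_A(X, E)`. -/
def derDG (f : X ⟶ Spec (CommRingCat.of A)) (E : CochainComplex X.Modules ℤ) : DGLieSheaf f :=
  (derDGData f E).toDG

end

section

variable {X : Scheme.{u}} {A : Type u} [CommRing A]

/-! ### The Atiyah-type sequences -/

namespace LieSheaf

variable {f : X ⟶ Spec (CommRingCat.of A)}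

theorem single_eq_zero (M : X.Modules) {i : ℤ} (hi : i ≠ 0) {U : X.Opens}
    (x : Γ((cx₀ M).X i, U)) : x = 0 := by
  rw [← incl_proj M i x, proj_ne M hi]; exact map_zero _

theorem map_br_of {L : DGLieSheaf f} {N : LieSheaf f} (φ : L.cx.X 0 ⟶ N.mod)
    (g : L.cx ⟶ cx₀ N.mod)
    (hg : ∀ (U : X.Opens) (z : Γ(L.cx.X 0, U)),
      (g.f 0).app U z = (incl N.mod 0).app U (φ.app U z))
    (h₀ : ∀ (h : (0 : ℤ) + 0 = 0) (U : X.Opens) (x y : Γ(L.cx.X 0, U)),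
      φ.app U (L.br h U x y) = N.br U (φ.app U x) (φ.app U y))
    (h₁ : ∀ (i j : ℤ) (h : i + j = 0), i ≠ 0 → ∀ (U : X.Opens) (x : Γ(L.cx.X i, U))
      (y : Γ(L.cx.X j, U)), φ.app U (L.br h U x y) = 0)
    {i j k : ℤ} (h : i + j = k) (U : X.Opens) (x : Γ(L.cx.X i, U)) (y : Γ(L.cx.X j, U)) :
    (g.f k).app U (L.br h U x y) = N.brDG i j k U ((g.f i).app U x) ((g.f j).app U y) := by
  by_cases hk : k = 0
  · subst hk
    rw [hg]
    by_cases hi : i = 0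
    · subst hi
      obtain rfl : j = 0 := by omega
      rw [brDG_apply, hg, hg, proj_incl, proj_incl, h₀ h]
    · rw [brDG_left _ hi, h₁ i j h hi, map_zero]
  · exact (single_eq_zero N.mod hk _).trans (single_eq_zero N.mod hk _).symm

/-- A morphism from a sheaf of DG-Lie algebras to a sheaf of Lie algebras (in degree zero), from its
component of degree zero. -/
def homToDG {L : DGLieSheaf f} {N : LieSheaf f} (φ : L.cx.X 0 ⟶ N.mod)
    (hd : ∀ (i : ℤ), (ComplexShape.up ℤ).Rel i 0 → L.cx.d i 0 ≫ φ = 0)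
    (h₀ : ∀ (h : (0 : ℤ) + 0 = 0) (U : X.Opens) (x y : Γ(L.cx.X 0, U)),
      φ.app U (L.br h U x y) = N.br U (φ.app U x) (φ.app U y))
    (h₁ : ∀ (i j : ℤ) (h : i + j = 0), i ≠ 0 → ∀ (U : X.Opens) (x : Γ(L.cx.X i, U))
      (y : Γ(L.cx.X j, U)), φ.app U (L.br h U x y) = 0) : L.Hom N.toDG where
  hom := HomologicalComplex.mkHomToSingle φ hd
  map_br {i j k} h U x y := map_br_of φ (HomologicalComplex.mkHomToSingle φ hd)
    (fun U z => by simp only [HomologicalComplex.mkHomToSingle_f, incl]; rfl) h₀ h₁ h U x y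

end LieSheaf

/-- A morphism of sheaves of Lie algebras. -/
structure LieSheaf.Hom {f : X ⟶ Spec (CommRingCat.of A)} (L M : LieSheaf f) where
  hom : L.mod ⟶ M.mod
  map_br : ∀ {U : X.Opens} (x y : Γ(L.mod, U)),
    hom.app U (L.br U x y) = M.br U (hom.app U x) (hom.app U y)

/-- A morphism of sheaves of Lie algebras, as a morphism of sheaves of DG-Lie algebras. -/
def LieSheaf.Hom.toDG {f : X ⟶ Spec (CommRingCat.of A)} {L M : LieSheaf f} (g : L.Hom M) :
    L.toDG.Hom M.toDG :=
  LieSheaf.homToDG (L := L.toDG) (N := M) (LieSheaf.proj L.mod 0 ≫ g.hom)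
    (fun i _ => Limits.zero_comp)
    (fun h U (x y : Γ((LieSheaf.cx₀ L.mod).X 0, U)) => by
      change g.hom.app U ((LieSheaf.proj L.mod 0).app U (L.brDG 0 0 0 U x y)) = _
      rw [LieSheaf.brDG_apply, LieSheaf.proj_incl, g.map_br]
      rfl)
    (fun i j h hi U (x : Γ((LieSheaf.cx₀ L.mod).X i, U)) (y : Γ((LieSheaf.cx₀ L.mod).X j, U)) => by
      change g.hom.app U ((LieSheaf.proj L.mod 0).app U (L.brDG i j 0 U x y)) = _
      rw [LieSheaf.brDG_left _ hi, map_zero, map_zero])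

variable (f : X ⟶ Spec (CommRingCat.of A))

/-- The inclusion `u ↦ (0, u)` of `ℋom^*(E, E)` in `𝒟^*_A(X, E)`. -/
def homIncl (E : CochainComplex X.Modules ℤ) : (homDG f E).Hom (derDG f E) where
  hom :=
    { f := fun i => homMk (M := (homData E i).toModules) (N := (derData f E i).toModules)
        (fun U => AddMonoidHom.mk' (fun u : (homData E i).S U =>
          (⟨(0, u.1), IsDerCoch.of_isLin u.2⟩ : DerCoch f E i U))
          fun _ _ => Subtype.ext (Prod.ext (add_zero _).symm rfl))
        (fun U a u => Subtype.ext (Prod.ext (smul_zero a).symm rfl))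
        (fun hV u => Subtype.ext (Prod.ext (map_zero (Op.restrict hV)) rfl))
      comm' := fun i j h => by
        ext U u
        exact ((derCx f E).toCx_d_app h U
          (⟨(0, u.1), IsDerCoch.of_isLin u.2⟩ : DerCoch f E i U)).trans
          (congrArg (fun v : (homData E j).S U =>
            (⟨(0, v.1), IsDerCoch.of_isLin v.2⟩ : DerCoch f E j U))
            ((homCx E).toCx_d_app h U u)).symm }
  map_br h U u v := Subtype.ext (Prod.ext (Op.comm_zero _).symm rfl)

/-- The anchor `(h, u) ↦ h` from `𝒟^*_A(X, E)` to the tangent sheaf. -/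
def anchor (E : CochainComplex X.Modules ℤ) : (derDG f E).Hom (theta f).toDG :=
  LieSheaf.homToDG (L := derDG f E) (N := theta f)
    (homMk (M := (derData f E 0).toModules) (N := (thetaData f).toModules)
      (fun U => AddMonoidHom.mk' (fun x : DerCoch f E 0 U => (⟨x.1.1, x.2.der⟩ : Der f U))
        fun _ _ => rfl)
      (fun U a x => rfl) (fun hV x => rfl))
    (fun i h => by
      ext U x
      exact congrArg (fun y : DerCoch f E 0 U => (⟨y.1.1, y.2.der⟩ : Der f U))
        ((derCx f E).toCx_d_app h U x))
    (fun h U x y => rfl)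
    (fun i j h hi U x y => Subtype.ext
      ((congrArg (fun z => Op.comm z y.1.1) (x.2.zero hi)).trans (Op.zero_comm _)))

variable (M : X.Modules)

theorem isLin_scalar {U : X.Opens} (a : Γ(X, U)) : Op.IsLin (a • (Op.ofHom (𝟙 M) U)) :=
  (Op.isLin_ofHom _).smul a

/-- The map `a ↦ (0, a ·)` from the structure sheaf to the derivations of the pair `(X, M)`. -/
def scalarIncl : (trivialLie f).Hom (pairLie f M) where
  hom := homMk (M := OO X) (N := (pairData f M).toModules)
    (fun U => AddMonoidHom.mk' (fun a => (⟨(0, fn U a • Op.ofHom (𝟙 M) U), Op.isDer_zero f,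
        Op.isPair_zero.2 (isLin_scalar M (fn U a))⟩ : PairDer f M U))
      fun a b => Subtype.ext (Prod.ext (add_zero _).symm (add_smul (fn U a) (fn U b) _)))
    (fun U a x => Subtype.ext (Prod.ext (smul_zero a).symm (mul_smul a (fn U x) (Op.ofHom (𝟙 M) U))))
    (fun hV x => Subtype.ext (Prod.ext (map_zero (Op.restrict hV))
      ((opData M M).r_smul hV (fn _ x) (Op.ofHom (𝟙 M) _))))
  map_br {U} a b := Subtype.ext (Prod.ext
    (Op.comm_zero (0 : Op (OO X) (OO X) U)).symm <| by
      refine (zero_smul Γ(X, U) (Op.ofHom (𝟙 M) U)).trans (Op.ext fun V hV m => ?_)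
      change 0 = (Op.comm (fn U a • Op.ofHom (𝟙 M) U) (fn U b • Op.ofHom (𝟙 M) U)).app hV m
      rw [Op.comm_app]
      change 0 = resO hV (fn U a) • resO hV (fn U b) • m - resO hV (fn U b) • resO hV (fn U a) • m
      rw [smul_comm, sub_self])

/-- The anchor `(h, u) ↦ h` from the derivations of the pair `(X, M)` to the tangent sheaf. -/
def pairAnchor : (pairLie f M).Hom (theta f) where
  hom := homMk (M := (pairData f M).toModules) (N := (thetaData f).toModules)
    (fun U => AddMonoidHom.mk' (fun x : PairDer f M U => (⟨x.1.1, x.2.1⟩ : Der f U))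
      fun _ _ => rfl) (fun U a x => rfl) (fun hV x => rfl)
  map_br x y := rfl

end

section

variable {X : Scheme.{u}} {A : Type u} [CommRing A]

/-! ### Locally free sheaves -/

/-- `e` is a frame of `E` over `V`: its restrictions form a basis of the sections of `E` over every
open subset of `V`. Thus `e` is an isomorphism from `𝒪_V^n` to `E|_V`. -/
def IsFrame (E : X.Modules) (V : X.Opens) {n : ℕ} (e : Fin n → Γ(E, V)) : Prop :=
  ∀ (W : X.Opens) (h : W ≤ V), LinearIndependent Γ(X, W) (fun i => res E h (e i)) ∧
    Submodule.span Γ(X, W) (Set.range fun i => res E h (e i)) = ⊤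

/-- `E|_V` is free of rank `n`. -/
def IsFreeOn (E : X.Modules) (V : X.Opens) (n : ℕ) : Prop :=
  ∃ e : Fin n → Γ(E, V), IsFrame E V e

/-- Locally free sheaves of finite rank. The rank is a locally constant function, not necessarily
constant. -/
def IsLocallyFree (E : X.Modules) : Prop :=
  ∀ x : X, ∃ (V : X.Opens) (n : ℕ), x ∈ V ∧ IsFreeOn E V n

theorem IsFreeOn.mono {E : X.Modules} {V W : X.Opens} {n : ℕ} (hE : IsFreeOn E V n) (h : W ≤ V) :
    IsFreeOn E W n := by
  obtain ⟨e, he⟩ := hE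
  refine ⟨fun i => res E h (e i), fun W' h' => ?_⟩
  simpa only [res_res] using he W' (h'.trans h)

/-- A module that is free of two different ranks is a module over the zero ring. -/
theorem IsFreeOn.subsingleton {E : X.Modules} {V : X.Opens} {n m : ℕ} (hn : IsFreeOn E V n)
    (hm : IsFreeOn E V m) (h : n ≠ m) : Subsingleton Γ(X, V) := by
  by_contra hs
  rw [not_subsingleton_iff_nontrivial] at hs
  obtain ⟨e, he⟩ := hn
  obtain ⟨e', he'⟩ := hm
  have b := Module.Basis.mk (he V le_rfl).1 (he V le_rfl).2.ge
  have b' := Module.Basis.mk (he' V le_rfl).1 (he' V le_rfl).2.ge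
  exact h (by simpa using Fintype.card_congr (b.indexEquiv b'))

/-! ### Sheafification -/

/-- The sheaf of modules associated with a presheaf of modules. -/
def sheafify (P : PresheafOfModules X.ringCatSheaf.obj) : X.Modules :=
  (PresheafOfModules.sheafification (𝟙 X.ringCatSheaf.obj)).obj P

/-- The map from the sections of a presheaf to the sections of the associated sheaf. -/
def toSheafify (P : PresheafOfModules X.ringCatSheaf.obj) (U : X.Opens) :
    P.obj (op U) →+ Γ(sheafify P, U) :=
  (((PresheafOfModules.sheafificationAdjunction (𝟙 X.ringCatSheaf.obj)).unit.app P).app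
    (op U)).hom.toAddMonoidHom

/-! ### Determinants -/

/-- Sections of the exterior algebra over a smaller open set, as an algebra over functions. -/
abbrev extAlg (E : X.Modules) {U V : X.Opens} (h : V ≤ U) :
    Algebra Γ(X, U) (ExteriorAlgebra Γ(X, V) Γ(E, V)) :=
  ((algebraMap Γ(X, V) (ExteriorAlgebra Γ(X, V) Γ(E, V))).comp (resO h)).toAlgebra'
    fun a x => Algebra.commutes (resO h a) x

/-- Restriction of sections of the presheaf of exterior algebras. -/
def extRes (E : X.Modules) {U V : X.Opens} (h : V ≤ U) :
    ExteriorAlgebra Γ(X, U) Γ(E, U) →+* ExteriorAlgebra Γ(X, V) Γ(E, V) :=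
  letI := extAlg E h
  (ExteriorAlgebra.lift Γ(X, U) (A := ExteriorAlgebra Γ(X, V) Γ(E, V))
    ⟨{ toFun := fun m => ExteriorAlgebra.ι Γ(X, V) (res E h m)
       map_add' := fun m m' => by rw [map_add, map_add]
       map_smul' := fun a m => by
        rw [res_smul, map_smul, Algebra.smul_def (resO h a)]
        rfl }, fun m => ExteriorAlgebra.ι_sq_zero _⟩).toRingHom

theorem extRes_ι (E : X.Modules) {U V : X.Opens} (h : V ≤ U) (m : Γ(E, U)) :
    extRes E h (ExteriorAlgebra.ι Γ(X, U) m) = ExteriorAlgebra.ι Γ(X, V) (res E h m) :=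
  letI := extAlg E h
  ExteriorAlgebra.lift_ι_apply Γ(X, U) _ _ m

theorem extRes_algebraMap (E : X.Modules) {U V : X.Opens} (h : V ≤ U) (a : Γ(X, U)) :
    extRes E h (algebraMap _ _ a) = algebraMap _ _ (resO h a) :=
  letI := extAlg E h
  AlgHom.commutes (ExteriorAlgebra.lift Γ(X, U) (A := ExteriorAlgebra Γ(X, V) Γ(E, V)) _) a

theorem extRes_smul (E : X.Modules) {U V : X.Opens} (h : V ≤ U) (a : Γ(X, U))
    (x : ExteriorAlgebra Γ(X, U) Γ(E, U)) : extRes E h (a • x) = resO h a • extRes E h x := by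
  rw [Algebra.smul_def, map_mul, extRes_algebraMap, ← Algebra.smul_def]

theorem extRes_self (E : X.Modules) {U : X.Opens} (x : ExteriorAlgebra Γ(X, U) Γ(E, U)) :
    extRes E (le_refl U) x = x := by
  induction x using ExteriorAlgebra.induction with
  | algebraMap a => rw [extRes_algebraMap, resO_self]
  | ι m => rw [extRes_ι, res_self]
  | mul x y hx hy => rw [map_mul, hx, hy]
  | add x y hx hy => rw [map_add, hx, hy]

theorem extRes_extRes (E : X.Modules) {U V W : X.Opens} (h : V ≤ U) (h' : W ≤ V)
    (x : ExteriorAlgebra Γ(X, U) Γ(E, U)) :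
    extRes E h' (extRes E h x) = extRes E (h'.trans h) x := by
  induction x using ExteriorAlgebra.induction with
  | algebraMap a => simp only [extRes_algebraMap, resO_resO]
  | ι m => simp only [extRes_ι, res_res]
  | mul x y hx hy => simp only [map_mul, hx, hy]
  | add x y hx hy => simp only [map_add, hx, hy]

theorem extRes_ιMulti (E : X.Modules) {U V : X.Opens} (h : V ≤ U) {n : ℕ} (m : Fin n → Γ(E, U)) :
    extRes E h (ExteriorAlgebra.ιMulti Γ(X, U) n m) =
      ExteriorAlgebra.ιMulti Γ(X, V) n fun i => res E h (m i) := by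
  simp only [ExteriorAlgebra.ιMulti_apply, map_list_prod, List.map_ofFn]
  congr 2
  funext i
  exact extRes_ι E h (m i)

/-- Sections over `U` of the presheaf of top exterior powers: elements of the exterior algebra of the
module of sections which lie in the `n`-th exterior power over all open subsets over which `E` is
free of rank `n`. -/
def topSections (E : X.Modules) (U : X.Opens) :
    Submodule Γ(X, U) (ExteriorAlgebra Γ(X, U) Γ(E, U)) where
  carrier := {s | ∀ (V : X.Opens) (h : V ≤ U) (n : ℕ), IsFreeOn E V n →
    extRes E h s ∈ ⋀[Γ(X, V)]^n Γ(E, V)}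
  zero_mem' V h n _ := by rw [map_zero]; exact Submodule.zero_mem _
  add_mem' hs ht V h n hn := by rw [map_add]; exact Submodule.add_mem _ (hs V h n hn) (ht V h n hn)
  smul_mem' a s hs V h n hn := by rw [extRes_smul]; exact Submodule.smul_mem _ _ (hs V h n hn)

/-- The presheaf of top exterior powers. -/
def topData (E : X.Modules) : PreData X where
  S U := topSections E U
  r h := AddMonoidHom.mk' (fun x => ⟨extRes E h x.1, fun V h' n hn => by
    rw [extRes_extRes]; exact x.2 V (h'.trans h) n hn⟩)
    fun x y => Subtype.ext (map_add (extRes E h) x.1 y.1)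
  r_smul h a x := Subtype.ext (extRes_smul E h a x.1)
  r_self x := Subtype.ext (extRes_self E x.1)
  r_r h h' x := Subtype.ext (extRes_extRes E h h' x.1)

/-- The determinant (top exterior power) of a locally free sheaf: the sheaf associated with the
presheaf of top exterior powers. -/
def det (E : X.Modules) : X.Modules := sheafify (topData E).toPresheafOfModules

theorem ιMulti_mem_topSections {E : X.Modules} {V : X.Opens} {n : ℕ} (hV : IsFreeOn E V n)
    (m : Fin n → Γ(E, V)) : ExteriorAlgebra.ιMulti Γ(X, V) n m ∈ topSections E V := by
  intro W h k hk
  by_cases hnk : n = k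
  · subst hnk
    rw [extRes_ιMulti]
    exact ExteriorAlgebra.ιMulti_range _ _ ⟨_, rfl⟩
  · have := (hV.mono h).subsingleton hk hnk
    have : Subsingleton (ExteriorAlgebra Γ(X, W) Γ(E, W)) := Module.subsingleton Γ(X, W) _
    rw [Subsingleton.elim (extRes E h _) 0]
    exact Submodule.zero_mem _

/-- The section `m_1 ∧ … ∧ m_n` of the determinant of a sheaf which is free of rank `n`. -/
def wedge {E : X.Modules} {V : X.Opens} {n : ℕ} (hV : IsFreeOn E V n) (m : Fin n → Γ(E, V)) :
    Γ(det E, V) :=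
  toSheafify (topData E).toPresheafOfModules V
    (⟨ExteriorAlgebra.ιMulti Γ(X, V) n m, ιMulti_mem_topSections hV m⟩ : topSections E V)

/-! ### Tensor products, duals, and the determinant of a complex -/

/-- The tensor product of two sheaves of modules. -/
def tensor (M N : X.Modules) : X.Modules :=
  sheafify (PresheafOfModules.Monoidal.tensorObj (R := X.presheaf) M.val N.val)

/-- The section `m ⊗ n` of the tensor product. -/
def tmul {M N : X.Modules} {U : X.Opens} (m : Γ(M, U)) (n : Γ(N, U)) : Γ(tensor M N, U) :=
  toSheafify (PresheafOfModules.Monoidal.tensorObj (R := X.presheaf) M.val N.val) U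
    (TensorProduct.tmul Γ(X, U) (M := Γ(M, U)) (N := Γ(N, U)) m n :
      TensorProduct Γ(X, U) Γ(M, U) Γ(N, U))

end

section

variable {X : Scheme.{u}} {A : Type u} [CommRing A]

/-- `L^{(-1)^i}`: the sheaf itself for even `i` and its dual for odd `i`. -/
def signed (L : X.Modules) : Bool → X.Modules
  | true => L
  | false => dual L

/-- The tensor product `L_a ⊗ (L_{a+1} ⊗ (⋯ ⊗ L_{a+k}))`. -/
def tensorRange (L : ℤ → X.Modules) : ℤ → ℕ → X.Modules
  | a, 0 => L a
  | a, k + 1 => tensor (L a) (tensorRange L (a + 1) k)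

/-- The factor `(det E^i)^{(-1)^i}` of the determinant of a complex. -/
def detFactor (E : CochainComplex X.Modules ℤ) (i : ℤ) : X.Modules :=
  signed (det (E.X i)) (decide (Even i))

/-- The determinant `⊗_i (det E^i)^{(-1)^i}` of a complex of locally free sheaves which vanishes
outside the degrees `a, …, a + k`. -/
def detComplex (E : CochainComplex X.Modules ℤ) (a : ℤ) (k : ℕ) : X.Modules :=
  tensorRange (detFactor E) a k

/-! ### Natural operations on derivations of pairs -/

section

variable {f : X ⟶ Spec (CommRingCat.of A)} {M N : X.Modules} {U : X.Opens}

/-- The derivation `(h, v)` of `(X, det M)` is the Leibniz extension of the derivation `(h, u)` of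
`(X, M)`: `v (m_1 ∧ ⋯ ∧ m_n) = ∑ i, m_1 ∧ ⋯ ∧ u (m_i) ∧ ⋯ ∧ m_n` wherever `M` is free of rank
`n`. -/
def IsLeibniz (x : PairDer f M U) (y : PairDer f (det M) U) : Prop :=
  y.der = x.der ∧ ∀ (V : X.Opens) (hV : V ≤ U) (n : ℕ) (hn : IsFreeOn M V n) (m : Fin n → Γ(M, V)),
    y.op.app hV (wedge hn m) = ∑ i, wedge hn (Function.update m i (x.op.app hV (m i)))

/-- The derivation `(h, w)` is the tensor product of the derivations `(h, u)` and `(h, v)`: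
`w (m ⊗ n) = u (m) ⊗ n + m ⊗ v (n)`. -/
def IsTensorDer (x : PairDer f M U) (y : PairDer f N U) (z : PairDer f (tensor M N) U) : Prop :=
  z.der = x.der ∧ z.der = y.der ∧ ∀ (V : X.Opens) (hV : V ≤ U) (m : Γ(M, V)) (n : Γ(N, V)),
    z.op.app hV (tmul m n) = tmul (x.op.app hV m) n + tmul m (y.op.app hV n)

/-- The operator `φ ↦ h φ - φ u` on the dual of `M`. -/
def transposeOp (x : PairDer f M U) : Op (dual M) (dual M) U :=
  ⟨fun V => AddMonoidHom.mk' (fun φ : (linData M (OO X)).S V.1 =>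
      (⟨(Op.restrict V.2 x.der).comp φ.1 - φ.1.comp (Op.restrict V.2 x.op), fun W hW a m => by
        have hφ := φ.2 W hW
        have e₁ := (Op.IsDer.isPair x.2.1).app_smul (hW.trans V.2) a (φ.1.app hW m)
        have e₂ := x.2.2.app_smul (hW.trans V.2) a m
        change x.1.1.app _ (φ.1.app hW (a • m)) - φ.1.app hW (x.1.2.app _ (a • m)) =
          a • (x.1.1.app _ (φ.1.app hW m) - φ.1.app hW (x.1.2.app _ m))
        rw [hφ, e₂, map_add, hφ, hφ, smul_sub]
        refine (congrArg (fun t => t - _) e₁).trans ?_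
        abel⟩ : (linData M (OO X)).S V.1))
    fun φ ψ => Subtype.ext (Op.ext fun W hW m => by
      change x.1.1.app (hW.trans V.2) (φ.1.app hW m + ψ.1.app hW m) -
          (φ.1.app hW (x.1.2.app _ m) + ψ.1.app hW (x.1.2.app _ m)) =
        (x.1.1.app _ (φ.1.app hW m) - φ.1.app hW (x.1.2.app _ m)) +
          (x.1.1.app _ (ψ.1.app hW m) - ψ.1.app hW (x.1.2.app _ m))
      rw [map_add]; abel),
    fun _ _ _ _ _ => rfl⟩

/-- The transpose `(h, φ ↦ h φ - φ u)` of a derivation `(h, u)` of a pair. -/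
def transpose (x : PairDer f M U) : PairDer f (dual M) U :=
  ⟨(x.der, transposeOp x), x.2.1, fun V hV a φ => Subtype.ext (Op.ext fun W hW m => by
    have e₁ := (Op.IsDer.isPair x.2.1).app_smul (hW.trans hV) (resO hW a) (φ.1.app hW m)
    change (x.1.1.app (hW.trans hV) (resO hW a • φ.1.app hW m) -
        resO hW a • φ.1.app hW (x.1.2.app (hW.trans hV) m)) -
      resO hW a • (x.1.1.app (hW.trans hV) (φ.1.app hW m) -
        φ.1.app hW (x.1.2.app (hW.trans hV) m)) = resO hW (x.1.1.onFun hV a) • φ.1.app hW m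
    refine Eq.trans ?_ (congrArg (fun b => b • φ.1.app hW m)
      (Op.resO_onFun x.1.1 hV hW a).symm)
    rw [smul_sub]
    refine (congrArg (fun t => t - _ - _) e₁).trans ?_
    abel)⟩

/-- The derivation of `(X, L^{(-1)^i})` given by a derivation of `(X, L)`: itself for even `i`, its
transpose for odd `i`. -/
def signedDer (x : PairDer f M U) : (b : Bool) → PairDer f (signed M b) U
  | true => x
  | false => transpose x

/-- The derivation `z` is the tensor product of the derivations `y_a, …, y_{a+k}`. -/
def IsTensorRangeDer {L : ℤ → X.Modules} (y : ∀ i, PairDer f (L i) U) :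
    (a : ℤ) → (k : ℕ) → PairDer f (tensorRange L a k) U → Prop
  | a, 0, z => z = y a
  | a, k + 1, z => ∃ w : PairDer f (tensorRange L (a + 1) k) U,
      IsTensorRangeDer y (a + 1) k w ∧ IsTensorDer (y a) w z

end

section

variable {f : X ⟶ Spec (CommRingCat.of A)} {E : CochainComplex X.Modules ℤ} {U : X.Opens}

/-- The derivation `(h, u_i)` of the pair `(X, E^i)` in a derivation of degree zero of `(X, E)`. -/
def DerCoch.component (x : DerCoch f E 0 U) (i : ℤ) : PairDer f (E.X i) U :=
  ⟨(x.1.1, Coch.at' (i := 0) x.1.2 i i (add_zero i)), x.2.der, x.2.pair i (add_zero i)⟩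

/-- The derivation `z` of `(X, det E)` is the trace of the derivation `x` of degree zero of `(X, E)`:
the tensor product of the Leibniz extensions of the components of `x` to the determinants of the
terms of `E`, transposed in odd degrees. -/
def IsTraceDer (a : ℤ) (k : ℕ) (x : DerCoch f E 0 U) (z : PairDer f (detComplex E a k) U) : Prop :=
  ∃ y : ∀ i, PairDer f (det (E.X i)) U, (∀ i, IsLeibniz (x.component i) (y i)) ∧
    IsTensorRangeDer (L := detFactor E) (fun i => signedDer (y i) (decide (Even i))) a k z

/-- The component `E^i → E^i` of a linear cochain of degree zero, on sections over `V`. -/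
def homComponent (x : (homData E 0).S U) (i : ℤ) {V : X.Opens} (hV : V ≤ U) :
    Γ(E.X i, V) →ₗ[Γ(X, V)] Γ(E.X i, V) where
  toFun := (Coch.at' (i := 0) x.1 i i (add_zero i)).app hV
  map_add' := map_add _
  map_smul' := x.2 i i (add_zero i) V hV

variable (f E) in
/-- `tr` is the trace map: in degree zero, `tr (u) = ∑ i, (-1)^i tr (u_i)` wherever the terms of `E`
are free. It is zero in the other degrees, where the target vanishes. -/
def IsTrace (a : ℤ) (k : ℕ) (tr : (homDG f E).Hom (trivialLie f).toDG) : Prop :=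
  ∀ (U : X.Opens) (x : (homData E 0).S U) (V : X.Opens) (hV : V ≤ U),
    (∀ i, ∃ n, IsFreeOn (E.X i) V n) →
    fn V (res (OO X) hV ((LieSheaf.proj (OO X) 0).app U ((tr.hom.f 0).app U x))) =
      ∑ i ∈ Finset.Icc a (a + k), i.negOnePow •
        LinearMap.trace Γ(X, V) Γ(E.X i, V) (homComponent x i hV)

variable (f E) in
/-- `Tr` is the trace map on derivations: in degree zero it sends a derivation of `(X, E)` to its
trace. It is zero in the other degrees, where the target vanishes. -/
def IsTraceMap (a : ℤ) (k : ℕ) (Tr : (derDG f E).Hom (pairLie f (detComplex E a k)).toDG) : Prop :=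
  ∀ (U : X.Opens) (x : DerCoch f E 0 U),
    IsTraceDer a k x ((LieSheaf.proj (pairData f (detComplex E a k)).toModules 0).app U
      ((Tr.hom.f 0).app U x) : PairDer f (detComplex E a k) U)

/-- A sequence `0 → L → M → N → 0` of sheaves of DG-Lie algebras is exact. -/
def IsExactSeq {L M N : DGLieSheaf f} (i : L.Hom M) (p : M.Hom N) : Prop :=
  ∃ h : i.hom ≫ p.hom = 0, (ShortComplex.mk i.hom p.hom h).ShortExact

end

end

end DGPair

end

open DGPair

/-! ### Finite presentations of sheaves of modules on a site -/

namespace SheafOfModules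

universe v₁ u₁

variable {C : Type u₁} [Category.{v₁} C] {J : GrothendieckTopology C} {R : Sheaf J RingCat.{u}}

/-! The trace is characterised locally and uniquely, so it can be built on frames and glued. Where
E^i has a frame e, a derivation of det E^i over a given h is determined by its value on the
generator e_1 ∧ ⋯ ∧ e_n, and that value can be prescribed. Prescribing it by the Leibniz formula
makes the formula hold for all m_1, …, m_n: the failure of the formula is again an alternating map
(`leibnizDefect`), and a top degree alternating map that vanishes on a basis is zero. Tensor
products of derivations of invertible sheaves are handled in the same way; transposes are explicit.
The relations `IsLeibniz`, `IsTensorDer` and `IsTraceDer` are stable under sums, multiples,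
restriction and brackets. Together with uniqueness this makes the chosen trace a linear map of
sheaves that preserves brackets in degree zero. It does not change h, which is the commutativity of
the right-hand square.

To be a morphism of DG-Lie algebras, the trace must also kill the differentials of elements of
degree -1 and the brackets of elements of opposite nonzero degrees. Both have the form (0, [u, v])
with u and v linear. For linear u, the Leibniz extension of u_i is multiplication by tr(u_i),
transposition changes the sign, and tensor products add scalars; so the trace of (0, u) is locally
multiplication by the supertrace (`isTraceDer_linDer`). The supertrace of a supercommutator vanishes
by cyclicity of the trace and a shift of the summation index (`supertrace_br`). Globally, the trace
of (0, u) has zero anchor, hence is multiplication by a unique function because det E is invertible.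
That function is taken as the trace of u, so the left-hand square commutes by construction.

For exactness, a derivation with h = 0 is linear, and the linear operators on an invertible sheaf
are scalars. The anchors are locally surjective because h can act on the coefficients with respect
to a frame.

For coherence, every term is, on small affine open sets V, the kernel of a matrix over the
noetherian ring Γ(V), compatibly over all open subsets of V (`IsKerOn`). Clearing denominators turns
generators of the kernel over Γ(V) into generators of the sheaf; the same argument applied to the
relations gives a finite presentation. For the tangent sheaf the matrix is the Jacobian matrix of a
presentation of Γ(V) over A. A solution over W ⊆ V is a derivation Γ(V) → Γ(W), which the quotient
rule extends to functions on all open subsets of W. The remaining terms are locally free or locally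
extensions of the tangent sheaf by a free sheaf, which only adds unknowns without equations. -/

theorem epi_of_locally_surjective {M N : SheafOfModules.{u} R} (g : M ⟶ N)
    (h : ∀ (U : C) (x : N.val.obj (op U)), ∃ S ∈ J U, ∀ (V : C) (i : V ⟶ U), S i →
      ∃ y : M.val.obj (op V), g.val.app (op V) y = N.val.map i.op x) : Epi g := by
  have : Sheaf.IsLocallySurjective ((toSheaf R).map g) := by
    constructor
    intro U x
    obtain ⟨S, hS, hx⟩ := h U x
    exact J.superset_covering (fun V i hi => hx V i hi) hS
  -- The functor to abelian sheaves reflects epimorphisms, and there local surjectivity suffices.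
  exact (toSheaf R).epi_of_epi_map (Sheaf.epi_of_isLocallySurjective _)

/-- Forgetting the sheaf condition preserves monomorphisms, and monomorphisms of presheaves of
modules are injective on sections. This lets sections of a kernel be compared inside the ambient
free sheaf. -/
theorem injective_of_mono {M N : SheafOfModules.{u} R} (g : M ⟶ N) [Mono g] (U : Cᵒᵖ) :
    Function.Injective (g.val.app U) := by
  have : Mono g.val := (forget R).map_mono g
  exact PresheafOfModules.injective_of_mono g.val U

variable [HasSheafify J AddCommGrpCat.{u}] [J.WEqualsLocallyBijective AddCommGrpCat.{u}]

/-- The section `∑ i, a i • e i` of a free sheaf of modules. -/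
noncomputable def freeElt {I : Type u} [Fintype I] (U : Cᵒᵖ) (a : I → R.obj.obj U) :
    (free (R := R) I).val.obj U :=
  ∑ i, a i • (freeSection (R := R) i).eval U

/-- A finite coproduct is a biproduct: the projections satisfy `∑ p i ≫ ιFree i = 𝟙`, and this
identity applied to `x` exhibits the coefficients `p i x`. No passage to a cover is needed. -/
theorem freeElt_surjective {I : Type u} [Fintype I] (U : Cᵒᵖ)
    (x : (free (R := R) I).val.obj U) : ∃ a, freeElt U a = x := by
  classical
  let p (i : I) : free (R := R) I ⟶ unit R :=
    Limits.Cofan.IsColimit.desc (isColimitFreeCofan I) (fun j => if j = i then 𝟙 _ else 0)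
  have hp (i j : I) : ιFree j ≫ p i = if j = i then 𝟙 _ else 0 := by
    rw [← freeCofan_inj]; exact Limits.Cofan.IsColimit.fac _ _ _
  have h1 : ∑ i, p i ≫ ιFree i = 𝟙 (free (R := R) I) := by
    refine Limits.Cofan.IsColimit.hom_ext (isColimitFreeCofan I) _ _ fun j => ?_
    have h0 : ιFree j ≫ ∑ i, p i ≫ ιFree i = ιFree j := by
      rw [Preadditive.comp_sum]
      rw [Finset.sum_eq_single j]
      · rw [← Category.assoc, hp, if_pos rfl, Category.id_comp]
      · intro i _ hi
        rw [← Category.assoc, hp, if_neg hi.symm, Limits.zero_comp]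
      · simp
    exact h0.trans (Category.comp_id _).symm
  -- Evaluation at `x` is additive in the morphism, so a sum of morphisms becomes a sum of sections.
  let ev : (free (R := R) I ⟶ free I) →+ (free (R := R) I).val.obj U :=
    AddMonoidHom.mk' (fun g => g.val.app U x) fun _ _ => rfl
  refine ⟨fun i => (p i).val.app U x, ?_⟩
  have h2 : ev (∑ i, p i ≫ ιFree i) = x := by rw [h1]; rfl
  rw [map_sum] at h2
  refine Eq.trans (Finset.sum_congr rfl fun i _ => ?_) h2
  change _ = (ιFree i).val.app U ((p i).val.app U x)
  have e : ∀ y : R.obj.obj U, (ιFree (R := R) i).val.app U y =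
      y • (ιFree (R := R) i).val.app U (1 : R.obj.obj U) := fun y => by
    refine Eq.trans ?_ (((ιFree (R := R) i).val.app U).hom.map_smul y (1 : R.obj.obj U))
    exact congrArg ((ιFree (R := R) i).val.app U) (mul_one y).symm
  refine Eq.trans ?_ (e _).symm
  refine congrArg (fun t : (free (R := R) I).val.obj U =>
    (show R.obj.obj U from (p i).val.app U x) • t) ?_
  change (unitHomEquiv _ (ιFree i ≫ 𝟙 _)).eval U = _
  rw [Category.comp_id]
  rfl

theorem app_freeElt {M : SheafOfModules.{u} R} {I : Type u} [Fintype I] (s : I → M.sections)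
    (U : Cᵒᵖ) (a : I → R.obj.obj U) :
    (M.freeHomEquiv.symm s).val.app U (freeElt U a) = ∑ i, a i • (s i).eval U := by
  rw [freeElt, map_sum]
  refine Finset.sum_congr rfl fun i _ => ?_
  rw [map_smul]
  congr 1
  exact congrArg (fun t : M.sections => t.eval U) (sectionsMap_freeHomEquiv_symm_freeSection s i)

theorem map_freeElt {I : Type u} [Fintype I] {U V : Cᵒᵖ} (f : U ⟶ V) (a : I → R.obj.obj U) :
    (free (R := R) I).val.map f (freeElt U a) = freeElt V fun i => R.obj.map f (a i) := by
  rw [freeElt]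
  refine (map_sum ((free (R := R) I).val.presheaf.map f).hom _ _).trans
    (Finset.sum_congr rfl fun i _ => ?_)
  refine ((free (R := R) I).val.map_smul f (a i) _).trans ?_
  congr 1
  exact PresheafOfModules.sections_property _ f

/-- A sheaf of modules which is locally generated by finitely many global sections, such that the
relations between them are locally generated by finitely many global relations, has a finite
presentation. -/
theorem exists_finite_presentation (M : SheafOfModules.{u} R) {I K : Type u} [Fintype I] [Fintype K]
    (s : I → M.sections) (c : K → I → ∀ U : Cᵒᵖ, R.obj.obj U)
    (hcmap : ∀ j i {U V : Cᵒᵖ} (f : U ⟶ V), R.obj.map f (c j i U) = c j i V)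
    (hs : ∀ (U : C) (x : M.val.obj (op U)), ∃ S ∈ J U, ∀ (V : C) (f : V ⟶ U), S f →
      ∃ a : I → R.obj.obj (op V), ∑ i, a i • (s i).eval (op V) = M.val.map f.op x)
    (hc₀ : ∀ j U, ∑ i, c j i U • (s i).eval U = 0)
    (hc : ∀ (U : C) (a : I → R.obj.obj (op U)), ∑ i, a i • (s i).eval (op U) = 0 →
      ∃ S ∈ J U, ∀ (V : C) (f : V ⟶ U), S f →
      ∃ b : K → R.obj.obj (op V), ∀ i, R.obj.map f.op (a i) = ∑ j, b j * c j i (op V)) :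
    ∃ P : M.Presentation, P.IsFinite := by
  let π := M.freeHomEquiv.symm s
  have hπ : Epi π := epi_of_locally_surjective _ fun U x => by
    obtain ⟨S, hS, h⟩ := hs U x
    refine ⟨S, hS, fun V f hf => ?_⟩
    obtain ⟨a, ha⟩ := h V f hf
    exact ⟨freeElt _ a, (app_freeElt s _ a).trans ha⟩
  let σ : M.GeneratingSections := ⟨I, s, hπ⟩
  let r (j : K) : (free (R := R) I).sections := PresheafOfModules.sectionsMk
    (fun U => freeElt U fun i => c j i U) (fun U V f => by simp only [map_freeElt, hcmap]; rfl)
  let ρ : free K ⟶ free I := (free I).freeHomEquiv.symm r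
  have hρ : ρ ≫ σ.π = 0 := by
    apply M.freeHomEquiv.injective
    funext j
    rw [freeHomEquiv_symm_comp, Equiv.apply_symm_apply]
    refine PresheafOfModules.sections_ext _ _ fun U => ?_
    exact (app_freeElt s U _).trans (hc₀ j U)
  let l : free K ⟶ Limits.kernel σ.π := Limits.kernel.lift _ ρ hρ
  have hl : l ≫ Limits.kernel.ι σ.π = ρ := Limits.kernel.lift_ι _ _ _
  -- A section of the kernel is a combination of the generators that maps to zero. By `hc` it is
  -- locally a combination of the given relations; the equality is checked in `free I`, where the
  -- kernel embeds.
  have : Epi l := epi_of_locally_surjective _ fun U x => by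
    obtain ⟨a, ha⟩ := freeElt_surjective (op U) ((Limits.kernel.ι σ.π).val.app (op U) x)
    have h0 : ∑ i, a i • (s i).eval (op U) = 0 := by
      rw [← app_freeElt, ha]
      exact congrArg (fun g : Limits.kernel σ.π ⟶ M => g.val.app (op U) x)
        (Limits.kernel.condition σ.π)
    obtain ⟨S, hS, h⟩ := hc U a h0
    refine ⟨S, hS, fun V f hf => ?_⟩
    obtain ⟨b, hb⟩ := h V f hf
    refine ⟨freeElt _ b, injective_of_mono (Limits.kernel.ι σ.π) (op V) ?_⟩
    have e1 : (Limits.kernel.ι σ.π).val.app (op V) (l.val.app (op V) (freeElt (op V) b)) =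
        ρ.val.app (op V) (freeElt (op V) b) :=
      congrArg (fun g : free K ⟶ free I => g.val.app (op V) (freeElt (op V) b)) hl
    have e2 : (Limits.kernel.ι σ.π).val.app (op V) ((Limits.kernel σ.π).val.map f.op x) =
        (free (R := R) I).val.map f.op ((Limits.kernel.ι σ.π).val.app (op U) x) :=
      PresheafOfModules.naturality_apply _ _ _
    refine e1.trans (Eq.trans ?_ e2.symm)
    rw [app_freeElt, ← ha, map_freeElt]
    simp only [hb]
    change ∑ j, b j • freeElt (op V) (fun i => c j i (op V)) = _
    simp only [freeElt, Finset.smul_sum, Finset.sum_smul, smul_smul]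
    exact Finset.sum_comm
  let τ : (Limits.kernel σ.π).GeneratingSections :=
    ⟨K, (Limits.kernel σ.π).freeHomEquiv l, by rwa [Equiv.symm_apply_apply]⟩
  refine ⟨⟨σ, τ⟩, ⟨⟨?_⟩, ⟨?_⟩⟩⟩
  · exact inferInstanceAs (Finite I)
  · exact inferInstanceAs (Finite K)

end SheafOfModules

noncomputable section

namespace DGPair

variable {X : Scheme.{u}}

/-! ### Coherence from presentations on sections -/

/-- Over `V`, the sheaf `M` is generated by the sections `s i`, and the relations between them are
generated by the relations `∑ i, c j i • s i = 0`. -/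
structure IsPresentedBy (M : X.Modules) (V : X.Opens) {r q : ℕ} (s : Fin r → Γ(M, V))
    (c : Fin q → Fin r → Γ(X, V)) : Prop where
  gen : ∀ (W : X.Opens) (h : W ≤ V) (m : Γ(M, W)) (x : X), x ∈ W →
    ∃ (W' : X.Opens) (h' : W' ≤ W), x ∈ W' ∧ ∃ a : Fin r → Γ(X, W'),
      ∑ i, a i • res M (h'.trans h) (s i) = res M h' m
  rel_eq : ∀ j, ∑ i, c j i • s i = 0
  rel : ∀ (W : X.Opens) (h : W ≤ V) (a : Fin r → Γ(X, W)), ∑ i, a i • res M h (s i) = 0 →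
    ∀ x, x ∈ W → ∃ (W' : X.Opens) (h' : W' ≤ W), x ∈ W' ∧ ∃ b : Fin q → Γ(X, W'),
      ∀ i, resO h' (a i) = ∑ j, b j * resO (h'.trans h) (c j i)

/-- Covering sieves of `U` in the slice over `V` correspond to covering sieves of the open set
`U.left`. A property stable under shrinking defines a sieve, which covers as soon as the property
holds near every point. This translates pointwise statements into the sieves required for
presentations. -/
theorem over_covering {V : X.Opens} (U : Over V) (P : ∀ W : X.Opens, W ≤ U.left → Prop)
    (hP : ∀ (W : X.Opens) (h : W ≤ U.left) (W' : X.Opens) (h' : W' ≤ W), P W h → P W' (h'.trans h))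
    (hcov : ∀ x, x ∈ U.left → ∃ (W : X.Opens) (h : W ≤ U.left), x ∈ W ∧ P W h) :
    ∃ S ∈ ((Opens.grothendieckTopology X).over V) U, ∀ (W : Over V) (f : W ⟶ U), S f →
      P W.left (leOfHom f.left) := by
  refine ⟨(Sieve.overEquiv U).symm
    { arrows := fun W f => P W (leOfHom f)
      downward_closed := fun {W W'} f hf g => hP W _ W' (leOfHom g) hf }, ?_, ?_⟩
  · rw [GrothendieckTopology.mem_over_iff, OrderIso.apply_symm_apply]
    intro x hx
    obtain ⟨W, h, hxW, hW⟩ := hcov x hx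
    exact ⟨W, homOfLE h, hW, hxW⟩
  · intro W f hf
    rwa [Sieve.overEquiv_symm_iff] at hf

/-- Sections over `V` become global sections on the slice site by restriction, and likewise the
coefficients of the relations. `ULift` only places the finite index types in the universe of the
scheme. -/
theorem IsPresentedBy.exists_presentation {M : X.Modules} {V : X.Opens} {r q : ℕ}
    {s : Fin r → Γ(M, V)} {c : Fin q → Fin r → Γ(X, V)} (hM : IsPresentedBy M V s c) :
    ∃ P : (SheafOfModules.over (R := X.ringCatSheaf) M V).Presentation, P.IsFinite := by
  refine SheafOfModules.exists_finite_presentation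
    (SheafOfModules.over (R := X.ringCatSheaf) M V)
    (I := ULift.{u} (Fin r)) (K := ULift.{u} (Fin q))
    (fun i => PresheafOfModules.sectionsMk
      (fun U => (res M (leOfHom U.unop.hom) (s i.down) : Γ(M, U.unop.left)))
      (fun U W f => res_res M (leOfHom U.unop.hom) (leOfHom f.unop.left) (s i.down)))
    (fun j i U => (resO (leOfHom U.unop.hom) (c j.down i.down) : Γ(X, U.unop.left)))
    (fun j i U W f => resO_resO (leOfHom U.unop.hom) (leOfHom f.unop.left) (c j.down i.down))
    (fun U x => ?_) (fun j U => ?_) (fun U a ha => ?_)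
  · have key := over_covering U (fun W h => ∃ a : Fin r → Γ(X, W),
      ∑ i, a i • res M (h.trans (leOfHom U.hom)) (s i) = res M h (show Γ(M, U.left) from x))
    refine Exists.elim (key ?_ ?_) ?_
    · rintro W h W' h' ⟨a, ha⟩
      refine ⟨fun i => resO h' (a i), ?_⟩
      rw [← res_res M h h', ← ha, map_sum]
      simp only [res_smul, res_res]
    · intro x' hx'
      obtain ⟨W, h, hx, a, ha⟩ := hM.gen U.left (leOfHom U.hom) x x' hx'
      exact ⟨W, h, hx, a, ha⟩
    · rintro S ⟨hS, h⟩
      refine ⟨S, hS, fun W f hf => ?_⟩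
      obtain ⟨a, ha⟩ := h W f hf
      refine ⟨fun i => a i.down, Eq.trans ?_ ha⟩
      exact Fintype.sum_equiv Equiv.ulift _ (fun i => a i • res M (leOfHom W.hom) (s i))
        fun i => rfl
  · have := congrArg (res M (leOfHom U.unop.hom)) (hM.rel_eq j.down)
    rw [map_sum, map_zero] at this
    refine Eq.trans ?_ this
    refine Fintype.sum_equiv Equiv.ulift _ _ fun i => ?_
    exact (res_smul M (leOfHom U.unop.hom) _ _).symm
  · have ha' : ∑ i, (show Γ(X, U.left) from a ⟨i⟩) • res M (leOfHom U.hom) (s i) = 0 := by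
      refine Eq.trans ?_ ha
      exact Fintype.sum_equiv Equiv.ulift.symm _ _ fun i => rfl
    have key := over_covering U (fun W h => ∃ b : Fin q → Γ(X, W),
      ∀ i : Fin r, resO h (show Γ(X, U.left) from a ⟨i⟩) =
        ∑ j, b j * resO (h.trans (leOfHom U.hom)) (c j i))
    refine Exists.elim (key ?_ ?_) ?_
    · rintro W h W' h' ⟨b, hb⟩
      refine ⟨fun j => resO h' (b j), fun i => ?_⟩
      rw [← resO_resO h h', hb, map_sum]
      simp only [map_mul, resO_resO]
    · intro x' hx'
      obtain ⟨W, h, hx, b, hb⟩ := hM.rel U.left (leOfHom U.hom) _ ha' x' hx'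
      exact ⟨W, h, hx, b, hb⟩
    · rintro S ⟨hS, h⟩
      refine ⟨S, hS, fun W f hf => ?_⟩
      obtain ⟨b, hb⟩ := h W f hf
      refine ⟨fun j => b j.down, fun i => (hb i.down).trans ?_⟩
      exact Fintype.sum_equiv Equiv.ulift.symm _ _ fun j => rfl

theorem isCoherent_of_isFinitePresentation (M : SheafOfModules.{u} X.ringCatSheaf)
    (h : M.IsFinitePresentation) : IsCoherent (X := X) M :=
  ⟨inferInstanceAs M.IsQuasicoherent, inferInstanceAs M.IsFiniteType⟩

theorem IsCoherent.of_isPresentedBy (M : X.Modules)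
    (h : ∀ x : X, ∃ (V : X.Opens) (r q : ℕ) (s : Fin r → Γ(M, V)) (c : Fin q → Fin r → Γ(X, V)),
      x ∈ V ∧ IsPresentedBy M V s c) : IsCoherent M := by
  choose V r q s c hx hV using h
  choose P hP using fun x => (hV x).exists_presentation
  let D : SheafOfModules.QuasicoherentData.{u} (R := X.ringCatSheaf) M :=
    { I := X
      X := V
      coversTop := by
        refine (Opens.coversTop_iff (T := X) V).2 ?_
        rw [IsOpenCover, eq_top_iff]
        intro x _
        exact Opens.mem_iSup.2 ⟨x, hx x⟩
      presentation := P }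
  have hD : SheafOfModules.QuasicoherentData.IsFinitePresentation.{u} D := by
    constructor; exact hP
  refine isCoherent_of_isFinitePresentation M ?_
  constructor; exact ⟨D, hD⟩

/-! ### Kernels of matrices on noetherian affine schemes -/

/-- The kernel over `Γ(X, V)` is finitely generated because the ring is noetherian. These generators
also generate the solutions over smaller open sets since localization is exact: near a point of `W`,
on a basic open set, a solution becomes one over `V` after multiplication by a unit. -/
theorem IsAffineOpen_exists_ker_generators {V : X.Opens} (hV : IsAffineOpen V)
    [IsNoetherianRing Γ(X, V)] {n m : Type} [Fintype n] [Fintype m] (T : m → n → Γ(X, V)) :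
    ∃ (r : ℕ) (c : Fin r → n → Γ(X, V)), (∀ k j, ∑ i, T j i * c k i = 0) ∧
      ∀ (W : X.Opens) (h : W ≤ V) (b : n → Γ(X, W)), (∀ j, ∑ i, resO h (T j i) * b i = 0) →
        ∀ x, x ∈ W → ∃ (W' : X.Opens) (h' : W' ≤ W), x ∈ W' ∧ ∃ a : Fin r → Γ(X, W'),
          ∀ i, resO h' (b i) = ∑ k, a k * resO (h'.trans h) (c k i) := by
  let K := LinearMap.ker (Matrix.mulVecLin (Matrix.of T))
  obtain ⟨r, c, hc⟩ := Submodule.fg_iff_exists_fin_generating_family.1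
    (IsNoetherian.noetherian K)
  have hK : ∀ v : n → Γ(X, V), v ∈ K ↔ ∀ j, ∑ i, T j i * v i = 0 := fun v => by
    simp only [K, LinearMap.mem_ker, funext_iff]
    rfl
  refine ⟨r, c, fun k => (hK _).1 (hc ▸ Submodule.subset_span ⟨k, rfl⟩), fun W h b hb x hx => ?_⟩
  obtain ⟨g, hgW, hxg⟩ := hV.exists_basicOpen_le ⟨x, hx⟩ (h hx)
  have := hV.isLocalization_basicOpen g
  have halg : ∀ y : Γ(X, V), algebraMap Γ(X, V) Γ(X, X.basicOpen g) y = resO (hgW.trans h) y :=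
    fun y => rfl
  -- A common denominator `p` for the finitely many entries of the solution; `b'` are the numerators
  -- over `V`.
  obtain ⟨⟨p, hp⟩, hpb⟩ := IsLocalization.exist_integer_multiples_of_finite
    (Submonoid.powers g) (fun i => resO hgW (b i))
  choose b' hb' using hpb
  have hb'' : ∀ i, resO (hgW.trans h) (b' i) = resO (hgW.trans h) p * resO hgW (b i) := fun i =>
    (hb' i).trans (Algebra.smul_def _ _)
  -- The numerators solve the equations only after localization, that is, up to a power of `g` for
  -- each equation.
  have hz : ∀ j, ∃ d ∈ Submonoid.powers g, d * ∑ i, T j i * b' i = 0 := fun j => by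
    have : algebraMap Γ(X, V) Γ(X, X.basicOpen g) (∑ i, T j i * b' i) = 0 := by
      have e := congrArg (resO hgW) (hb j)
      rw [map_zero, map_sum] at e
      rw [map_sum]
      simp only [map_mul, resO_resO, halg, hb''] at e ⊢
      calc _ = resO (hgW.trans h) p * ∑ i, resO (hgW.trans h) (T j i) * resO hgW (b i) := by
            rw [Finset.mul_sum]; exact Finset.sum_congr rfl fun i _ => by ring
        _ = 0 := by rw [e, mul_zero]
    obtain ⟨d, hd⟩ := (IsLocalization.map_eq_zero_iff (Submonoid.powers g) _ _).1 this
    exact ⟨d, d.2, hd⟩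
  choose d hd hd0 using hz
  -- The product of these powers works for all equations at once.
  have hmem : (fun i => (∏ j, d j) * b' i) ∈ K := (hK _).2 fun j => by
    have : ∑ i, T j i * ((∏ j, d j) * b' i) = (∏ j, d j) * ∑ i, T j i * b' i := by
      rw [Finset.mul_sum]; exact Finset.sum_congr rfl fun i _ => by ring
    classical
    rw [this, ← Finset.mul_prod_erase _ _ (Finset.mem_univ j), mul_right_comm, hd0, zero_mul]
  rw [← hc, Submodule.mem_span_range_iff_exists_fun] at hmem
  obtain ⟨a, ha⟩ := hmem
  have hu : IsUnit (algebraMap Γ(X, V) Γ(X, X.basicOpen g) ((∏ j, d j) * p)) :=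
    IsLocalization.map_units _
      (⟨_, mul_mem (prod_mem fun j _ => hd j) hp⟩ : Submonoid.powers g)
  obtain ⟨w, hw⟩ := hu
  -- The accumulated factor `(∏ d) * p` is a power of `g`, hence the unit `w` on the basic open set,
  -- and is divided out again.
  refine ⟨X.basicOpen g, hgW, hxg, fun k => ↑w⁻¹ * resO (hgW.trans h) (a k), fun i => ?_⟩
  have e := congrArg (algebraMap Γ(X, V) Γ(X, X.basicOpen g)) (congrFun ha i)
  simp only [Finset.sum_apply, Pi.smul_apply, smul_eq_mul, map_sum, map_mul, halg, hb''] at e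
  simp only [mul_assoc, ← Finset.mul_sum]
  rw [e, ← mul_assoc (resO _ _), ← map_mul, ← halg (_ * p), ← hw, Units.inv_mul_cancel_left]

/-- Over every open subset of `V`, the sections of `M` are identified with the solutions of a system
of linear equations with coefficients in the functions on `V`. -/
def IsKerOn (M : X.Modules) (V : X.Opens) : Prop :=
  ∃ (n m : Type) (_ : Fintype n) (_ : Fintype m) (T : m → n → Γ(X, V))
    (φ : ∀ W : X.Opens, W ≤ V → Γ(M, W) →+ (n → Γ(X, W))),
    (∀ W h (a : Γ(X, W)) x i, φ W h (a • x) i = a * φ W h x i) ∧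
    (∀ W h W' (h' : W' ≤ W) x i, φ W' (h'.trans h) (res M h' x) i = resO h' (φ W h x i)) ∧
    (∀ W h x, φ W h x = 0 → x = 0) ∧
    (∀ W h x j, ∑ i, resO h (T j i) * φ W h x i = 0) ∧
    ∀ W h b, (∀ j, ∑ i, resO h (T j i) * b i = 0) → ∃ x, φ W h x = b

/-- The kernel lemma is used twice: for `T` it gives generators, and for the matrix of these
generators it gives the relations between them. -/
theorem IsKerOn.exists_isPresentedBy {M : X.Modules} {V : X.Opens} (hM : IsKerOn M V)
    (hV : IsAffineOpen V) [IsNoetherianRing Γ(X, V)] :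
    ∃ (r q : ℕ) (s : Fin r → Γ(M, V)) (c : Fin q → Fin r → Γ(X, V)), IsPresentedBy M V s c := by
  obtain ⟨n, m, _, _, T, φ, hsmul, hres, hinj, hker, hsurj⟩ := hM
  obtain ⟨r, c, hc0, hc⟩ := IsAffineOpen_exists_ker_generators hV T
  -- A relation between the vectors `c k` is an element of the kernel of the transposed matrix,
  -- since sections are determined by their coordinates.
  obtain ⟨q, d, hd0, hd⟩ := IsAffineOpen_exists_ker_generators hV (fun i k => c k i)
  have hs : ∀ k, ∃ s, φ V le_rfl s = c k := fun k => hsurj V le_rfl (c k) fun j => by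
    simp only [resO_self]; exact hc0 k j
  choose s hs using hs
  have hφ : ∀ (W : X.Opens) (h : W ≤ V) (a : Fin r → Γ(X, W)) (i : n),
      φ W h (∑ k, a k • res M h (s k)) i = ∑ k, a k * resO h (c k i) := fun W h a i => by
    rw [map_sum, Finset.sum_apply]
    refine Finset.sum_congr rfl fun k _ => ?_
    rw [hsmul, hres V le_rfl, hs]
  have hinj' : ∀ (W : X.Opens) (h : W ≤ V) (x y : Γ(M, W)), φ W h x = φ W h y → x = y :=
    fun W h x y e => sub_eq_zero.1 (hinj W h _ (by rw [map_sub, e, sub_self]))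
  refine ⟨r, q, s, d, fun W h x p hp => ?_, fun j => hinj V le_rfl _ (funext fun i => ?_),
    fun W h a ha p hp => ?_⟩
  · obtain ⟨W', h', hp', a, ha⟩ := hc W h (φ W h x) (hker W h x) p hp
    refine ⟨W', h', hp', a, hinj' W' (h'.trans h) _ _ (funext fun i => ?_)⟩
    rw [hφ, hres W h, ha]
  · have e := hφ V le_rfl (d j) i
    simp only [res_self, resO_self] at e
    rw [e, Pi.zero_apply, ← hd0 j i]
    exact Finset.sum_congr rfl fun k _ => mul_comm _ _
  · refine hd W h a (fun i => ?_) p hp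
    have e := hφ W h a i
    rw [ha, map_zero, Pi.zero_apply] at e
    exact (Finset.sum_congr rfl fun k _ => mul_comm _ _).trans e.symm

theorem IsCoherent.of_isKerOn (M : X.Modules)
    (h : ∀ x : X, ∃ V : X.Opens, x ∈ V ∧ IsAffineOpen V ∧ IsNoetherianRing Γ(X, V) ∧
      IsKerOn M V) : IsCoherent M :=
  .of_isPresentedBy M fun x => by
    obtain ⟨V, hx, hV, hn, hM⟩ := h x
    obtain ⟨r, q, s, c, hP⟩ := hM.exists_isPresentedBy hV
    exact ⟨V, r, q, s, c, hx, hP⟩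

end DGPair

end

noncomputable section

namespace DGPair

variable {X : Scheme.{u}}

/-! ### Local determination and local existence of sections -/

namespace SheafData

theorem ext_cover (D : SheafData X) {ι : Type u} (W : ι → X.Opens) {U : X.Opens} (hU : U = iSup W)
    (hW : ∀ i, W i ≤ U) {s t : D.S U} (h : ∀ i, D.r (hW i) s = D.r (hW i) t) : s = t := by
  subst hU
  exact D.sep W s t h

theorem glue_cover (D : SheafData X) {ι : Type u} (W : ι → X.Opens) {U : X.Opens} (hU : U = iSup W)
    (hW : ∀ i, W i ≤ U) (s : ∀ i, D.S (W i))
    (h : ∀ i j, D.r (inf_le_left : W i ⊓ W j ≤ W i) (s i)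
      = D.r (inf_le_right : W i ⊓ W j ≤ W j) (s j)) :
    ∃ t : D.S U, ∀ i, D.r (hW i) t = s i := by
  subst hU
  exact D.glue W s h

theorem cover_eq {U : X.Opens} (W : {x : X // x ∈ U} → X.Opens) (hW : ∀ x, W x ≤ U)
    (hx : ∀ x, x.1 ∈ W x) : U = iSup W :=
  le_antisymm (fun x h => Opens.mem_iSup.2 ⟨⟨x, h⟩, hx _⟩) (iSup_le hW)

/-- Sections that agree near every point are equal. -/
theorem ext_local (D : SheafData X) {U : X.Opens} {s t : D.S U}
    (h : ∀ x, x ∈ U → ∃ (V : X.Opens) (hV : V ≤ U), x ∈ V ∧ D.r hV s = D.r hV t) : s = t := by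
  choose V hV hx h using fun x : {x : X // x ∈ U} => h x.1 x.2
  exact D.ext_cover V (cover_eq V hV hx) hV h

/-- Sections with a property that determines them uniquely exist if they exist locally. -/
theorem exists_of_local (D : SheafData X) {U : X.Opens} (Q : ∀ V : X.Opens, V ≤ U → D.S V → Prop)
    (hres : ∀ (V : X.Opens) (hV : V ≤ U) (V' : X.Opens) (h' : V' ≤ V) (s : D.S V),
      Q V hV s → Q V' (h'.trans hV) (D.r h' s))
    (huniq : ∀ (V : X.Opens) (hV : V ≤ U) (s t : D.S V), Q V hV s → Q V hV t → s = t)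
    (hex : ∀ x, x ∈ U → ∃ (V : X.Opens) (hV : V ≤ U), x ∈ V ∧ ∃ s, Q V hV s) :
    ∃ t : D.S U, ∀ x, x ∈ U → ∃ (V : X.Opens) (hV : V ≤ U), x ∈ V ∧ Q V hV (D.r hV t) := by
  choose V hV hx s hs using fun x : {x : X // x ∈ U} => hex x.1 x.2
  obtain ⟨t, ht⟩ := D.glue_cover V (cover_eq V hV hx) hV s fun i j =>
    huniq _ (inf_le_left.trans (hV i)) _ _ (hres _ _ _ _ _ (hs i)) (hres _ _ _ _ _ (hs j))
  exact ⟨t, fun x h => ⟨V ⟨x, h⟩, hV _, hx _, (ht ⟨x, h⟩).symm ▸ hs _⟩⟩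

/-- The concrete presentation of a sheaf of modules. -/
def ofModules (M : X.Modules) : SheafData X where
  S U := Γ(M, U)
  r h := res M h
  r_smul h a x := res_smul M h a x
  r_self x := res_self M x
  r_r h h' x := res_res M h h' x
  sep W s t h := res_ext M W (le_iSup W) le_rfl s t h
  glue W s h := res_glue M W (le_iSup W) le_rfl s h

end SheafData

/-- Sections of a sheaf of modules that agree near every point are equal. -/
theorem res_ext_local (M : X.Modules) {U : X.Opens} {s t : Γ(M, U)}
    (h : ∀ x, x ∈ U → ∃ (V : X.Opens) (hV : V ≤ U), x ∈ V ∧ res M hV s = res M hV t) : s = t :=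
  (SheafData.ofModules M).ext_local h

/-- Functions that agree near every point are equal. -/
theorem resO_ext_local {U : X.Opens} {s t : Γ(X, U)}
    (h : ∀ x, x ∈ U → ∃ (V : X.Opens) (hV : V ≤ U), x ∈ V ∧ resO hV s = resO hV t) : s = t :=
  (SheafData.ofModules (OO X)).ext_local h

/-- Functions with a property that determines them uniquely exist if they exist locally. -/
theorem exists_fun_of_local {U : X.Opens} (Q : ∀ V : X.Opens, V ≤ U → Γ(X, V) → Prop)
    (hres : ∀ (V : X.Opens) (hV : V ≤ U) (V' : X.Opens) (h' : V' ≤ V) (s : Γ(X, V)),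
      Q V hV s → Q V' (h'.trans hV) (resO h' s))
    (huniq : ∀ (V : X.Opens) (hV : V ≤ U) (s t : Γ(X, V)), Q V hV s → Q V hV t → s = t)
    (hex : ∀ x, x ∈ U → ∃ (V : X.Opens) (hV : V ≤ U), x ∈ V ∧ ∃ s, Q V hV s) :
    ∃ t : Γ(X, U), ∀ x, x ∈ U → ∃ (V : X.Opens) (hV : V ≤ U), x ∈ V ∧ Q V hV (resO hV t) :=
  (SheafData.ofModules (OO X)).exists_of_local Q hres huniq hex

/-- Operators that agree near every point are equal. -/
theorem Op.ext_local {M N : X.Modules} {U : X.Opens} {u v : Op M N U}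
    (h : ∀ x, x ∈ U → ∃ (V : X.Opens) (hV : V ≤ U), x ∈ V ∧
      Op.restrict hV u = Op.restrict hV v) : u = v :=
  (opData M N).ext_local h

/-! ### Frames -/

namespace IsFrame

variable {E N : X.Modules} {V W : X.Opens} {n : ℕ} {e : Fin n → Γ(E, V)}

/-- The basis of the sections over `W` given by a frame. -/
def basis (he : IsFrame E V e) (h : W ≤ V) : Module.Basis (Fin n) Γ(X, W) Γ(E, W) :=
  Module.Basis.mk (he W h).1 (he W h).2.ge

theorem basis_apply (he : IsFrame E V e) (h : W ≤ V) (i : Fin n) :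
    he.basis h i = res E h (e i) := by
  rw [basis, Module.Basis.mk_apply]

theorem sum_repr (he : IsFrame E V e) (h : W ≤ V) (x : Γ(E, W)) :
    ∑ i, (he.basis h).repr x i • res E h (e i) = x := by
  simpa only [basis_apply] using (he.basis h).sum_repr x

theorem repr_sum (he : IsFrame E V e) (h : W ≤ V) (a : Fin n → Γ(X, W)) (i : Fin n) :
    (he.basis h).repr (∑ i, a i • res E h (e i)) i = a i := by
  simp only [← he.basis_apply h]
  rw [Module.Basis.repr_sum_self]

theorem repr_res (he : IsFrame E V e) (h : W ≤ V) {W' : X.Opens} (h' : W' ≤ W) (x : Γ(E, W))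
    (i : Fin n) :
    (he.basis (h'.trans h)).repr (res E h' x) i = resO h' ((he.basis h).repr x i) := by
  conv_lhs => rw [← he.sum_repr h x]
  rw [map_sum]
  simp only [res_smul, res_res]
  exact he.repr_sum _ _ i

theorem mono (he : IsFrame E V e) (h : W ≤ V) : IsFrame E W (fun i => res E h (e i)) := by
  intro W' h'
  simpa only [res_res] using he W' (h'.trans h)

theorem isFreeOn (he : IsFrame E V e) : IsFreeOn E V n := ⟨e, he⟩

/-- The linear operator with prescribed values on a frame. -/
def lin (he : IsFrame E V e) (c : Fin n → Γ(N, V)) : Op E N V :=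
  ⟨fun W => AddMonoidHom.mk' (fun x => ∑ i, (he.basis W.2).repr x i • res N W.2 (c i))
    (fun x y => by simp only [map_add, Finsupp.add_apply, add_smul, Finset.sum_add_distrib]),
    fun W W' h h' x => by
      simp only [AddMonoidHom.mk'_apply, map_sum, res_smul, res_res, he.repr_res h h']⟩

theorem lin_app (he : IsFrame E V e) (c : Fin n → Γ(N, V)) (h : W ≤ V) (x : Γ(E, W)) :
    (he.lin c).app h x = ∑ i, (he.basis h).repr x i • res N h (c i) := rfl

theorem isLin_lin (he : IsFrame E V e) (c : Fin n → Γ(N, V)) : Op.IsLin (he.lin c) :=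
  fun W h a x => by
    simp only [lin_app, map_smul, Finsupp.smul_apply, smul_eq_mul, mul_smul, Finset.smul_sum]

theorem repr_self (he : IsFrame E V e) (h : W ≤ V) (i : Fin n) :
    (he.basis h).repr (res E h (e i)) = Finsupp.single i 1 := by
  rw [← he.basis_apply h, Module.Basis.repr_self]

theorem lin_app_self (he : IsFrame E V e) (c : Fin n → Γ(N, V)) (h : W ≤ V) (i : Fin n) :
    (he.lin c).app h (res E h (e i)) = res N h (c i) := by
  rw [lin_app, Finset.sum_eq_single i]
  · rw [repr_self, Finsupp.single_eq_same, one_smul]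
  · intro j _ hj
    rw [repr_self, Finsupp.single_eq_of_ne hj, zero_smul]
  · simp

/-- The operator `∑ i, a i • e i ↦ ∑ i, h (a i) • e i`. -/
def derOp (he : IsFrame E V e) (h : Op (OO X) (OO X) V) : Op E E V :=
  ⟨fun W => AddMonoidHom.mk'
    (fun x => ∑ i, h.onFun W.2 ((he.basis W.2).repr x i) • res E W.2 (e i))
    (fun x y => by simp only [map_add, Finsupp.add_apply, add_smul, Finset.sum_add_distrib]),
    fun W W' hW h' x => by
      simp only [AddMonoidHom.mk'_apply, map_sum, res_smul, res_res, he.repr_res hW h',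
        Op.resO_onFun]⟩

theorem derOp_app (he : IsFrame E V e) (h : Op (OO X) (OO X) V) (hW : W ≤ V) (x : Γ(E, W)) :
    (he.derOp h).app hW x = ∑ i, h.onFun hW ((he.basis hW).repr x i) • res E hW (e i) := rfl

/-- The product rule applied to each coordinate leaves the extra term h(a) ∑ x_i e_i = h(a) x. -/
theorem isPair_derOp (he : IsFrame E V e) {A : Type u} [CommRing A]
    {f : X ⟶ Spec (CommRingCat.of A)} {h : Op (OO X) (OO X) V} (hh : Op.IsDer f h) :
    Op.IsPair h (he.derOp h) := fun W hW a x => by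
  simp only [derOp_app, map_smul, Finsupp.smul_apply, smul_eq_mul, hh.mul, add_smul, mul_smul,
    Finset.sum_add_distrib, Finset.smul_sum, add_sub_cancel_left]
  conv_rhs => rw [← he.sum_repr hW x, Finset.smul_sum]
  exact Finset.sum_congr rfl fun i _ => smul_comm _ _ _

theorem onFun_one {A : Type u} [CommRing A] {f : X ⟶ Spec (CommRingCat.of A)}
    {h : Op (OO X) (OO X) V} (hh : Op.IsDer f h) (hW : W ≤ V) : h.onFun hW 1 = 0 := by
  have := hh.base W hW 1
  rwa [map_one] at this

/-- The coordinates of a frame vector are 0 and 1, which every derivation kills. -/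
theorem derOp_app_self (he : IsFrame E V e) {A : Type u} [CommRing A]
    {f : X ⟶ Spec (CommRingCat.of A)} {h : Op (OO X) (OO X) V} (hh : Op.IsDer f h) (hW : W ≤ V)
    (i : Fin n) : (he.derOp h).app hW (res E hW (e i)) = 0 := by
  rw [derOp_app]
  refine Finset.sum_eq_zero fun j _ => ?_
  by_cases hj : j = i
  · rw [hj, repr_self, Finsupp.single_eq_same, onFun_one hh, zero_smul]
  · rw [repr_self, Finsupp.single_eq_of_ne hj, map_zero, zero_smul]

/-- Linear operators that agree on a frame are equal. -/
theorem ext_lin (he : IsFrame E V e) {u v : Op E N V} (hu : Op.IsLin u) (hv : Op.IsLin v)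
    (h : ∀ i, u.app le_rfl (e i) = v.app le_rfl (e i)) : u = v := by
  refine Op.ext fun W hW x => ?_
  rw [← he.sum_repr hW x, map_sum, map_sum]
  refine Finset.sum_congr rfl fun i _ => ?_
  rw [hu W hW, hv W hW, ← u.res_app le_rfl hW, ← v.res_app le_rfl hW, h]

/-- Derivations of a pair that agree on functions and on a frame are equal. -/
theorem ext_pair (he : IsFrame E V e) {h : Op (OO X) (OO X) V} {u v : Op E E V}
    (hu : Op.IsPair h u) (hv : Op.IsPair h v)
    (huv : ∀ i, u.app le_rfl (e i) = v.app le_rfl (e i)) : u = v := by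
  refine Op.ext fun W hW x => ?_
  rw [← he.sum_repr hW x, map_sum, map_sum]
  refine Finset.sum_congr rfl fun i _ => ?_
  rw [hu.app_smul, hv.app_smul, ← u.res_app le_rfl hW, ← v.res_app le_rfl hW, huv]

/-- The derivation of a pair with prescribed values on a frame. -/
def pair (he : IsFrame E V e) {A : Type u} [CommRing A] {f : X ⟶ Spec (CommRingCat.of A)}
    (h : Op (OO X) (OO X) V) (hh : Op.IsDer f h) (c : Fin n → Γ(E, V)) : PairDer f E V :=
  ⟨(h, he.derOp h + he.lin c), hh, by
    simpa using Op.isPair_add (he.isPair_derOp hh) (Op.isPair_zero.2 (he.isLin_lin c))⟩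

theorem pair_app_self (he : IsFrame E V e) {A : Type u} [CommRing A]
    {f : X ⟶ Spec (CommRingCat.of A)} {h : Op (OO X) (OO X) V} (hh : Op.IsDer f h)
    (c : Fin n → Γ(E, V)) (hW : W ≤ V) (i : Fin n) :
    (he.pair h hh c).op.app hW (res E hW (e i)) = res E hW (c i) := by
  change (he.derOp h + he.lin c).app hW _ = _
  rw [Op.add_app, he.derOp_app_self hh, he.lin_app_self, zero_add]

end IsFrame

/-- For a single vector, linear independence is injectivity and spanning is surjectivity of `a ↦ a •
e`. Generators of invertible sheaves are used in this form. -/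
theorem isFrame_one_iff {L : X.Modules} {V : X.Opens} {e : Γ(L, V)} :
    IsFrame L V (fun _ : Fin 1 => e) ↔
      ∀ (W : X.Opens) (h : W ≤ V), Function.Bijective fun a : Γ(X, W) => a • res L h e := by
  refine forall₂_congr fun W h => ?_
  rw [Function.Bijective, Set.range_const, Submodule.eq_top_iff']
  refine and_congr ?_ (forall_congr' fun x => Submodule.mem_span_singleton)
  rw [Fintype.linearIndependent_iff]
  refine ⟨fun H a b hab => sub_eq_zero.1 (H (fun _ => a - b) ?_ 0), fun H g hg i => ?_⟩
  · simpa [sub_smul, sub_eq_zero] using hab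
  · rw [Subsingleton.elim i 0]
    exact H (by simpa using hg)

/-- Invertible sheaves. -/
def IsInvertible (L : X.Modules) : Prop := ∀ x : X, ∃ V : X.Opens, x ∈ V ∧ IsFreeOn L V 1

theorem IsFreeOn.exists_generator {L : X.Modules} {V : X.Opens} (h : IsFreeOn L V 1) :
    ∃ e : Γ(L, V), IsFrame L V (fun _ : Fin 1 => e) := by
  obtain ⟨e, he⟩ := h
  refine ⟨e 0, ?_⟩
  convert he using 2 with i
  rw [Subsingleton.elim i 0]

/-- Near every point of `U`, an invertible sheaf has a generator. -/
theorem IsInvertible.exists_generator {L : X.Modules} (hL : IsInvertible L) {U : X.Opens} {x : X}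
    (hx : x ∈ U) : ∃ (V : X.Opens) (_ : V ≤ U) (e : Γ(L, V)), x ∈ V ∧
      IsFrame L V (fun _ : Fin 1 => e) := by
  obtain ⟨V, hxV, hV⟩ := hL x
  obtain ⟨e, he⟩ := (hV.mono (inf_le_right : U ⊓ V ≤ V)).exists_generator
  exact ⟨U ⊓ V, inf_le_left, e, ⟨hx, hxV⟩, he⟩

end DGPair

end

noncomputable section

namespace DGPair

variable {X : Scheme.{u}}

/-! ### Sheafification on sections -/

section

variable (P : PresheafOfModules.{u} X.ringCatSheaf.obj) {U V W : X.Opens}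

/-- Restriction of sections of a presheaf of modules. -/
def presRes (h : V ≤ U) : P.obj (op U) →+ P.obj (op V) :=
  (P.presheaf.map (homOfLE h).op).hom

theorem toSheafify_smul (a : Γ(X, U)) (x : P.obj (op U)) :
    toSheafify P U ((show X.ringCatSheaf.obj.obj (op U) from a) • x) = a • toSheafify P U x :=
  (((PresheafOfModules.sheafificationAdjunction (𝟙 X.ringCatSheaf.obj)).unit.app P).app
    (op U)).hom.map_smul (show X.ringCatSheaf.obj.obj (op U) from a) x

theorem res_toSheafify (h : V ≤ U) (x : P.obj (op U)) :
    res (sheafify P) h (toSheafify P U x) = toSheafify P V (presRes P h x) :=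
  (CategoryTheory.congr_fun ((CategoryTheory.toSheafify (Opens.grothendieckTopology X)
    P.presheaf).naturality (homOfLE h).op) x).symm

theorem toSheafify_locally_injective {x y : P.obj (op U)}
    (hxy : toSheafify P U x = toSheafify P U y) {p : X} (hp : p ∈ U) :
    ∃ (V : X.Opens) (h : V ≤ U), p ∈ V ∧ presRes P h x = presRes P h y := by
  obtain ⟨V, g, hg, hV⟩ := Presheaf.equalizerSieve_mem (Opens.grothendieckTopology X)
    (CategoryTheory.toSheafify (Opens.grothendieckTopology X) P.presheaf) (X := op U) x y hxy p hp
  exact ⟨V, leOfHom g, hV, hg⟩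

theorem toSheafify_locally_surjective (y : Γ(sheafify P, U)) {p : X} (hp : p ∈ U) :
    ∃ (V : X.Opens) (h : V ≤ U), p ∈ V ∧ ∃ x, toSheafify P V x = res (sheafify P) h y := by
  obtain ⟨V, g, ⟨x, hx⟩, hV⟩ := Presheaf.imageSieve_mem (Opens.grothendieckTopology X)
    (CategoryTheory.toSheafify (Opens.grothendieckTopology X) P.presheaf) (U := op U) y p hp
  exact ⟨V, leOfHom g, hV, x, hx⟩

/-- A generator of a presheaf of modules is a generator of the associated sheaf. -/
theorem isFrame_toSheafify (e : P.obj (op V)) (he : ∀ (W : X.Opens) (h : W ≤ V),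
    Function.Bijective fun a : Γ(X, W) =>
      ((show X.ringCatSheaf.obj.obj (op W) from a) • presRes P h e : P.obj (op W))) :
    IsFrame (sheafify P) V (fun _ : Fin 1 => toSheafify P V e) := by
  have hr : ∀ (W : X.Opens) (h : W ≤ V) (W' : X.Opens) (h' : W' ≤ W),
      presRes P h' (presRes P h e) = presRes P (h'.trans h) e := fun W h W' h' =>
    (CategoryTheory.congr_fun (P.presheaf.map_comp (homOfLE h).op (homOfLE h').op) e).symm
  have hs : ∀ (W : X.Opens) (h : W ≤ V) (W' : X.Opens) (h' : W' ≤ W) (a : Γ(X, W)),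
      presRes P h' ((show X.ringCatSheaf.obj.obj (op W) from a) • presRes P h e) =
        (show X.ringCatSheaf.obj.obj (op W') from resO h' a) • presRes P (h'.trans h) e :=
    fun W h W' h' a => by
      rw [← hr W h W' h']
      exact P.map_smul (homOfLE h').op _ _
  refine isFrame_one_iff.2 fun W h => ⟨fun a b hab => ?_, fun y => ?_⟩
  · simp only [res_toSheafify, ← toSheafify_smul] at hab
    refine resO_ext_local fun p hp => ?_
    obtain ⟨W', h', hp', e'⟩ := toSheafify_locally_injective P hab hp
    refine ⟨W', h', hp', (he W' (h'.trans h)).1 ?_⟩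
    rwa [hs, hs] at e'
  -- A section of the sheafification comes locally from the presheaf, hence is locally a multiple of
  -- `e`. The coefficients are unique, so they glue.
  · have key := exists_fun_of_local (U := W)
      (fun W' h' (a : Γ(X, W')) => a • res (sheafify P) (h'.trans h) (toSheafify P V e) =
        res (sheafify P) h' y)
    refine Exists.elim (key ?_ ?_ ?_) fun a ha => ⟨a, res_ext_local _ fun p hp => ?_⟩
    · intro W' h' W'' h'' a ha
      have := congrArg (res (sheafify P) h'') ha
      rw [res_smul, res_res, res_res] at this
      exact this
    -- Equality in the sheafification means equality in the presheaf on a smaller open set, where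
    -- `e` is a generator.
    · intro W' h' a b ha hb
      have hab := ha.trans hb.symm
      simp only [res_toSheafify, ← toSheafify_smul] at hab
      refine resO_ext_local fun p hp => ?_
      obtain ⟨W'', h'', hp', e'⟩ := toSheafify_locally_injective P hab hp
      refine ⟨W'', h'', hp', (he W'' (h''.trans (h'.trans h))).1 ?_⟩
      rwa [hs, hs] at e'
    · intro p hp
      obtain ⟨W', h', hp', x, hx⟩ := toSheafify_locally_surjective P y hp
      obtain ⟨a, rfl⟩ := (he W' (h'.trans h)).2 x
      refine ⟨W', h', hp', a, ?_⟩
      rw [← hx, res_toSheafify, ← toSheafify_smul]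
    · obtain ⟨W', h', hp', e'⟩ := ha p hp
      refine ⟨W', h', hp', ?_⟩
      refine (res_smul _ h' a _).trans ?_
      rw [res_res]
      exact e'

end

end DGPair

end

noncomputable section

namespace DGPair

/-! ### Top exterior powers of free modules -/

section

variable {R M N : Type*} [CommRing R] [AddCommGroup M] [Module R M] [AddCommGroup N] [Module R N]
  {n : ℕ}

/-- Top degree alternating maps that agree on a basis are equal. -/
theorem alternatingMap_ext_basis (b : Module.Basis (Fin n) R M) {F G : M [⋀^Fin n]→ₗ[R] N}
    (h : F b = G b) : F = G := by
  -- Only families of basis vectors with injective indices matter. In top degree these are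
  -- permutations of `b`, and both maps change by the same sign.
  refine Module.Basis.ext_alternating b fun i hi => ?_
  let σ : Equiv.Perm (Fin n) := Equiv.ofBijective i (Finite.injective_iff_bijective.1 hi)
  change F (b ∘ σ) = G (b ∘ σ)
  rw [AlternatingMap.map_perm, AlternatingMap.map_perm, h]

/-- Both sides are alternating of top degree in `m` and agree at `b`, where the determinant is 1. -/
theorem ιMulti_eq_det_smul (b : Module.Basis (Fin n) R M) (m : Fin n → M) :
    ExteriorAlgebra.ιMulti R n m = b.det m • ExteriorAlgebra.ιMulti R n b := by
  have := alternatingMap_ext_basis b (F := ExteriorAlgebra.ιMulti R n)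
    (G := (LinearMap.toSpanSingleton R _ (ExteriorAlgebra.ιMulti R n b)).compAlternatingMap b.det)
    (by simp [b.det_self])
  exact DFunLike.congr_fun this m

theorem exists_smul_ιMulti_of_mem (b : Module.Basis (Fin n) R M) {x : ExteriorAlgebra R M}
    (hx : x ∈ ⋀[R]^n M) : ∃ a : R, a • ExteriorAlgebra.ιMulti R n b = x := by
  rw [← exteriorPower.ιMulti_span_fixedDegree] at hx
  rw [← Submodule.mem_span_singleton]
  refine Submodule.span_le.2 ?_ hx
  rintro _ ⟨m, rfl⟩
  exact Submodule.mem_span_singleton.2 ⟨_, (ιMulti_eq_det_smul b m).symm⟩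

/-- The determinant with respect to `b` extends to a linear form on the exterior algebra with value
1 at the product of the basis, so it recovers the scalar. -/
theorem smul_ιMulti_injective (b : Module.Basis (Fin n) R M) :
    Function.Injective fun a : R => a • ExteriorAlgebra.ιMulti R n b := fun a c h => by
  have := congrArg (ExteriorAlgebra.liftAlternating (Pi.single n b.det)) h
  simpa [ExteriorAlgebra.liftAlternating_apply_ιMulti, b.det_self] using this

end

variable {X : Scheme.{u}}

/-! ### Determinants of free sheaves -/

section

variable {E : X.Modules} {V W : X.Opens} {n : ℕ}

theorem wedge_congr (hV : IsFreeOn E V n) {m m' : Fin n → Γ(E, V)} (h : m = m') :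
    wedge hV m = wedge hV m' := by rw [h]

/-- The alternating map `m ↦ m_1 ∧ ⋯ ∧ m_n`. -/
def wedgeMap (hV : IsFreeOn E V n) : Γ(E, V) [⋀^Fin n]→ₗ[Γ(X, V)] Γ(det E, V) where
  toFun := wedge hV
  map_update_add' m i x y := by
    rename_i inst
    -- The field is quantified over all decidability instances; since they are all equal, the
    -- canonical one may be taken.
    obtain rfl : inst = instDecidableEqFin n := Subsingleton.elim _ _
    refine Eq.trans ?_ (map_add (toSheafify (topData E).toPresheafOfModules V)
      (⟨_, ιMulti_mem_topSections hV _⟩ : topSections E V)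
      (⟨_, ιMulti_mem_topSections hV _⟩ : topSections E V))
    exact congrArg (toSheafify (topData E).toPresheafOfModules V)
      (Subtype.ext (AlternatingMap.map_update_add (ExteriorAlgebra.ιMulti Γ(X, V) n) m i x y) :
        (_ : topSections E V) = _)
  map_update_smul' m i a x := by
    rename_i inst
    obtain rfl : inst = instDecidableEqFin n := Subsingleton.elim _ _
    refine Eq.trans ?_ (toSheafify_smul (topData E).toPresheafOfModules a
      (⟨_, ιMulti_mem_topSections hV _⟩ : topSections E V))
    exact congrArg (toSheafify (topData E).toPresheafOfModules V)
      (Subtype.ext (AlternatingMap.map_update_smul (ExteriorAlgebra.ιMulti Γ(X, V) n) m i a x) :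
        (_ : topSections E V) = _)
  map_eq_zero_of_eq' m i j h hij := by
    refine Eq.trans ?_ (map_zero (toSheafify (topData E).toPresheafOfModules V))
    exact congrArg (toSheafify (topData E).toPresheafOfModules V)
      (Subtype.ext (AlternatingMap.map_eq_zero_of_eq (ExteriorAlgebra.ιMulti Γ(X, V) n) m h hij) :
        (_ : topSections E V) = _)

theorem wedgeMap_apply (hV : IsFreeOn E V n) (m : Fin n → Γ(E, V)) :
    wedgeMap hV m = wedge hV m := rfl

theorem res_wedge (hV : IsFreeOn E V n) (h : W ≤ V) (m : Fin n → Γ(E, V)) :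
    res (det E) h (wedge hV m) = wedge (hV.mono h) (fun i => res E h (m i)) := by
  refine (res_toSheafify (topData E).toPresheafOfModules h _).trans ?_
  exact congrArg (toSheafify (topData E).toPresheafOfModules W)
    (Subtype.ext (extRes_ιMulti E h m) : (_ : topSections E W) = _)

/-- The exterior product of a frame generates the determinant. -/
theorem IsFrame.wedge {e : Fin n → Γ(E, V)} (he : IsFrame E V e) :
    IsFrame (det E) V (fun _ : Fin 1 => wedge he.isFreeOn e) := by
  refine isFrame_toSheafify _ _ fun W h => ?_
  have hx : ∀ a : Γ(X, W), (((show X.ringCatSheaf.obj.obj (op W) from a) •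
      presRes (topData E).toPresheafOfModules h
        (⟨_, ιMulti_mem_topSections he.isFreeOn e⟩ : topSections E V) : topSections E W)).1 =
      a • ExteriorAlgebra.ιMulti Γ(X, W) n (he.basis h) := fun a => by
    have : ⇑(he.basis h) = fun i => res E h (e i) := funext fun i => he.basis_apply h i
    rw [this, ← extRes_ιMulti]
    rfl
  refine ⟨fun a b hab => smul_ιMulti_injective (he.basis h) ?_, fun y => ?_⟩
  · exact (hx a).symm.trans ((congrArg Subtype.val hab).trans (hx b))
  -- The defining condition of `topSections` places `y` in the n-th exterior power because the sheaf
  -- is free of rank `n` over `W` itself; there the wedge of the basis generates.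
  · have hy := y.2 W le_rfl n (he.mono h).isFreeOn
    rw [extRes_self] at hy
    obtain ⟨a, ha⟩ := exists_smul_ιMulti_of_mem (he.basis h) hy
    exact ⟨a, Subtype.ext ((hx a).trans ha)⟩

theorem IsLocallyFree.exists_frame (hE : IsLocallyFree E) {U : X.Opens} {x : X} (hx : x ∈ U) :
    ∃ (V : X.Opens) (_ : V ≤ U) (n : ℕ) (e : Fin n → Γ(E, V)), x ∈ V ∧ IsFrame E V e := by
  obtain ⟨V, n, hxV, hV⟩ := hE x
  obtain ⟨e, he⟩ := hV.mono (inf_le_right : U ⊓ V ≤ V)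
  exact ⟨U ⊓ V, inf_le_left, n, e, ⟨hx, hxV⟩, he⟩

theorem IsLocallyFree.isInvertible_det (hE : IsLocallyFree E) : IsInvertible (det E) := fun x => by
  obtain ⟨V, n, hx, e, he⟩ := hE x
  exact ⟨V, hx, he.wedge.isFreeOn⟩

end

/-! ### Tensor products and duals of invertible sheaves -/

section

variable {M N : X.Modules} {U V : X.Opens}

theorem tmul_add (m : Γ(M, U)) (n n' : Γ(N, U)) : tmul m (n + n') = tmul m n + tmul m n' := by
  refine Eq.trans ?_ (map_add (toSheafify
    (PresheafOfModules.Monoidal.tensorObj (R := X.presheaf) M.val N.val) U) _ _)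
  exact congrArg (toSheafify _ U) (TensorProduct.tmul_add (R := Γ(X, U)) m n n')

theorem add_tmul (m m' : Γ(M, U)) (n : Γ(N, U)) : tmul (m + m') n = tmul m n + tmul m' n := by
  refine Eq.trans ?_ (map_add (toSheafify
    (PresheafOfModules.Monoidal.tensorObj (R := X.presheaf) M.val N.val) U) _ _)
  exact congrArg (toSheafify _ U) (TensorProduct.add_tmul (R := Γ(X, U)) m m' n)

theorem smul_tmul (a : Γ(X, U)) (m : Γ(M, U)) (n : Γ(N, U)) : tmul (a • m) n = a • tmul m n := by
  refine Eq.trans ?_ (toSheafify_smul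
    (PresheafOfModules.Monoidal.tensorObj (R := X.presheaf) M.val N.val) a _)
  exact congrArg (toSheafify _ U) (TensorProduct.smul_tmul' (R := Γ(X, U)) a m n).symm

theorem tmul_smul (a : Γ(X, U)) (m : Γ(M, U)) (n : Γ(N, U)) : tmul m (a • n) = a • tmul m n := by
  rw [← smul_tmul]
  exact congrArg (toSheafify _ U) (TensorProduct.smul_tmul (R := Γ(X, U)) a m n).symm

theorem res_tmul (h : V ≤ U) (m : Γ(M, U)) (n : Γ(N, U)) :
    res (tensor M N) h (tmul m n) = tmul (res M h m) (res N h n) :=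
  res_toSheafify (PresheafOfModules.Monoidal.tensorObj (R := X.presheaf) M.val N.val) h _

/-- Already before sheafification, `R ≅ R ⊗ R ≅ M ⊗ N` sends `a` to `a m ⊗ n`, so `m ⊗ n` is a
generator of the presheaf tensor product over every open subset of `V`. -/
theorem IsFrame.tmul {m : Γ(M, V)} {n : Γ(N, V)} (hm : IsFrame M V (fun _ : Fin 1 => m))
    (hn : IsFrame N V (fun _ : Fin 1 => n)) :
    IsFrame (tensor M N) V (fun _ : Fin 1 => tmul m n) := by
  refine isFrame_toSheafify _ _ fun W h => ?_
  have h₁ := isFrame_one_iff.1 hm W h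
  have h₂ := isFrame_one_iff.1 hn W h
  let b₁ := LinearEquiv.ofBijective (LinearMap.toSpanSingleton Γ(X, W) Γ(M, W) (res M h m)) h₁
  let b₂ := LinearEquiv.ofBijective (LinearMap.toSpanSingleton Γ(X, W) Γ(N, W) (res N h n)) h₂
  let b := (TensorProduct.rid Γ(X, W) Γ(X, W)).symm ≪≫ₗ TensorProduct.congr b₁ b₂
  refine Eq.mpr (congrArg Function.Bijective (funext fun a => ?_ : _ = fun a : Γ(X, W) => b a))
    b.bijective
  refine Eq.trans ?_ (TensorProduct.congr_tmul b₁ b₂ a 1).symm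
  change _ = TensorProduct.tmul Γ(X, W) (a • res M h m) ((1 : Γ(X, W)) • res N h n)
  rw [one_smul]
  exact (TensorProduct.smul_tmul' (R := Γ(X, W)) a (res M h m) (res N h n))

theorem IsInvertible.tensor (hM : IsInvertible M) (hN : IsInvertible N) :
    IsInvertible (tensor M N) := fun x => by
  obtain ⟨V, -, m, hx, hm⟩ := hM.exists_generator (U := ⊤) (x := x) trivial
  obtain ⟨W, h, n, hxW, hn⟩ := hN.exists_generator hx
  exact ⟨W, hxW, ((hm.mono h).tmul hn).isFreeOn⟩

/-- The linear form with value one at a generator generates the dual. -/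
theorem IsFrame.dual {e : Γ(M, V)} (he : IsFrame M V (fun _ : Fin 1 => e)) :
    IsFrame (dual M) V (fun _ : Fin 1 =>
      ((⟨he.lin fun _ => (fn V).symm 1, he.isLin_lin _⟩ : (linData M (OO X)).S V) :
        Γ(DGPair.dual M, V))) := by
  refine isFrame_one_iff.2 fun W h => ?_
  -- Evaluation at `e` recovers the coefficient, which gives injectivity. For surjectivity, the
  -- coefficient of a form is its value at `e`.
  have key : ∀ (a : Γ(X, W)), ((show (linData M (OO X)).S W from a • res (DGPair.dual M) h
      (⟨he.lin fun _ => (fn V).symm 1, he.isLin_lin _⟩ : (linData M (OO X)).S V)).1.app le_rfl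
        (res M h e)) = (fn W).symm a := fun a => by
    change resO le_rfl a • (he.lin fun _ => (fn V).symm 1).app h (res M h e) = _
    rw [he.lin_app_self (fun _ => (fn V).symm 1) h 0, resO_self]
    apply (fn W).injective
    rw [fn_smul, fn_res]
    simp
  refine ⟨fun a b hab => ?_, fun φ => ⟨fn W (φ.1.app le_rfl (res M h e)), ?_⟩⟩
  · exact (fn W).symm.injective ((key a).symm.trans ((congrArg (fun φ : (linData M (OO X)).S W =>
      φ.1.app le_rfl (res M h e)) hab).trans (key b)))
  · refine Subtype.ext ((he.mono h).ext_lin ?_ φ.2 fun _ => ?_)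
    · exact Subtype.prop (_ : (linData M (OO X)).S W)
    · exact (key _).trans (AddEquiv.symm_apply_apply _ _)

theorem IsInvertible.dual (hM : IsInvertible M) : IsInvertible (dual M) := fun x => by
  obtain ⟨V, -, m, hx, hm⟩ := hM.exists_generator (U := ⊤) (x := x) trivial
  exact ⟨V, hx, hm.dual.isFreeOn⟩

theorem IsInvertible.signed (hM : IsInvertible M) : ∀ b, IsInvertible (signed M b)
  | true => hM
  | false => hM.dual

theorem IsInvertible.tensorRange {L : ℤ → X.Modules} (hL : ∀ i, IsInvertible (L i)) :
    ∀ (a : ℤ) (k : ℕ), IsInvertible (tensorRange L a k)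
  | a, 0 => hL a
  | a, k + 1 => (hL a).tensor (tensorRange hL (a + 1) k)

theorem isInvertible_detComplex {E : CochainComplex X.Modules ℤ}
    (hE : ∀ i, IsLocallyFree (E.X i)) (a : ℤ) (k : ℕ) : IsInvertible (detComplex E a k) :=
  .tensorRange (fun i => (hE i).isInvertible_det.signed _) a k

end

end DGPair

end

noncomputable section

namespace DGPair

/-! ### Derivations and alternating maps -/

section

variable {R M N : Type*} [CommRing R] [AddCommGroup M] [Module R M] [AddCommGroup N] [Module R N]
  {n : ℕ}

/-- The failure of two operators that differentiate scalars in the same way to satisfy the Leibniz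
rule for an alternating map is alternating. -/
def leibnizDefect (w : M [⋀^Fin n]→ₗ[R] N) (D : M →+ M) (D' : N →+ N) (δ : R → R)
    (hD : ∀ a m, D (a • m) = a • D m + δ a • m) (hD' : ∀ a y, D' (a • y) = a • D' y + δ a • y) :
    M [⋀^Fin n]→ₗ[R] N where
  toFun m := D' (w m) - ∑ i, w (Function.update m i (D (m i)))
  map_update_add' m j x y := by
    rename_i inst
    obtain rfl : inst = instDecidableEqFin n := Subsingleton.elim _ _
    rw [AlternatingMap.map_update_add, map_add, sub_add_sub_comm, ← Finset.sum_add_distrib]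
    congr 1
    refine Finset.sum_congr rfl fun i _ => ?_
    by_cases hij : i = j
    · subst hij
      simp
    · simp only [Function.update_of_ne hij, Function.update_comm (Ne.symm hij)]
      exact AlternatingMap.map_update_add _ _ _ _ _
  map_update_smul' m j a x := by
    rename_i inst
    obtain rfl : inst = instDecidableEqFin n := Subsingleton.elim _ _
    -- Only the summand `i = j` differentiates the scalar `a`. Its extra term `δ a • w` cancels the
    -- one produced by `D'`.
    have key : ∀ i, w (Function.update (Function.update m j (a • x)) i
        (D (Function.update m j (a • x) i))) =
        a • w (Function.update (Function.update m j x) i (D (Function.update m j x i))) +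
          if i = j then δ a • w (Function.update m j x) else 0 := fun i => by
      by_cases hij : i = j
      · subst hij
        simp [hD]
      · simp only [Function.update_of_ne hij, Function.update_comm (Ne.symm hij), if_neg hij,
          add_zero]
        exact AlternatingMap.map_update_smul _ _ _ _ _
    rw [Finset.sum_congr rfl fun i _ => key i, Finset.sum_add_distrib, Finset.sum_ite_eq',
      if_pos (Finset.mem_univ _), AlternatingMap.map_update_smul, hD', ← Finset.smul_sum, smul_sub]
    abel
  map_eq_zero_of_eq' m i j h hij := by
    -- If `m i = m j`, a summand with `l ≠ i, j` still has two equal arguments and vanishes; the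
    -- summands `l = i` and `l = j` differ by a transposition and cancel.
    have key : ∀ l, w (Function.update m l (D (m l))) =
        (if l = i then w (Function.update m i (D (m i))) else 0) +
          if l = j then -w (Function.update m i (D (m i))) else 0 := fun l => by
      by_cases hi : l = i
      · subst hi
        simp [hij]
      · by_cases hj : l = j
        · subst hj
          rw [if_neg hi, if_pos rfl, zero_add, ← AlternatingMap.map_swap _ _ hij, h]
          congr 1
          funext p
          by_cases hp : p = l
          · subst hp; simp
          · by_cases hp' : p = i
            · subst hp'
              simpa [hij, h] using (Function.update_of_ne hi (D (m l)) m).symm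
            · simp [Equiv.swap_apply_of_ne_of_ne hp' hp, hp, hp']
        · rw [if_neg hi, if_neg hj, add_zero]
          refine AlternatingMap.map_eq_zero_of_eq _ _ ?_ hij
          rw [Function.update_of_ne (Ne.symm hi), Function.update_of_ne (Ne.symm hj), h]
    rw [Finset.sum_congr rfl fun l _ => key l, Finset.sum_add_distrib, Finset.sum_ite_eq',
      Finset.sum_ite_eq', if_pos (Finset.mem_univ _), if_pos (Finset.mem_univ _), add_neg_cancel,
      AlternatingMap.map_eq_zero_of_eq w m h hij, map_zero, sub_zero]

/-- Updates in different slots commute, so the off-diagonal terms of the two double sums cancel. The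
diagonal terms give the commutator of `D` and `D'`. This is why Leibniz extension respects brackets.
-/
theorem sum_update_comm (w : M [⋀^Fin n]→ₗ[R] N) (D D' : M →+ M) (m : Fin n → M) :
    (∑ i, ∑ j, w (Function.update (Function.update m i (D' (m i))) j
        (D (Function.update m i (D' (m i)) j)))) -
      ∑ i, ∑ j, w (Function.update (Function.update m i (D (m i))) j
        (D' (Function.update m i (D (m i)) j))) =
      ∑ i, w (Function.update m i (D (D' (m i)) - D' (D (m i)))) := by
  rw [Finset.sum_comm (f := fun i j => w (Function.update (Function.update m i (D (m i))) j
        (D' (Function.update m i (D (m i)) j)))), ← Finset.sum_sub_distrib]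
  refine Finset.sum_congr rfl fun i _ => ?_
  rw [← Finset.sum_sub_distrib, Finset.sum_eq_single i]
  · simp
  · intro j _ hj
    rw [Function.update_of_ne hj, Function.update_of_ne (Ne.symm hj), Function.update_comm hj,
      sub_self]
  · simp

end

variable {X : Scheme.{u}} {A : Type u} [CommRing A] {f : X ⟶ Spec (CommRingCat.of A)}
  {M N : X.Modules} {U V W : X.Opens}

namespace PairDer

theorem ext' {x y : PairDer f M U} (h : x.der = y.der) (h' : x.op = y.op) : x = y :=
  Subtype.ext (Prod.ext h h')

theorem isDer (x : PairDer f M U) : Op.IsDer f x.der := x.2.1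

theorem isPair (x : PairDer f M U) : Op.IsPair x.der x.op := x.2.2

/-- Restriction of derivations of a pair. -/
abbrev restrict (h : V ≤ U) (x : PairDer f M U) : PairDer f M V := (pairData f M).r h x

/-- The bracket of derivations of a pair. -/
abbrev bracket (x y : PairDer f M U) : PairDer f M U := (pairLie f M).br U x y

@[simp] theorem der_restrict (h : V ≤ U) (x : PairDer f M U) :
    (x.restrict h).der = Op.restrict h x.der := rfl

@[simp] theorem op_restrict (h : V ≤ U) (x : PairDer f M U) :
    (x.restrict h).op = Op.restrict h x.op := rfl

@[simp] theorem der_bracket (x y : PairDer f M U) :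
    (x.bracket y).der = Op.comm x.der y.der := rfl

@[simp] theorem op_bracket (x y : PairDer f M U) :
    (x.bracket y).op = Op.comm x.op y.op := rfl

@[simp] theorem der_add (x y : PairDer f M U) : (x + y).der = x.der + y.der := rfl

@[simp] theorem op_add (x y : PairDer f M U) : (x + y).op = x.op + y.op := rfl

@[simp] theorem der_smul (a : Γ(X, U)) (x : PairDer f M U) : (a • x).der = a • x.der := rfl

@[simp] theorem op_smul (a : Γ(X, U)) (x : PairDer f M U) : (a • x).op = a • x.op := rfl

end PairDer

/-! ### Leibniz extensions to the determinant -/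

namespace IsLeibniz

variable {x x' : PairDer f M U} {y y' : PairDer f (det M) U}

theorem restrict (h : IsLeibniz x y) (hV : V ≤ U) : IsLeibniz (x.restrict hV) (y.restrict hV) :=
  ⟨congrArg (Op.restrict hV) h.1, fun W hW => h.2 W (hW.trans hV)⟩

theorem of_local (h : ∀ p, p ∈ U → ∃ (V : X.Opens) (hV : V ≤ U), p ∈ V ∧
    IsLeibniz (x.restrict hV) (y.restrict hV)) : IsLeibniz x y := by
  refine ⟨Op.ext_local fun p hp => ?_, fun V hV n hn m => res_ext_local _ fun p hp => ?_⟩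
  · obtain ⟨V, hV, hpV, e⟩ := h p hp
    exact ⟨V, hV, hpV, e.1⟩
  · obtain ⟨W, hW, hpW, e⟩ := h p (hV hp)
    refine ⟨V ⊓ W, inf_le_left, ⟨hp, hpW⟩, ?_⟩
    have := e.2 (V ⊓ W) inf_le_right n (hn.mono inf_le_left) fun i => res M inf_le_left (m i)
    simp only [PairDer.op_restrict, Op.restrict_app] at this
    rw [Op.res_app, res_wedge, this, map_sum]
    refine Finset.sum_congr rfl fun i _ => ?_
    rw [res_wedge]
    refine wedge_congr _ (funext fun j => ?_)
    by_cases hj : j = i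
    · subst hj
      simp [Op.res_app]
    · simp [Function.update_of_ne hj]

/-- The Leibniz formula fixes the value on the wedge of a frame, which generates the determinant; a
derivation over a fixed `h` is determined by its value on a generator. -/
theorem unique (hM : IsLocallyFree M) (h : IsLeibniz x y) (h' : IsLeibniz x y') : y = y' := by
  refine PairDer.ext' (h.1.trans h'.1.symm) (Op.ext_local fun p hp => ?_)
  obtain ⟨V, hV, n, e, hpV, he⟩ := hM.exists_frame hp
  refine ⟨V, hV, hpV, he.wedge.ext_pair (y.restrict hV).isPair ?_ fun i => ?_⟩
  · have : Op.restrict hV y.der = Op.restrict hV y'.der := by rw [h.1, h'.1]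
    have h2 := (y'.restrict hV).isPair
    rw [PairDer.der_restrict, ← this] at h2
    exact h2
  · exact ((h.restrict hV).2 V le_rfl n he.isFreeOn e).trans
      ((h'.restrict hV).2 V le_rfl n he.isFreeOn e).symm

/-- The value on the generator is prescribed by the Leibniz formula for the frame. The defect of the
formula over a smaller open set is then an alternating map vanishing on a basis, hence zero. -/
theorem of_frame {n : ℕ} {e : Fin n → Γ(M, V)} (he : IsFrame M V e) (x : PairDer f M V) :
    ∃ y, IsLeibniz x y := by
  let y := he.wedge.pair x.der x.isDer
    (fun _ => ∑ i, wedge he.isFreeOn (Function.update e i (x.op.app le_rfl (e i))))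
  have hy : y.der = x.der := rfl
  refine ⟨y, hy, fun W hW n' hn m => ?_⟩
  by_cases h : n' = n
  · subst h
    have hF := alternatingMap_ext_basis (he.basis hW)
      (F := leibnizDefect (wedgeMap hn) (x.op.app hW) (y.op.app hW) (x.der.onFun hW)
        (fun a m => x.isPair.app_smul hW a m) (fun a m => y.isPair.app_smul hW a m))
      (G := 0) ?_
    · exact sub_eq_zero.1 (DFunLike.congr_fun hF m)
    · have : ⇑(he.basis hW) = fun i => res M hW (e i) := funext fun i => he.basis_apply hW i
      rw [this]
      refine sub_eq_zero.2 ?_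
      simp only [wedgeMap_apply]
      rw [← res_wedge he.isFreeOn hW]
      refine (he.wedge.pair_app_self x.isDer _ hW 0).trans ?_
      rw [map_sum]
      refine Finset.sum_congr rfl fun i _ => ?_
      rw [res_wedge]
      refine wedge_congr _ (funext fun j => ?_)
      by_cases hj : j = i
      · subst hj
        simp [Op.res_app]
      · simp [Function.update_of_ne hj]
  -- Two different ranks can occur only over the zero ring, where there is nothing to prove. This
  -- includes the empty open set.
  · have := (he.isFreeOn.mono hW).subsingleton hn (Ne.symm h)
    have := Module.subsingleton Γ(X, W) Γ(det M, W)
    exact Subsingleton.elim _ _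

/-- Local extensions exist on frames and agree on overlaps by uniqueness, so they glue. -/
theorem exists' (hM : IsLocallyFree M) (x : PairDer f M U) : ∃ y, IsLeibniz x y := by
  have key := (pairData f (det M)).exists_of_local (U := U)
    (fun V hV y => IsLeibniz (x.restrict hV) y)
  refine Exists.elim (key ?_ ?_ ?_) fun y hy => ⟨y, of_local hy⟩
  · exact fun V hV V' h' y hy => hy.restrict h'
  · exact fun V hV y y' hy hy' => hy.unique hM hy'
  · intro p hp
    obtain ⟨V, hV, n, e, hpV, he⟩ := hM.exists_frame hp
    exact ⟨V, hV, hpV, of_frame he _⟩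

theorem add (h : IsLeibniz x y) (h' : IsLeibniz x' y') : IsLeibniz (x + x') (y + y') := by
  refine ⟨congrArg₂ (· + ·) h.1 h'.1, fun V hV n hn m => ?_⟩
  rw [PairDer.op_add, PairDer.op_add, Op.add_app, h.2 V hV n hn, h'.2 V hV n hn,
    ← Finset.sum_add_distrib]
  exact Finset.sum_congr rfl fun i _ => ((wedgeMap hn).map_update_add m i _ _).symm

theorem smul (a : Γ(X, U)) (h : IsLeibniz x y) : IsLeibniz (a • x) (a • y) := by
  refine ⟨congrArg (a • ·) h.1, fun V hV n hn m => ?_⟩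
  rw [PairDer.op_smul, PairDer.op_smul, Op.smul_app, h.2 V hV n hn, Finset.smul_sum]
  exact Finset.sum_congr rfl fun i _ => ((wedgeMap hn).map_update_smul m i _ _).symm

theorem bracket (h : IsLeibniz x y) (h' : IsLeibniz x' y') :
    IsLeibniz (x.bracket x') (y.bracket y') := by
  refine ⟨congrArg₂ Op.comm h.1 h'.1, fun V hV n hn m => ?_⟩
  rw [PairDer.op_bracket, PairDer.op_bracket, Op.comm_app, h.2 V hV n hn, h'.2 V hV n hn, map_sum,
    map_sum]
  simp only [h.2 V hV n hn, h'.2 V hV n hn]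
  exact sum_update_comm (wedgeMap hn) (x.op.app hV) (x'.op.app hV) m

end IsLeibniz

/-! ### Tensor products of derivations -/

namespace IsTensorDer

variable {x x' : PairDer f M U} {y y' : PairDer f N U} {z z' : PairDer f (tensor M N) U}

theorem restrict (h : IsTensorDer x y z) (hV : V ≤ U) :
    IsTensorDer (x.restrict hV) (y.restrict hV) (z.restrict hV) :=
  ⟨congrArg (Op.restrict hV) h.1, congrArg (Op.restrict hV) h.2.1,
    fun W hW => h.2.2 W (hW.trans hV)⟩

theorem of_local (h : ∀ p, p ∈ U → ∃ (V : X.Opens) (hV : V ≤ U), p ∈ V ∧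
    IsTensorDer (x.restrict hV) (y.restrict hV) (z.restrict hV)) : IsTensorDer x y z := by
  refine ⟨Op.ext_local fun p hp => ?_, Op.ext_local fun p hp => ?_,
    fun V hV m n => res_ext_local _ fun p hp => ?_⟩
  · obtain ⟨V, hV, hpV, e⟩ := h p hp
    exact ⟨V, hV, hpV, e.1⟩
  · obtain ⟨V, hV, hpV, e⟩ := h p hp
    exact ⟨V, hV, hpV, e.2.1⟩
  · obtain ⟨W, hW, hpW, e⟩ := h p (hV hp)
    refine ⟨V ⊓ W, inf_le_left, ⟨hp, hpW⟩, ?_⟩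
    have := e.2.2 (V ⊓ W) inf_le_right (res M inf_le_left m) (res N inf_le_left n)
    simp only [PairDer.op_restrict, Op.restrict_app] at this
    rw [Op.res_app, res_tmul, this, map_add, res_tmul, res_tmul, Op.res_app, Op.res_app]

/-- The value on `m ⊗ n` for local generators `m` and `n` is fixed by the formula, and `m ⊗ n`
generates the tensor product. -/
theorem unique (hM : IsInvertible M) (hN : IsInvertible N) (h : IsTensorDer x y z)
    (h' : IsTensorDer x y z') : z = z' := by
  refine PairDer.ext' (h.1.trans h'.1.symm) (Op.ext_local fun p hp => ?_)
  obtain ⟨V, hV, m, hpV, hm⟩ := hM.exists_generator hp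
  obtain ⟨W, hW, n, hpW, hn⟩ := hN.exists_generator hpV
  refine ⟨W, hW.trans hV, hpW, ((hm.mono hW).tmul hn).ext_pair (z.restrict (hW.trans hV)).isPair ?_
    fun i => ?_⟩
  · have : Op.restrict (hW.trans hV) z.der = Op.restrict (hW.trans hV) z'.der := by
      rw [h.1, h'.1]
    have h2 := (z'.restrict (hW.trans hV)).isPair
    rw [PairDer.der_restrict, ← this] at h2
    exact h2
  · exact ((h.restrict (hW.trans hV)).2.2 W le_rfl _ _).trans
      ((h'.restrict (hW.trans hV)).2.2 W le_rfl _ _).symm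

theorem of_frame {m : Γ(M, V)} {n : Γ(N, V)} (hm : IsFrame M V (fun _ : Fin 1 => m))
    (hn : IsFrame N V (fun _ : Fin 1 => n)) (x : PairDer f M V) (y : PairDer f N V)
    (hxy : x.der = y.der) : ∃ z, IsTensorDer x y z := by
  let z := (hm.tmul hn).pair x.der x.isDer
    (fun _ => tmul (x.op.app le_rfl m) n + tmul m (y.op.app le_rfl n))
  refine ⟨z, rfl, hxy, fun W hW m' n' => ?_⟩
  -- All sections over `W` are multiples of the generators. The formula for `a m ⊗ b n` then follows
  -- from the one for `m ⊗ n` and the product rule, because `x` and `y` lie over the same derivation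
  -- of functions.
  obtain ⟨a, rfl⟩ := (isFrame_one_iff.1 hm W hW).2 m'
  obtain ⟨b, rfl⟩ := (isFrame_one_iff.1 hn W hW).2 n'
  have h₁ : z.op.app hW (tmul (res M hW m) (res N hW n)) =
      tmul (x.op.app hW (res M hW m)) (res N hW n) +
        tmul (res M hW m) (y.op.app hW (res N hW n)) := by
    rw [← res_tmul]
    refine ((hm.tmul hn).pair_app_self x.isDer _ hW 0).trans ?_
    rw [map_add, res_tmul, res_tmul, Op.res_app, Op.res_app]
  have hz : z.der = x.der := rfl
  simp only [smul_tmul, tmul_smul, z.isPair.app_smul, x.isPair.app_smul, y.isPair.app_smul, h₁,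
    add_tmul, tmul_add, hz, ← hxy]
  module

theorem exists' (hM : IsInvertible M) (hN : IsInvertible N) (x : PairDer f M U)
    (y : PairDer f N U) (hxy : x.der = y.der) : ∃ z, IsTensorDer x y z := by
  have key := (pairData f (tensor M N)).exists_of_local (U := U)
    (fun V hV z => IsTensorDer (x.restrict hV) (y.restrict hV) z)
  refine Exists.elim (key ?_ ?_ ?_) fun z hz => ⟨z, of_local hz⟩
  · exact fun V hV V' h' z hz => hz.restrict h'
  · exact fun V hV z z' hz hz' => hz.unique hM hN hz'
  · intro p hp
    obtain ⟨V, hV, m, hpV, hm⟩ := hM.exists_generator hp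
    obtain ⟨W, hW, n, hpW, hn⟩ := hN.exists_generator hpV
    exact ⟨W, hW.trans hV, hpW, of_frame (hm.mono hW) hn _ _
      (congrArg (Op.restrict (hW.trans hV)) hxy)⟩

theorem add (h : IsTensorDer x y z) (h' : IsTensorDer x' y' z') :
    IsTensorDer (x + x') (y + y') (z + z') := by
  refine ⟨congrArg₂ (· + ·) h.1 h'.1, congrArg₂ (· + ·) h.2.1 h'.2.1, fun V hV m n => ?_⟩
  simp only [PairDer.op_add, Op.add_app, h.2.2 V hV, h'.2.2 V hV, add_tmul, tmul_add]
  abel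

theorem smul (a : Γ(X, U)) (h : IsTensorDer x y z) : IsTensorDer (a • x) (a • y) (a • z) := by
  refine ⟨congrArg (a • ·) h.1, congrArg (a • ·) h.2.1, fun V hV m n => ?_⟩
  simp only [PairDer.op_smul, Op.smul_app, h.2.2 V hV, smul_tmul, tmul_smul, smul_add]

theorem tmul_sub (m : Γ(M, U)) (n n' : Γ(N, U)) : tmul m (n - n') = tmul m n - tmul m n' :=
  eq_sub_of_add_eq (by rw [← tmul_add, sub_add_cancel])

theorem sub_tmul (m m' : Γ(M, U)) (n : Γ(N, U)) : tmul (m - m') n = tmul m n - tmul m' n :=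
  eq_sub_of_add_eq (by rw [← add_tmul, sub_add_cancel])

/-- The operators `u ⊗ 1` and `1 ⊗ v'` commute, so the mixed terms cancel in the commutator. -/
theorem bracket (h : IsTensorDer x y z) (h' : IsTensorDer x' y' z') :
    IsTensorDer (x.bracket x') (y.bracket y') (z.bracket z') := by
  refine ⟨congrArg₂ Op.comm h.1 h'.1, congrArg₂ Op.comm h.2.1 h'.2.1, fun V hV m n => ?_⟩
  simp only [PairDer.op_bracket, Op.comm_app, h.2.2 V hV, h'.2.2 V hV, map_add, sub_tmul,
    tmul_sub]
  abel

end IsTensorDer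

/-! ### Transposes -/

/-- The value of a section of the dual at a section. -/
def dualApp (φ : Γ(dual M, V)) (hW : W ≤ V) : Γ(M, W) →+ Γ(OO X, W) :=
  (show (linData M (OO X)).S V from φ).1.app hW

theorem dual_ext {φ ψ : Γ(dual M, V)} (h : ∀ (W : X.Opens) (hW : W ≤ V) (m : Γ(M, W)),
    dualApp φ hW m = dualApp ψ hW m) : φ = ψ :=
  Subtype.ext (Op.ext h)

theorem dualApp_add (φ ψ : Γ(dual M, V)) (hW : W ≤ V) (m : Γ(M, W)) :
    dualApp (φ + ψ) hW m = dualApp φ hW m + dualApp ψ hW m := rfl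

theorem dualApp_sub (φ ψ : Γ(dual M, V)) (hW : W ≤ V) (m : Γ(M, W)) :
    dualApp (φ - ψ) hW m = dualApp φ hW m - dualApp ψ hW m := rfl

theorem dualApp_smul (a : Γ(X, V)) (φ : Γ(dual M, V)) (hW : W ≤ V) (m : Γ(M, W)) :
    dualApp (a • φ) hW m = resO hW a • dualApp φ hW m := rfl

theorem dualApp_map_smul (a : Γ(X, W)) (φ : Γ(dual M, V)) (hW : W ≤ V) (m : Γ(M, W)) :
    dualApp φ hW (a • m) = a • dualApp φ hW m :=
  (show (linData M (OO X)).S V from φ).2 W hW a m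

theorem dualApp_transpose (x : PairDer f M U) (hV : V ≤ U) (φ : Γ(dual M, V)) (hW : W ≤ V)
    (m : Γ(M, W)) : dualApp ((transpose x).op.app hV φ) hW m =
      x.der.app (hW.trans hV) (dualApp φ hW m) - dualApp φ hW (x.op.app (hW.trans hV) m) := rfl

theorem der_transpose (x : PairDer f M U) : (transpose x).der = x.der := rfl

theorem transpose_add (x y : PairDer f M U) : transpose (x + y) = transpose x + transpose y :=
  PairDer.ext' (by simp only [der_transpose, PairDer.der_add]) (Op.ext fun V hV φ =>
      dual_ext fun W hW m => by
    rw [PairDer.op_add, Op.add_app, dualApp_add, dualApp_transpose, dualApp_transpose,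
      dualApp_transpose, PairDer.der_add, PairDer.op_add, Op.add_app, Op.add_app, map_add]
    abel)

theorem transpose_smul (a : Γ(X, U)) (x : PairDer f M U) : transpose (a • x) = a • transpose x :=
  PairDer.ext' (by simp only [der_transpose, PairDer.der_smul]) (Op.ext fun V hV φ =>
      dual_ext fun W hW m => by
    rw [PairDer.op_smul, Op.smul_app, dualApp_smul, dualApp_transpose, dualApp_transpose,
      PairDer.der_smul, PairDer.op_smul, Op.smul_app, Op.smul_app, resO_resO, dualApp_map_smul,
      smul_sub])

/-- The transpose is left composition with `h` minus right composition with `u`. Left and right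
compositions commute, and two right compositions are reversed in order; with the minus sign the
bracket is preserved rather than reversed. -/
theorem transpose_bracket (x y : PairDer f M U) :
    transpose (x.bracket y) = (transpose x).bracket (transpose y) :=
  PairDer.ext' (by simp only [der_transpose, PairDer.der_bracket]) (Op.ext fun V hV φ =>
      dual_ext fun W hW m => by
    rw [PairDer.op_bracket, Op.comm_app, dualApp_sub]
    simp only [dualApp_transpose, PairDer.der_bracket, PairDer.op_bracket, Op.comm_app, map_sub]
    abel)

end DGPair

end

noncomputable section

namespace DGPair

variable {X : Scheme.{u}} {A : Type u} [CommRing A] {f : X ⟶ Spec (CommRingCat.of A)}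
  {M N : X.Modules} {U V W : X.Opens}

/-! ### Tensor products of several derivations -/

theorem der_signedDer (x : PairDer f M U) : ∀ b, (signedDer x b).der = x.der
  | true => rfl
  | false => der_transpose x

theorem signedDer_add (x y : PairDer f M U) :
    ∀ b, signedDer (x + y) b = signedDer x b + signedDer y b
  | true => rfl
  | false => transpose_add x y

theorem signedDer_smul (a : Γ(X, U)) (x : PairDer f M U) :
    ∀ b, signedDer (a • x) b = a • signedDer x b
  | true => rfl
  | false => transpose_smul a x

theorem signedDer_bracket (x y : PairDer f M U) :
    ∀ b, signedDer (x.bracket y) b = (signedDer x b).bracket (signedDer y b)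
  | true => rfl
  | false => transpose_bracket x y

theorem transpose_restrict (x : PairDer f M U) (h : V ≤ U) :
    transpose (x.restrict h) = (transpose x).restrict h :=
  PairDer.ext' (by simp only [der_transpose, PairDer.der_restrict]) rfl

theorem signedDer_restrict (x : PairDer f M U) (h : V ≤ U) :
    ∀ b, signedDer (x.restrict h) b = (signedDer x b).restrict h
  | true => rfl
  | false => transpose_restrict x h

namespace IsTensorRangeDer

variable {L : ℤ → X.Modules} {y y' : ∀ i, PairDer f (L i) U}

theorem der_eq {a : ℤ} : ∀ {k : ℕ} {z : PairDer f (tensorRange L a k) U},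
    IsTensorRangeDer y a k z → z.der = (y a).der
  | 0, _, h => congrArg PairDer.der h
  | _ + 1, _, ⟨_, _, h⟩ => h.1

/-- The factors must lie over a common derivation of functions, since a tensor product of
derivations exists only then. -/
theorem exists' (hL : ∀ i, IsInvertible (L i)) (hy : ∀ i j, (y i).der = (y j).der) :
    ∀ (a : ℤ) (k : ℕ), ∃ z, IsTensorRangeDer y a k z
  | a, 0 => ⟨y a, rfl⟩
  | a, k + 1 => by
    obtain ⟨w, hw⟩ := exists' hL hy (a + 1) k
    obtain ⟨z, hz⟩ := IsTensorDer.exists' (hL a) (.tensorRange hL (a + 1) k) (y a) w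
      ((hy _ _).trans hw.der_eq.symm)
    exact ⟨z, w, hw, hz⟩

theorem unique (hL : ∀ i, IsInvertible (L i)) : ∀ {a : ℤ} {k : ℕ}
    {z z' : PairDer f (tensorRange L a k) U}, IsTensorRangeDer y a k z →
    IsTensorRangeDer y a k z' → z = z'
  | _, 0, _, _, h, h' => h.trans (Eq.symm h')
  | a, k + 1, _, _, ⟨w, hw, h⟩, ⟨w', hw', h'⟩ => by
    obtain rfl := unique hL hw hw'
    exact h.unique (hL a) (.tensorRange hL (a + 1) k) h'

theorem add : ∀ {a : ℤ} {k : ℕ} {z z' : PairDer f (tensorRange L a k) U},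
    IsTensorRangeDer y a k z → IsTensorRangeDer y' a k z' →
    IsTensorRangeDer (fun i => y i + y' i) a k (z + z')
  | _, 0, _, _, h, h' => congrArg₂ (· + ·) h h'
  | _, _ + 1, _, _, ⟨w, hw, h⟩, ⟨w', hw', h'⟩ => ⟨w + w', add hw hw', h.add h'⟩

theorem smul (c : Γ(X, U)) : ∀ {a : ℤ} {k : ℕ} {z : PairDer f (tensorRange L a k) U},
    IsTensorRangeDer y a k z → IsTensorRangeDer (fun i => c • y i) a k (c • z)
  | _, 0, _, h => congrArg (c • ·) h
  | _, _ + 1, _, ⟨w, hw, h⟩ => ⟨c • w, smul c hw, h.smul c⟩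

theorem bracket : ∀ {a : ℤ} {k : ℕ} {z z' : PairDer f (tensorRange L a k) U},
    IsTensorRangeDer y a k z → IsTensorRangeDer y' a k z' →
    IsTensorRangeDer (fun i => (y i).bracket (y' i)) a k (z.bracket z')
  | _, 0, _, _, h, h' => congrArg₂ PairDer.bracket h h'
  | _, _ + 1, _, _, ⟨w, hw, h⟩, ⟨w', hw', h'⟩ => ⟨w.bracket w', bracket hw hw', h.bracket h'⟩

theorem restrict (hV : V ≤ U) : ∀ {a : ℤ} {k : ℕ} {z : PairDer f (tensorRange L a k) U},
    IsTensorRangeDer y a k z → IsTensorRangeDer (fun i => (y i).restrict hV) a k (z.restrict hV)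
  | _, 0, _, h => congrArg (PairDer.restrict hV) h
  | _, _ + 1, _, ⟨w, hw, h⟩ => ⟨w.restrict hV, restrict hV hw, h.restrict hV⟩

end IsTensorRangeDer

/-! ### The trace of a derivation -/

section

variable {E : CochainComplex X.Modules ℤ}

theorem Coch.br_at_zero (h : (0 : ℤ) + 0 = 0) (u v : Coch E 0 U) (i : ℤ) :
    (Coch.br h u v).at' i i (add_zero i) =
      Op.comm (u.at' i i (add_zero i)) (v.at' i i (add_zero i)) := by
  change (Coch.mul h u v).at' i i _ - ((0 : ℤ) * 0).negOnePow •
    (Coch.mul ((add_comm 0 0).trans h) v u).at' i i _ = _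
  rw [show ((0 : ℤ) * 0).negOnePow = 1 by simp, one_smul,
    Coch.mul_at h u v i i i _ (add_zero i) (add_zero i),
    Coch.mul_at _ v u i i i _ (add_zero i) (add_zero i)]
  rfl

theorem DerCoch.component_bracket (h : (0 : ℤ) + 0 = 0) (x x' : DerCoch f E 0 U) (i : ℤ) :
    DerCoch.component (derBr f E h x x') i =
      (DerCoch.component x i).bracket (DerCoch.component x' i) :=
  PairDer.ext' rfl (Coch.br_at_zero h x.1.2 x'.1.2 i)

namespace IsTraceDer

variable {a : ℤ} {k : ℕ} {x x' : DerCoch f E 0 U} {z z' : PairDer f (detComplex E a k) U}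

theorem invertible (hE : ∀ i, IsLocallyFree (E.X i)) (i : ℤ) : IsInvertible (detFactor E i) :=
  (hE i).isInvertible_det.signed _

theorem der_eq (h : IsTraceDer a k x z) : z.der = x.1.1 := by
  obtain ⟨y, hy, hz⟩ := h
  exact hz.der_eq.trans ((der_signedDer _ _).trans (hy a).1)

theorem exists' (hE : ∀ i, IsLocallyFree (E.X i)) (a : ℤ) (k : ℕ) (x : DerCoch f E 0 U) :
    ∃ z, IsTraceDer a k x z := by
  choose y hy using fun i => IsLeibniz.exists' (hE i) (x.component i)
  obtain ⟨z, hz⟩ := IsTensorRangeDer.exists' (L := detFactor E)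
    (y := fun i => signedDer (y i) (decide (Even i))) (invertible hE)
    (fun i j => ((der_signedDer _ _).trans (hy i).1).trans
      ((der_signedDer _ _).trans (hy j).1).symm) a k
  exact ⟨z, y, hy, hz⟩

/-- The intermediate Leibniz extensions are themselves unique, so the two witnesses coincide and
uniqueness of tensor products applies. -/
theorem unique (hE : ∀ i, IsLocallyFree (E.X i)) (h : IsTraceDer a k x z)
    (h' : IsTraceDer a k x z') : z = z' := by
  obtain ⟨y, hy, hz⟩ := h
  obtain ⟨y', hy', hz'⟩ := h'
  obtain rfl : y = y' := funext fun i => (hy i).unique (hE i) (hy' i)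
  exact hz.unique (invertible hE) hz'

theorem add (h : IsTraceDer a k x z) (h' : IsTraceDer a k x' z') :
    IsTraceDer a k (x + x') (z + z') := by
  obtain ⟨y, hy, hz⟩ := h
  obtain ⟨y', hy', hz'⟩ := h'
  refine ⟨fun i => y i + y' i, fun i => (hy i).add (hy' i), ?_⟩
  simp only [signedDer_add]
  exact hz.add hz'

theorem smul (c : Γ(X, U)) (h : IsTraceDer a k x z) : IsTraceDer a k (c • x) (c • z) := by
  obtain ⟨y, hy, hz⟩ := h
  refine ⟨fun i => c • y i, fun i => (hy i).smul c, ?_⟩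
  simp only [signedDer_smul]
  exact hz.smul c

theorem bracket (h₀ : (0 : ℤ) + 0 = 0) (h : IsTraceDer a k x z) (h' : IsTraceDer a k x' z') :
    IsTraceDer a k (derBr f E h₀ x x') (z.bracket z') := by
  obtain ⟨y, hy, hz⟩ := h
  obtain ⟨y', hy', hz'⟩ := h'
  refine ⟨fun i => (y i).bracket (y' i), fun i => ?_, ?_⟩
  · rw [DerCoch.component_bracket]
    exact (hy i).bracket (hy' i)
  · simp only [signedDer_bracket]
    exact hz.bracket hz'

theorem restrict (hV : V ≤ U) (h : IsTraceDer a k x z) :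
    IsTraceDer a k ((derData f E 0).r hV x) (z.restrict hV) := by
  obtain ⟨y, hy, hz⟩ := h
  refine ⟨fun i => (y i).restrict hV, fun i => (hy i).restrict hV, ?_⟩
  simp only [signedDer_restrict]
  exact hz.restrict hV

end IsTraceDer

end

/-! ### Scalar derivations -/

variable (f M) in
/-- The derivation `(0, c ·)`. -/
def scalarDer (c : Γ(X, U)) : PairDer f M U :=
  ⟨(0, c • Op.ofHom (𝟙 M) U), Op.isDer_zero f, Op.isPair_zero.2 (isLin_scalar M c)⟩

@[simp] theorem der_scalarDer (c : Γ(X, U)) : (scalarDer f M c).der = 0 := rfl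

@[simp] theorem scalarDer_app (c : Γ(X, U)) (hV : V ≤ U) (m : Γ(M, V)) :
    (scalarDer f M c).op.app hV m = resO hV c • m := rfl

theorem scalarDer_restrict (c : Γ(X, U)) (hV : V ≤ U) :
    (scalarDer f M c).restrict hV = scalarDer f M (resO hV c) :=
  PairDer.ext' (map_zero (Op.restrict hV)) (Op.ext fun W hW m => by
    rw [PairDer.op_restrict, Op.restrict_app, scalarDer_app, scalarDer_app, resO_resO])

theorem scalarDer_add (c d : Γ(X, U)) :
    scalarDer f M (c + d) = scalarDer f M c + scalarDer f M d :=
  PairDer.ext' (add_zero _).symm (Op.ext fun W hW m => by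
    rw [PairDer.op_add, Op.add_app, scalarDer_app, scalarDer_app, scalarDer_app, map_add, add_smul])

theorem scalarDer_smul (c d : Γ(X, U)) : scalarDer f M (c * d) = c • scalarDer f M d :=
  PairDer.ext' (by rw [PairDer.der_smul, der_scalarDer, der_scalarDer, smul_zero])
    (Op.ext fun W hW m => by
    rw [PairDer.op_smul, Op.smul_app, scalarDer_app, scalarDer_app, map_mul, mul_smul])

theorem scalarDer_zero : scalarDer f M (0 : Γ(X, U)) = 0 :=
  PairDer.ext' rfl (zero_smul _ _)

/-- With `h = 0` only `φ ↦ -φ (c ·)` remains. This is the origin of the sign (-1)^i in the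
supertrace. -/
theorem transpose_scalarDer (c : Γ(X, U)) :
    transpose (scalarDer f M c) = scalarDer f (dual M) (-c) :=
  PairDer.ext' (by rw [der_transpose, der_scalarDer, der_scalarDer])
    (Op.ext fun V hV φ => dual_ext fun W hW m => by
      rw [dualApp_transpose, der_scalarDer, scalarDer_app, scalarDer_app, dualApp_smul,
        dualApp_map_smul, map_neg, map_neg, neg_smul, resO_resO, Op.zero_app, zero_sub])

theorem signedDer_scalarDer (c : Γ(X, U)) (i : ℤ) :
    signedDer (scalarDer f M c) (decide (Even i)) =
      scalarDer f (signed M (decide (Even i))) (i.negOnePow • c) := by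
  by_cases h : Even i
  · rw [Int.negOnePow_even i h, one_smul]
    -- The Boolean is made a variable because the sheaf depends on `decide (Even i)`, which does not
    -- reduce by itself.
    have : ∀ b : Bool, b = true → signedDer (scalarDer f M c) b = scalarDer f (signed M b) c := by
      rintro _ rfl; rfl
    exact this _ (decide_eq_true h)
  · rw [Int.negOnePow_odd i (Int.not_even_iff_odd.1 h), Units.neg_smul, one_smul]
    have : ∀ b : Bool, b = false →
        signedDer (scalarDer f M c) b = scalarDer f (signed M b) (-c) := by
      rintro _ rfl
      exact transpose_scalarDer c
    exact this _ (decide_eq_false h)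

/-- Both scalars can be pulled out of the tensor product, so they add up. -/
theorem isTensorDer_scalarDer (c d : Γ(X, U)) :
    IsTensorDer (scalarDer f M c) (scalarDer f N d) (scalarDer f (tensor M N) (c + d)) :=
  ⟨rfl, rfl, fun V hV m n => by
    rw [scalarDer_app, scalarDer_app, scalarDer_app, smul_tmul, tmul_smul, map_add, add_smul]⟩

theorem Icc_succ_eq_insert (a : ℤ) (k : ℕ) :
    Finset.Icc a (a + (k + 1 : ℕ)) = insert a (Finset.Icc (a + 1) (a + 1 + k)) := by
  ext i
  simp only [Finset.mem_insert, Finset.mem_Icc]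
  omega

theorem isTensorRangeDer_scalarDer {L : ℤ → X.Modules} (c : ℤ → Γ(X, U)) : ∀ (a : ℤ) (k : ℕ),
    IsTensorRangeDer (fun i => scalarDer f (L i) (c i)) a k
      (scalarDer f (tensorRange L a k) (∑ i ∈ Finset.Icc a (a + k), c i))
  | a, 0 => by
    simp only [Nat.cast_zero, add_zero, Finset.Icc_self, Finset.sum_singleton]
    rfl
  | a, k + 1 => by
    rw [Icc_succ_eq_insert, Finset.sum_insert (by simp)]
    exact ⟨_, isTensorRangeDer_scalarDer c (a + 1) k, isTensorDer_scalarDer _ _⟩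

/-- A scalar derivation of an invertible sheaf determines the scalar. -/
theorem scalarDer_injective (hM : IsInvertible M) :
    Function.Injective (scalarDer f M (U := U)) := fun c d h => by
  refine resO_ext_local fun p hp => ?_
  obtain ⟨V, hV, e, hpV, he⟩ := hM.exists_generator hp
  refine ⟨V, hV, hpV, (isFrame_one_iff.1 he V le_rfl).1 ?_⟩
  exact congrArg (fun x : PairDer f M U => x.op.app hV (res M le_rfl e)) h

/-- The linear derivations of an invertible sheaf are scalar. -/
theorem exists_eq_scalarDer (hM : IsInvertible M) {z : PairDer f M U} (hz : z.der = 0) :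
    ∃ c, z = scalarDer f M c := by
  have key := exists_fun_of_local (U := U) (fun V hV c => z.restrict hV = scalarDer f M c)
  refine Exists.elim (key ?_ ?_ ?_) fun c hc => ⟨c, (pairData f M).ext_local fun p hp => ?_⟩
  · intro V hV V' h' c hc
    have := congrArg (PairDer.restrict h') hc
    rwa [scalarDer_restrict] at this
  · exact fun V hV c d hc hd => scalarDer_injective hM (hc.symm.trans hd)
  · intro p hp
    obtain ⟨V, hV, e, hpV, he⟩ := hM.exists_generator hp
    -- The scalar is the coefficient of the image of the generator.
    obtain ⟨c, hc⟩ := (isFrame_one_iff.1 he V le_rfl).2 (z.op.app hV e)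
    have hz' : (z.restrict hV).der = 0 := by rw [PairDer.der_restrict, hz, map_zero]
    refine ⟨V, hV, hpV, c, PairDer.ext' hz' (he.ext_pair (z.restrict hV).isPair ?_ fun i => ?_)⟩
    · rw [hz']
      exact (scalarDer f M c).isPair
    · refine Eq.trans ?_ (hc.symm.trans ?_)
      · rfl
      · rw [scalarDer_app, resO_self, res_self]
  · obtain ⟨V, hV, hpV, e⟩ := hc p hp
    refine ⟨V, hV, hpV, e.trans ?_⟩
    rw [← scalarDer_restrict]

end DGPair

end

noncomputable section

namespace DGPair

/-! ### Traces -/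

/-- The difference of the two sides is the Leibniz defect with `δ = 0` and `D'` multiplication by
the trace, hence alternating, so it suffices to compare both sides on a basis. -/
theorem sum_update_eq_trace_smul {R M N : Type*} [CommRing R] [AddCommGroup M] [Module R M]
    [AddCommGroup N] [Module R N] {n : ℕ} (b : Module.Basis (Fin n) R M)
    (w : M [⋀^Fin n]→ₗ[R] N) (D : M →ₗ[R] M) (m : Fin n → M) :
    ∑ i, w (Function.update m i (D (m i))) = LinearMap.trace R M D • w m := by
  have hF := alternatingMap_ext_basis b
    (F := leibnizDefect w D.toAddMonoidHom
      (DistribSMul.toAddMonoidHom N (LinearMap.trace R M D)) (fun _ => 0)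
      (fun a m => by
        change D (a • m) = a • D m + (0 : R) • m
        rw [zero_smul, add_zero, map_smul]) (fun a y => by
        change LinearMap.trace R M D • a • y = a • LinearMap.trace R M D • y + (0 : R) • y
        rw [zero_smul, add_zero, smul_comm])) (G := 0) ?_
  · exact (sub_eq_zero.1 (DFunLike.congr_fun hF m)).symm
  · refine sub_eq_zero.2 ?_
    change LinearMap.trace R M D • w b = ∑ i, w (Function.update b i (D (b i)))
    rw [LinearMap.trace_eq_matrix_trace R b, Matrix.trace, Finset.sum_smul]
    refine Finset.sum_congr rfl fun i _ => ?_
    rw [Matrix.diag_apply, LinearMap.toMatrix_apply]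
    conv_rhs => rw [← b.sum_repr (D (b i))]
    -- Expanding `D (b i)` in slot `i`, every off-diagonal entry repeats a basis vector; only the
    -- diagonal entries survive.
    rw [AlternatingMap.map_update_sum, Finset.sum_eq_single i]
    · rw [AlternatingMap.map_update_smul, Function.update_eq_self]
    · intro j _ hj
      rw [AlternatingMap.map_update_smul, AlternatingMap.map_eq_zero_of_eq w _ _ hj, smul_zero]
      rw [Function.update_of_ne hj, Function.update_self]
    · simp

variable {X : Scheme.{u}} {M N K : X.Modules} {U V W : X.Opens}

namespace Op

/-- The linear map on sections given by a linear operator. -/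
def toLin {u : Op M N U} (hu : IsLin u) (h : V ≤ U) : Γ(M, V) →ₗ[Γ(X, V)] Γ(N, V) where
  toFun := u.app h
  map_add' := map_add _
  map_smul' := hu V h

theorem toLin_apply {u : Op M N U} (hu : IsLin u) (h : V ≤ U) (x : Γ(M, V)) :
    toLin hu h x = u.app h x := rfl

end Op

/-- The matrix over `W` with respect to a frame on `V` is the restriction of the matrix over `V`,
and so is its trace. -/
theorem IsFrame.trace_toLin {n : ℕ} {e : Fin n → Γ(M, V)} (he : IsFrame M V e) {u : Op M M U}
    (hu : Op.IsLin u) (hV : V ≤ U) (hW : W ≤ V) :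
    LinearMap.trace Γ(X, W) Γ(M, W) (Op.toLin hu (hW.trans hV)) =
      resO hW (∑ i, (he.basis le_rfl).repr (u.app hV (e i)) i) := by
  rw [LinearMap.trace_eq_matrix_trace _ (he.basis hW), Matrix.trace, map_sum]
  refine Finset.sum_congr rfl fun i _ => ?_
  rw [Matrix.diag_apply, LinearMap.toMatrix_apply, he.basis_apply, Op.toLin_apply, ← Op.res_app,
    he.repr_res le_rfl hW]

theorem resO_trace {n : ℕ} (hM : IsFreeOn M V n) {u : Op M M U} (hu : Op.IsLin u) (hV : V ≤ U)
    (hW : W ≤ V) : resO hW (LinearMap.trace Γ(X, V) Γ(M, V) (Op.toLin hu hV)) =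
      LinearMap.trace Γ(X, W) Γ(M, W) (Op.toLin hu (hW.trans hV)) := by
  obtain ⟨e, he⟩ := hM
  rw [he.trace_toLin hu hV hW, ← he.trace_toLin hu hV le_rfl |>.trans (resO_self _)]

theorem IsFreeOn.free {n : ℕ} (hM : IsFreeOn M V n) :
    Module.Free Γ(X, V) Γ(M, V) ∧ Module.Finite Γ(X, V) Γ(M, V) := by
  obtain ⟨e, he⟩ := hM
  exact ⟨.of_basis (he.basis le_rfl), .of_basis (he.basis le_rfl)⟩

theorem subsingleton_of_isZero (h : Limits.IsZero M) (V : X.Opens) : Subsingleton Γ(M, V) := by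
  refine ⟨fun x y => ?_⟩
  have : ∀ x : Γ(M, V), x = 0 := fun x =>
    congrArg (fun g : M ⟶ M => g.app V x) (h.eq_of_src (𝟙 M) 0)
  rw [this x, this y]

/-- Vanishing terms are free of rank 0 over every open set, so freeness can be required in all
degrees simultaneously. -/
theorem isFreeOn_of_isZero (h : Limits.IsZero M) (V : X.Opens) : IsFreeOn M V 0 := by
  refine ⟨Fin.elim0, fun W hW => ?_⟩
  have := subsingleton_of_isZero h W
  exact ⟨linearIndependent_empty_type, Subsingleton.elim _ _⟩

section

variable {A : Type u} [CommRing A] {f : X ⟶ Spec (CommRingCat.of A)}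

/-- The Leibniz extension of a linear operator is multiplication by its trace. The trace is taken
over `U` and restricts correctly to smaller open sets because the sheaf is free on `U`. -/
theorem isLeibniz_scalarDer {n : ℕ} (hM : IsFreeOn M U n) {x : PairDer f M U} (hx : x.der = 0)
    (hu : Op.IsLin x.op) :
    IsLeibniz x (scalarDer f (det M)
      (LinearMap.trace Γ(X, U) Γ(M, U) (Op.toLin hu le_rfl))) := by
  refine ⟨hx.symm, fun W hW n' hn m => ?_⟩
  obtain ⟨e, he⟩ := id hn
  rw [scalarDer_app, resO_trace hM]
  exact (sum_update_eq_trace_smul (he.basis le_rfl) (wedgeMap hn) (Op.toLin hu hW) m).symm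

/-- The terms of the complex are free over the open set. -/
def AllFree (E : CochainComplex X.Modules ℤ) (V : X.Opens) : Prop :=
  ∀ i, ∃ n, IsFreeOn (E.X i) V n

variable {E : CochainComplex X.Modules ℤ} {a : ℤ} {k : ℕ}

theorem AllFree.mono (h : AllFree E V) (hW : W ≤ V) : AllFree E W := fun i => by
  obtain ⟨n, hn⟩ := h i
  exact ⟨n, hn.mono hW⟩

/-- The terms of a bounded complex of locally free sheaves are free near every point. -/
theorem exists_allFree (hb : ∀ i, i < a ∨ a + k < i → Limits.IsZero (E.X i))
    (hE : ∀ i, IsLocallyFree (E.X i)) {p : X} (hp : p ∈ U) :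
    ∃ V : X.Opens, V ≤ U ∧ p ∈ V ∧ AllFree E V := by
  -- Shrinking is done one degree at a time, so boundedness of the complex is essential; outside the
  -- range the terms are zero.
  have key : ∀ s : Finset ℤ, ∃ V : X.Opens, V ≤ U ∧ p ∈ V ∧
      ∀ i ∈ s, ∃ n, IsFreeOn (E.X i) V n := fun s => by
    induction s using Finset.induction_on with
    | empty => exact ⟨U, le_rfl, hp, by simp⟩
    | insert i s _ ih =>
      obtain ⟨V, hV, hpV, h⟩ := ih
      obtain ⟨W, hW, n, e, hpW, he⟩ := (hE i).exists_frame hpV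
      refine ⟨W, hW.trans hV, hpW, fun j hj => ?_⟩
      rcases Finset.mem_insert.1 hj with rfl | hj
      · exact ⟨n, e, he⟩
      · obtain ⟨n', hn'⟩ := h j hj
        exact ⟨n', hn'.mono hW⟩
  obtain ⟨V, hV, hpV, h⟩ := key (Finset.Icc a (a + k))
  refine ⟨V, hV, hpV, fun i => ?_⟩
  by_cases hi : i ∈ Finset.Icc a (a + k)
  · exact h i hi
  · refine ⟨0, isFreeOn_of_isZero (hb i ?_) V⟩
    rw [Finset.mem_Icc] at hi
    omega

/-- The supertrace of a linear cochain of degree zero. -/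
def supertrace (a : ℤ) (k : ℕ) {u : Coch E 0 U} (hu : u.IsLin) (hV : V ≤ U) : Γ(X, V) :=
  ∑ i ∈ Finset.Icc a (a + k), i.negOnePow •
    LinearMap.trace Γ(X, V) Γ(E.X i, V) (Op.toLin (hu i i (add_zero i)) hV)

/-- Linear cochains as derivations. -/
def linDer (f : X ⟶ Spec (CommRingCat.of A)) {i : ℤ} {u : Coch E i U} (hu : u.IsLin) :
    DerCoch f E i U :=
  ⟨(0, u), IsDerCoch.of_isLin hu⟩

/-- Leibniz extensions produce the traces, transposition in odd degrees the signs, and the tensor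
product their sum. -/
theorem isTraceDer_linDer (hU : AllFree E U) {u : Coch E 0 U} (hu : u.IsLin) :
    IsTraceDer a k (linDer f hu) (scalarDer f (detComplex E a k) (supertrace a k hu le_rfl)) := by
  refine ⟨fun i => scalarDer f _
    (LinearMap.trace Γ(X, U) Γ(E.X i, U) (Op.toLin (hu i i (add_zero i)) le_rfl)), fun i => ?_, ?_⟩
  · obtain ⟨n, hn⟩ := hU i
    exact isLeibniz_scalarDer hn (x := (linDer f hu).component i) rfl (hu i i (add_zero i))
  · simp only [signedDer_scalarDer]
    exact isTensorRangeDer_scalarDer (L := detFactor E) _ a k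

/-- By uniqueness, any trace of a linear cochain is the explicit scalar wherever all terms are free.
Every local computation of a trace goes through this statement. -/
theorem IsTraceDer.restrict_linDer (hE : ∀ i, IsLocallyFree (E.X i)) {u : Coch E 0 U}
    {hu : u.IsLin} {z : PairDer f (detComplex E a k) U} (hz : IsTraceDer a k (linDer f hu) z)
    (hV : V ≤ U) (hfree : AllFree E V) :
    z.restrict hV = scalarDer f (detComplex E a k) (supertrace a k hu hV) :=
  (hz.restrict hV).unique hE (isTraceDer_linDer (f := f) hfree
    (u := fun x => Op.restrict hV (u x)) fun p q h => (hu p q h).restrict hV)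

/-- The supertrace of a supercommutator vanishes. -/
theorem supertrace_br (hb : ∀ i, i < a ∨ a + k < i → Limits.IsZero (E.X i)) {i j : ℤ}
    (h : i + j = 0) {u : Coch E i U} {v : Coch E j U} (hu : u.IsLin) (hv : v.IsLin) (hV : V ≤ U)
    (hfree : AllFree E V) : supertrace a k (hu.br hv (h := h)) hV = 0 := by
  have hfr : ∀ p, Module.Free Γ(X, V) Γ(E.X p, V) := fun p => (hfree p).choose_spec.free.1
  have hfin : ∀ p, Module.Finite Γ(X, V) Γ(E.X p, V) := fun p => (hfree p).choose_spec.free.2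
  -- `F p` is the signed trace of `u v` on `E^p`. By cyclicity `F (p + i)` is the corresponding term
  -- for `v u`, also computed on `E^p`, so the supertrace is the sum of `F p - F (p + i)`.
  let F : ℤ → Γ(X, V) := fun p => p.negOnePow •
    LinearMap.trace Γ(X, V) Γ(E.X p, V)
      (Op.toLin (hu (p + j) p (by omega)) hV ∘ₗ Op.toLin (hv p (p + j) rfl) hV)
  have hF : ∀ p, F (p + i) = p.negOnePow • (i * j).negOnePow •
      LinearMap.trace Γ(X, V) Γ(E.X p, V)
        (Op.toLin (hv (p + i) p (by omega)) hV ∘ₗ Op.toLin (hu p (p + i) rfl) hV) := fun p => by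
    -- Here `j = -i`, and `i * i` has the parity of `i`.
    have e : (i * j).negOnePow = i.negOnePow := by
      obtain rfl : j = -i := by omega
      rcases Int.even_or_odd i with hi | hi
      · rw [Int.negOnePow_even _ hi, Int.negOnePow_even _ (hi.mul_right _)]
      · rw [Int.negOnePow_odd _ hi, Int.negOnePow_odd _ (hi.mul hi.neg)]
    -- The degree `p + i + j` equals `p` only propositionally; a variable `q` allows substitution
    -- before cyclicity is applied.
    have key : ∀ (q : ℤ) (hq : q = p) (h₁ : q + i = p + i) (h₂ : p + i + j = q),
        LinearMap.trace Γ(X, V) Γ(E.X (p + i), V)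
          (Op.toLin (hu q (p + i) h₁) hV ∘ₗ Op.toLin (hv (p + i) q h₂) hV) =
        LinearMap.trace Γ(X, V) Γ(E.X p, V)
          (Op.toLin (hv (p + i) p (by omega)) hV ∘ₗ Op.toLin (hu p (p + i) rfl) hV) := by
      rintro q rfl h₁ h₂
      exact LinearMap.trace_comp_comm' _ _
    simp only [F]
    rw [key (p + i + j) (by omega), e, Int.negOnePow_add, mul_smul]
  -- Both terms are traces on `E^p`, which is zero outside the range.
  have hz : ∀ p, p ∉ Finset.Icc a (a + k) → F p = 0 ∧ F (p + i) = 0 := fun p hp => by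
    have : Subsingleton Γ(E.X p, V) := subsingleton_of_isZero (hb p (by
      rw [Finset.mem_Icc] at hp
      omega)) V
    have ht : ∀ g : Γ(E.X p, V) →ₗ[Γ(X, V)] Γ(E.X p, V),
        LinearMap.trace Γ(X, V) Γ(E.X p, V) g = 0 := fun g => by
      rw [Subsingleton.elim g 0, map_zero]
    rw [hF]
    simp only [F, ht, smul_zero, and_self]
  have hs : supertrace a k (hu.br hv (h := h)) hV =
      ∑ p ∈ Finset.Icc a (a + k), (F p - F (p + i)) := by
    refine Finset.sum_congr rfl fun p _ => ?_
    rw [hF, ← smul_sub]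
    congr 1
    have e : Op.toLin ((hu.br hv (h := h)) p p (add_zero p)) hV =
        Op.toLin (hu (p + j) p (by omega)) hV ∘ₗ Op.toLin (hv p (p + j) rfl) hV -
        (i * j).negOnePow • (Op.toLin (hv (p + i) p (by omega)) hV ∘ₗ
          Op.toLin (hu p (p + i) rfl) hV) :=
      LinearMap.ext fun m => by
        refine (Coch.br_at h u v p p (add_zero p) hV m).trans ?_
        rcases Int.units_eq_one_or (i * j).negOnePow with e | e <;> rw [e] <;>
          simp [Op.toLin_apply]
    rw [e, map_sub]
    rcases Int.units_eq_one_or (i * j).negOnePow with e | e <;> rw [e] <;> simp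
  -- Extending both sums to all integers makes them equal by translation invariance; over the
  -- interval itself the shift would not preserve the index set.
  have h₁ : ∑ᶠ p, F p = ∑ p ∈ Finset.Icc a (a + k), F p :=
    finsum_eq_sum_of_support_subset _ fun p hp => by
      by_contra h'
      exact hp (hz p h').1
  have h₂ : ∑ᶠ p, F (p + i) = ∑ p ∈ Finset.Icc a (a + k), F (p + i) :=
    finsum_eq_sum_of_support_subset _ fun p hp => by
      by_contra h'
      exact hp (hz p h').2
  rw [hs, Finset.sum_sub_distrib, ← h₁, ← h₂]
  exact sub_eq_zero.2 (finsum_comp_equiv (Equiv.addRight i)).symm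

theorem IsTraceDer.eq_zero_of_br (hb : ∀ i, i < a ∨ a + k < i → Limits.IsZero (E.X i))
    (hE : ∀ i, IsLocallyFree (E.X i)) {i j : ℤ} (h : i + j = 0) {u : Coch E i U} {v : Coch E j U}
    (hu : u.IsLin) (hv : v.IsLin) {z : PairDer f (detComplex E a k) U}
    (hz : IsTraceDer a k (linDer f (hu.br hv (h := h))) z) : z = 0 := by
  refine (pairData f (detComplex E a k)).ext_local fun p hp => ?_
  obtain ⟨V, hV, hpV, hfree⟩ := exists_allFree hb hE hp
  refine ⟨V, hV, hpV, ?_⟩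
  refine (hz.restrict_linDer hE hV hfree).trans ?_
  rw [supertrace_br hb h hu hv hV hfree, scalarDer_zero, map_zero]

end

end DGPair

end

noncomputable section

namespace DGPair

variable {X : Scheme.{u}} {A : Type u} [CommRing A] {f : X ⟶ Spec (CommRingCat.of A)}
  {U V W : X.Opens}

/-! ### The trace morphisms -/

theorem homToDG_app {L : DGLieSheaf f} {N : LieSheaf f} (φ : L.cx.X 0 ⟶ N.mod)
    (hd : ∀ (i : ℤ), (ComplexShape.up ℤ).Rel i 0 → L.cx.d i 0 ≫ φ = 0)
    (h₀ : ∀ (h : (0 : ℤ) + 0 = 0) (U : X.Opens) (x y : Γ(L.cx.X 0, U)),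
      φ.app U (L.br h U x y) = N.br U (φ.app U x) (φ.app U y))
    (h₁ : ∀ (i j : ℤ) (h : i + j = 0), i ≠ 0 → ∀ (U : X.Opens) (x : Γ(L.cx.X i, U))
      (y : Γ(L.cx.X j, U)), φ.app U (L.br h U x y) = 0) (U : X.Opens) (x : Γ(L.cx.X 0, U)) :
    ((LieSheaf.homToDG φ hd h₀ h₁).hom.f 0).app U x =
      (LieSheaf.incl N.mod 0).app U (φ.app U x) := by
  simp only [LieSheaf.homToDG, HomologicalComplex.mkHomToSingle_f, LieSheaf.incl]
  rfl

theorem toDG_app {L M : LieSheaf f} (g : L.Hom M) (U : X.Opens)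
    (x : Γ((LieSheaf.cx₀ L.mod).X 0, U)) :
    (g.toDG.hom.f 0).app U x =
      (LieSheaf.incl M.mod 0).app U (g.hom.app U ((LieSheaf.proj L.mod 0).app U x)) :=
  homToDG_app (L := L.toDG) (N := M) _ _ _ _ U x

/-- The target vanishes in nonzero degrees, so only degree zero has to be compared. -/
theorem hom_ext_cx₀ {C : CochainComplex X.Modules ℤ} {M : X.Modules} {g g' : C ⟶ LieSheaf.cx₀ M}
    (h : ∀ (U : X.Opens) (x : Γ(C.X 0, U)), (g.f 0).app U x = (g'.f 0).app U x) : g = g' := by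
  refine HomologicalComplex.hom_ext _ _ fun i => ?_
  by_cases hi : i = 0
  · subst hi
    ext U x
    exact h U x
  · exact (HomologicalComplex.isZero_single_obj_X (ComplexShape.up ℤ) 0 M i hi).eq_of_tgt _ _

section

variable {E : CochainComplex X.Modules ℤ} (hE : ∀ i, IsLocallyFree (E.X i)) (a : ℤ) (k : ℕ)

/-- The trace of a derivation of degree zero. -/
def traceDer (x : DerCoch f E 0 U) : PairDer f (detComplex E a k) U :=
  (IsTraceDer.exists' hE a k x).choose

theorem isTraceDer_traceDer (x : DerCoch f E 0 U) : IsTraceDer a k x (traceDer hE a k x) :=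
  (IsTraceDer.exists' hE a k x).choose_spec

/-- Additivity, linearity, restriction and brackets of the chosen trace are all deduced by
exhibiting a second trace and applying this. -/
theorem IsTraceDer.eq_traceDer {x : DerCoch f E 0 U} {z : PairDer f (detComplex E a k) U}
    (h : IsTraceDer a k x z) : traceDer hE a k x = z :=
  (isTraceDer_traceDer hE a k x).unique hE h

variable (f) in
/-- The trace in degree zero, as a morphism of sheaves. -/
def traceDerHom : (derData f E 0).toModules ⟶ (pairData f (detComplex E a k)).toModules :=
  homMk (M := (derData f E 0).toModules) (N := (pairData f (detComplex E a k)).toModules)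
    (fun U => AddMonoidHom.mk' (fun x : DerCoch f E 0 U => traceDer hE a k x) fun x y =>
      IsTraceDer.eq_traceDer hE a k
        ((isTraceDer_traceDer hE a k x).add (isTraceDer_traceDer hE a k y)))
    (fun _ c x => IsTraceDer.eq_traceDer hE a k ((isTraceDer_traceDer hE a k x).smul c))
    (fun hV x => (IsTraceDer.eq_traceDer hE a k
      ((isTraceDer_traceDer hE a k x).restrict hV)).symm)

theorem traceDer_der (x : DerCoch f E 0 U) : (traceDer hE a k x).der = x.1.1 :=
  (isTraceDer_traceDer hE a k x).der_eq

variable {a k} (hb : ∀ i, i < a ∨ a + k < i → Limits.IsZero (E.X i))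
-- Near every point all terms are free, the trace is multiplication by the supertrace, and the
-- supertrace of a supercommutator is zero.
theorem traceDer_br_eq_zero (hb : ∀ i, i < a ∨ a + k < i → Limits.IsZero (E.X i)) {i j : ℤ}
    (h : i + j = 0) {u : Coch E i U} {v : Coch E j U}
    (hu : u.IsLin) (hv : v.IsLin) : traceDer hE a k (linDer f (hu.br hv (h := h))) = 0 :=
  (isTraceDer_traceDer hE a k _).eq_zero_of_br hb hE h hu hv

variable (f) in
/-- The trace map on derivations. -/
def derTrace : (derDG f E).Hom (pairLie f (detComplex E a k)).toDG :=
  LieSheaf.homToDG (L := derDG f E) (N := pairLie f (detComplex E a k)) (traceDerHom f hE a k)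
    (fun i h => by
      ext U x
      -- The incoming degree is -1, where a derivation is a linear cochain; its differential is
      -- therefore a supercommutator with `d_E`, whose trace vanishes.
      have hi : i ≠ 0 := by
        have : i + 1 = 0 := h
        omega
      refine (congrArg (traceDer hE a k (U := U)) ((derCx f E).toCx_d_app h U x)).trans ?_
      exact traceDer_br_eq_zero hE hb _ Coch.diff_isLin (x.2.lin hi))
    (fun h U x y => IsTraceDer.eq_traceDer hE a k
      ((isTraceDer_traceDer hE a k x).bracket h (isTraceDer_traceDer hE a k y)))
    (fun i j h hi U x y => by
      have hj : j ≠ 0 := by omega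
      -- In nonzero degrees the components in the tangent sheaf vanish, so the bracket is the
      -- supercommutator of two linear cochains.
      have e : derBr f E h x y = linDer f ((x.2.lin hi).br (y.2.lin hj) (h := h)) :=
        Subtype.ext (Prod.ext ((congrArg (fun z => Op.comm z y.1.1) (x.2.zero hi)).trans
          (Op.zero_comm _)) rfl)
      exact (congrArg (traceDer hE a k (U := U)) e).trans
        (traceDer_br_eq_zero hE hb h (x.2.lin hi) (y.2.lin hj)))

theorem proj_derTrace (x : DerCoch f E 0 U) :
    (LieSheaf.proj (pairData f (detComplex E a k)).toModules 0).app U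
      (((derTrace f hE hb).hom.f 0).app U x) = traceDer hE a k x := by
  refine (congrArg ((LieSheaf.proj (pairData f (detComplex E a k)).toModules 0).app U)
    (homToDG_app (L := derDG f E) (N := pairLie f (detComplex E a k)) (traceDerHom f hE a k)
      _ _ _ U x)).trans ?_
  exact LieSheaf.proj_incl _ _

theorem isTraceMap_derTrace : IsTraceMap f E a k (derTrace f hE hb) := fun U x => by
  rw [proj_derTrace]
  exact isTraceDer_traceDer hE a k x

variable (a k)

/-- The trace keeps the anchor, here zero, and linear derivations of the invertible sheaf `det E`
are scalars. This defines the supertrace on all of `U`, also where the terms of `E` are not free. -/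
theorem exists_scalar (x : (homData E 0).S U) :
    ∃ c, traceDer hE a k (linDer f x.2) = scalarDer f (detComplex E a k) c :=
  exists_eq_scalarDer (isInvertible_detComplex hE a k) (traceDer_der hE a k _)

variable (f) in
/-- The supertrace of a linear cochain. -/
def traceFun (x : (homData E 0).S U) : Γ(X, U) := (exists_scalar (f := f) hE a k x).choose

theorem traceDer_linDer (x : (homData E 0).S U) : traceDer hE a k (linDer f x.2) =
    scalarDer f (detComplex E a k) (traceFun f hE a k x) :=
  (exists_scalar hE a k x).choose_spec

theorem traceFun_eq {x : (homData E 0).S U} {c : Γ(X, U)}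
    (h : IsTraceDer a k (linDer f x.2) (scalarDer f (detComplex E a k) c)) :
    traceFun f hE a k x = c :=
  scalarDer_injective (isInvertible_detComplex hE a k)
    ((traceDer_linDer hE a k x).symm.trans (h.eq_traceDer hE))

theorem isTraceDer_traceFun (x : (homData E 0).S U) : IsTraceDer a k (linDer f x.2)
    (scalarDer f (detComplex E a k) (traceFun f hE a k x)) :=
  traceDer_linDer (f := f) hE a k x ▸ isTraceDer_traceDer hE a k _

variable (f) in
/-- The supertrace, as a morphism of sheaves. -/
def traceFunHom : (homData E 0).toModules ⟶ OO X :=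
  homMk (M := (homData E 0).toModules) (N := OO X)
    (fun U => AddMonoidHom.mk' (fun x : (homData E 0).S U => (fn U).symm (traceFun f hE a k x))
      fun x y => by
        rw [← map_add]
        refine congrArg _ (traceFun_eq hE a k ?_)
        rw [scalarDer_add]
        have := (isTraceDer_traceFun (f := f) hE a k x).add (isTraceDer_traceFun hE a k y)
        convert this using 1
        exact Subtype.ext (Prod.ext (add_zero _).symm rfl))
    (fun U c x => by
      apply (fn U).injective
      refine (traceFun_eq hE a k ?_).trans (fn_smul c _).symm
      refine Eq.mp (congrArg₂ (IsTraceDer a k) ?_ ?_)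
        ((isTraceDer_traceFun (f := f) hE a k x).smul c)
      · exact Subtype.ext (Prod.ext (smul_zero c) rfl)
      · exact (scalarDer_smul c _).symm)
    (fun {U V} hV x => by
      apply (fn V).injective
      refine Eq.symm (traceFun_eq hE a k ?_)
      refine Eq.mp (congrArg₂ (IsTraceDer a k) ?_ ?_)
        ((isTraceDer_traceFun (f := f) hE a k x).restrict hV)
      · exact Subtype.ext (Prod.ext (map_zero (Op.restrict hV)) rfl)
      · exact scalarDer_restrict _ hV)

theorem fn_traceFunHom (x : (homData E 0).S U) :
    fn U ((traceFunHom f hE a k).app U x) = traceFun f hE a k x := rfl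

theorem traceFunHom_eq_zero {x : (homData E 0).S U}
    (h : traceDer hE a k (linDer f x.2) = 0) : (traceFunHom f hE a k).app U x = 0 := by
  apply (fn U).injective
  rw [fn_traceFunHom, map_zero]
  refine traceFun_eq hE a k ?_
  rw [scalarDer_zero, ← h]
  exact isTraceDer_traceDer hE a k _

variable {a k}
variable (f) in
/-- The trace map on linear cochains. -/
def homTrace : (homDG f E).Hom (trivialLie f).toDG :=
  LieSheaf.homToDG (L := homDG f E) (N := trivialLie f) (traceFunHom f hE a k)
    (fun i h => by
      ext U x
      refine (congrArg ((traceFunHom f hE a k).app U) ((homCx E).toCx_d_app h U x)).trans ?_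
      exact traceFunHom_eq_zero (f := f) hE a k
        (traceDer_br_eq_zero hE hb ((add_comm 1 i).trans h) Coch.diff_isLin x.2))
    -- The structure sheaf has the trivial bracket, so here even brackets of two elements of degree
    -- zero must have trace zero.
    (fun h U x y => traceFunHom_eq_zero (f := f) hE a k (traceDer_br_eq_zero hE hb h x.2 y.2))
    (fun i j h _ U x y => traceFunHom_eq_zero (f := f) hE a k
      (traceDer_br_eq_zero hE hb h x.2 y.2))

theorem proj_homTrace (x : (homData E 0).S U) :
    fn U ((LieSheaf.proj (OO X) 0).app U (((homTrace f hE hb).hom.f 0).app U x)) =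
      traceFun f hE a k x := by
  refine (congrArg (fun y => fn U ((LieSheaf.proj (OO X) 0).app U y))
    (homToDG_app (L := homDG f E) (N := trivialLie f) (traceFunHom f hE a k) _ _ _ U x)).trans ?_
  exact congrArg (fn U) (LieSheaf.proj_incl _ _)

/-- Where the terms are free, the trace of (0, u) is also multiplication by the explicit supertrace,
and a scalar derivation determines its scalar. -/
theorem isTrace_homTrace : IsTrace f E a k (homTrace f hE hb) := fun U x V hV hfree => by
  rw [fn_res, proj_homTrace]
  have h := (isTraceDer_traceFun (f := f) hE a k x).restrict_linDer hE hV hfree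
  rw [scalarDer_restrict] at h
  exact scalarDer_injective (isInvertible_detComplex hE a k) h

/-- This is the defining property of `traceFun`: the trace of (0, u) is multiplication by it. -/
theorem homIncl_derTrace_app (x : (homData E 0).S U) :
    ((derTrace f hE hb).hom.f 0).app U (linDer f x.2) =
      ((scalarIncl f (detComplex E a k)).toDG.hom.f 0).app U
        (((homTrace f hE hb).hom.f 0).app U x) := by
  refine (homToDG_app (L := derDG f E) (N := pairLie f (detComplex E a k))
    (traceDerHom f hE a k) _ _ _ U (linDer f x.2)).trans ?_
  have e := toDG_app (scalarIncl f (detComplex E a k)) U (((homTrace f hE hb).hom.f 0).app U x)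
  refine Eq.trans ?_ e.symm
  refine congrArg ((LieSheaf.incl (pairData f (detComplex E a k)).toModules 0).app U) ?_
  refine (traceDer_linDer hE a k x).trans ?_
  rw [← proj_homTrace hE hb x]
  rfl

theorem homIncl_derTrace : (homIncl f E).hom ≫ (derTrace f hE hb).hom =
    (homTrace f hE hb).hom ≫ (scalarIncl f (detComplex E a k)).toDG.hom := by
  refine hom_ext_cx₀ (M := (pairData f (detComplex E a k)).toModules) fun U x => ?_
  have e := homIncl_derTrace_app (f := f) (U := U) hE hb x
  have e1 : (((homIncl f E).hom ≫ (derTrace f hE hb).hom).f 0).app U x =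
    ((derTrace f hE hb).hom.f 0).app U (((homIncl f E).hom.f 0).app U x) := rfl
  have e2 : (((homTrace f hE hb).hom ≫ (scalarIncl f (detComplex E a k)).toDG.hom).f 0).app U x =
    ((scalarIncl f (detComplex E a k)).toDG.hom.f 0).app U
        (((homTrace f hE hb).hom.f 0).app U x) := rfl
  exact e1.trans (e.trans e2.symm)

theorem derTrace_pairAnchor :
    (derTrace f hE hb).hom ≫ (pairAnchor f (detComplex E a k)).toDG.hom = (anchor f E).hom := by
  refine hom_ext_cx₀ (M := (thetaData f).toModules) fun U x => ?_
  refine Eq.trans (toDG_app (pairAnchor f (detComplex E a k)) U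
    (((derTrace f hE hb).hom.f 0).app U x)) ?_
  refine Eq.trans ?_ (homToDG_app (L := derDG f E) (N := theta f) _ _ _ _ U x).symm
  refine congrArg ((LieSheaf.incl (thetaData f).toModules 0).app U) ?_
  refine (congrArg ((pairAnchor f (detComplex E a k)).hom.app U) (proj_derTrace hE hb x)).trans ?_
  exact Subtype.ext (traceDer_der hE a k x)

end

end DGPair

end

noncomputable section

namespace DGPair

variable {X : Scheme.{u}} {A : Type u} [CommRing A] {f : X ⟶ Spec (CommRingCat.of A)}
  {U V W : X.Opens}

/-! ### Exactness -/

/-- A sequence of sheaves of modules is short exact if it is left exact on sections and the last map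
is locally surjective. -/
theorem shortExact_of_sections (S : ShortComplex X.Modules)
    (hinj : ∀ (U : X.Opens) (x : Γ(S.X₁, U)), S.f.app U x = 0 → x = 0)
    (hker : ∀ (U : X.Opens) (x : Γ(S.X₂, U)), S.g.app U x = 0 → ∃ y, S.f.app U y = x)
    (hsurj : ∀ (U : X.Opens) (x : Γ(S.X₃, U)) (p : X), p ∈ U → ∃ (V : X.Opens) (hV : V ≤ U),
      p ∈ V ∧ ∃ y, S.g.app V y = res S.X₃ hV x) : S.ShortExact := by
  have hinj' : ∀ (U : X.Opens) (x y : Γ(S.X₁, U)), S.f.app U x = S.f.app U y → x = y :=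
    fun U x y h => sub_eq_zero.1 (hinj U _ (by rw [map_sub, h, sub_self]))
  have hk : Nonempty (Limits.IsLimit (Limits.KernelFork.ofι S.f S.zero)) := by
    have key : ∀ (T : X.Modules) (k : T ⟶ S.X₂) (_ : k ≫ S.g = 0) (U : X.Opens) (t : Γ(T, U)),
        ∃ y, S.f.app U y = k.app U t := fun T k hk U t => hker U _ (by
      have : (k ≫ S.g).app U t = 0 := by rw [hk]; rfl
      exact this)
    -- Lifts are chosen section by section. They are unique by injectivity, and this makes the
    -- choice additive, linear and compatible with restriction.
    choose l hl using key
    refine ⟨Limits.KernelFork.IsLimit.ofι S.f S.zero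
      (fun {T} k hk => homMk (fun U => AddMonoidHom.mk' (fun t => l T k hk U t)
        fun s t => hinj' U _ _ ?_) (fun U a t => hinj' U _ _ ?_) (fun {U V} h t => hinj' V _ _ ?_))
      (fun {T} k hk => ?_) (fun {T} k hk m hm => ?_)⟩
    · rw [map_add, hl, hl, hl, map_add]
    · simp only [AddMonoidHom.mk'_apply]
      rw [Scheme.Modules.Hom.app_smul, hl, hl, Scheme.Modules.Hom.app_smul]
    · simp only [AddMonoidHom.mk'_apply]
      rw [← LieSheaf.res_hom, hl, hl, LieSheaf.res_hom]
    · ext U t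
      exact hl T k hk U t
    · ext U t
      refine hinj' U _ _ (Eq.trans ?_ (hl T k hk U t).symm)
      rw [← hm]; rfl
  have : Mono S.f := Limits.Fork.IsLimit.mono hk.some
  have : Epi S.g := by
    refine (SheafOfModules.epi_of_locally_surjective
      (M := S.X₂) (N := S.X₃) S.g fun U x => ?_ : Epi (C := SheafOfModules X.ringCatSheaf) S.g)
    -- The open sets over which `x` lifts form a sieve, which covers by local surjectivity.
    refine ⟨{ arrows := fun V i => ∃ y, S.g.app V y = res S.X₃ (leOfHom i) x
              downward_closed := ?_ }, ?_, ?_⟩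
    · rintro V V' i ⟨y, hy⟩ j
      refine ⟨res S.X₂ (leOfHom j) y, ?_⟩
      refine (LieSheaf.res_hom S.g (leOfHom j) y).symm.trans ?_
      refine (congrArg (res S.X₃ (leOfHom j)) hy).trans ?_
      exact res_res S.X₃ (leOfHom i) (leOfHom j) (show Γ(S.X₃, U) from x)
    · intro p hp
      obtain ⟨V, hV, hpV, y, hy⟩ := hsurj U x p hp
      exact ⟨V, homOfLE hV, ⟨y, hy⟩, hpV⟩
    · rintro V i ⟨y, hy⟩
      exact ⟨y, hy⟩
  exact ⟨ShortComplex.exact_of_f_is_kernel S hk.some⟩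

theorem isExactSeq_of_sections {L M N : DGLieSheaf f} (i : L.Hom M) (p : M.Hom N)
    (hzero : i.hom ≫ p.hom = 0)
    (hinj : ∀ n (U : X.Opens) (x : Γ(L.cx.X n, U)), (i.hom.f n).app U x = 0 → x = 0)
    (hker : ∀ n (U : X.Opens) (x : Γ(M.cx.X n, U)), (p.hom.f n).app U x = 0 →
      ∃ y, (i.hom.f n).app U y = x)
    (hsurj : ∀ n (U : X.Opens) (x : Γ(N.cx.X n, U)) (q : X), q ∈ U → ∃ (V : X.Opens) (hV : V ≤ U),
      q ∈ V ∧ ∃ y, (p.hom.f n).app V y = res (N.cx.X n) hV x) : IsExactSeq i p :=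
  ⟨hzero, HomologicalComplex.shortExact_of_degreewise_shortExact _ fun n =>
    shortExact_of_sections _ (hinj n) (hker n) (hsurj n)⟩

theorem LieSheaf.incl_injective (M : X.Modules) {x : Γ(M, U)}
    (h : (LieSheaf.incl M 0).app U x = 0) : x = 0 := by
  rw [← LieSheaf.proj_incl M x, h, map_zero]

theorem anchor_app (E : CochainComplex X.Modules ℤ) (x : DerCoch f E 0 U) :
    ((anchor f E).hom.f 0).app U x =
      (LieSheaf.incl (thetaData f).toModules 0).app U (⟨x.1.1, x.2.der⟩ : Der f U) :=
  homToDG_app (L := derDG f E) (N := theta f) _ _ _ _ U x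

variable {E : CochainComplex X.Modules ℤ}

/-- Where the terms of `E` are free, every derivation of functions lifts to a derivation of `E`. -/
theorem exists_derCoch (hV : AllFree E V) {h : Op (OO X) (OO X) V} (hh : Op.IsDer f h) :
    ∃ x : DerCoch f E 0 V, x.1.1 = h := by
  choose n e he using hV
  -- A component of degree zero has type `E^p → E^q` with `p + 0 = q`; the cast identifies `q` with
  -- `p` and is trivial on the diagonal.
  refine ⟨⟨(h, fun x => cast (congrArg (fun j => Op (E.X x.1.1) (E.X j) V)
      (by have := x.2; omega : x.1.1 = x.1.2)) ((he x.1.1).derOp h)), hh, fun h => absurd rfl h,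
      fun h => absurd rfl h, fun p hp => (he p).isPair_derOp hh⟩, rfl⟩

/-- A derivation with zero anchor is a linear cochain, automatically so in nonzero degrees.
Surjectivity is needed only in degree zero, and there only locally, where `h` acts on coefficients
with respect to frames. -/
theorem isExactSeq_homIncl_anchor {a : ℤ} {k : ℕ} (hE : ∀ i, IsLocallyFree (E.X i))
    (hb : ∀ i, i < a ∨ a + k < i → Limits.IsZero (E.X i)) :
    IsExactSeq (homIncl f E) (anchor f E) := by
  refine isExactSeq_of_sections _ _ ?_ ?_ ?_ ?_
  · refine hom_ext_cx₀ (M := (thetaData f).toModules) fun U x => ?_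
    refine (anchor_app E (⟨(0, x.1), IsDerCoch.of_isLin x.2⟩ : DerCoch f E 0 U)).trans ?_
    exact map_zero ((LieSheaf.incl (thetaData f).toModules 0).app U).hom
  · intro n U x hx
    exact Subtype.ext (congrArg (fun y : DerCoch f E n U => y.1.2) hx)
  · intro n U x hx
    have h0 : (show DerCoch f E n U from x).1.1 = 0 := by
      by_cases hn : n = 0
      · subst hn
        have := LieSheaf.incl_injective (thetaData f).toModules ((anchor_app E x).symm.trans hx)
        exact congrArg Subtype.val this
      · exact (show DerCoch f E n U from x).2.zero hn
    have hx2 := (show DerCoch f E n U from x).2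
    change IsDerCoch f _ _ at hx2
    rw [h0] at hx2
    exact ⟨(⟨(show DerCoch f E n U from x).1.2, IsDerCoch.isLin hx2⟩ : (homData E n).S U),
      Subtype.ext (Prod.ext h0.symm rfl)⟩
  · intro n U x q hq
    by_cases hn : n = 0
    · subst hn
      obtain ⟨V, hV, hqV, hfree⟩ := exists_allFree hb hE hq
      refine ⟨V, hV, hqV, ?_⟩
      obtain ⟨y, hy⟩ := exists_derCoch (f := f) hfree
        (h := ((thetaData f).r hV ((LieSheaf.proj (thetaData f).toModules 0).app U x)).1)
        ((thetaData f).r hV ((LieSheaf.proj (thetaData f).toModules 0).app U x)).2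
      refine ⟨y, (anchor_app E y).trans ?_⟩
      refine Eq.trans ?_ (LieSheaf.incl_proj (thetaData f).toModules 0 _)
      refine congrArg ((LieSheaf.incl (thetaData f).toModules 0).app V) ?_
      refine Eq.trans ?_ (LieSheaf.res_hom (LieSheaf.proj (thetaData f).toModules 0) hV x)
      exact Subtype.ext hy
    · exact ⟨U, le_rfl, hq, 0, (map_zero _).trans
        (LieSheaf.single_eq_zero (thetaData f).toModules hn _).symm⟩

/-- A short exact sequence of sheaves of Lie algebras is exact as a sequence of sheaves of DG-Lie
algebras. -/
theorem isExactSeq_toDG {L M N : LieSheaf f} (i : L.Hom M) (p : M.Hom N)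
    (hzero : ∀ (U : X.Opens) (x : Γ(L.mod, U)), p.hom.app U (i.hom.app U x) = 0)
    (hinj : ∀ (U : X.Opens) (x : Γ(L.mod, U)), i.hom.app U x = 0 → x = 0)
    (hker : ∀ (U : X.Opens) (x : Γ(M.mod, U)), p.hom.app U x = 0 → ∃ y, i.hom.app U y = x)
    (hsurj : ∀ (U : X.Opens) (x : Γ(N.mod, U)) (q : X), q ∈ U → ∃ (V : X.Opens) (hV : V ≤ U),
      q ∈ V ∧ ∃ y, p.hom.app V y = res N.mod hV x) : IsExactSeq i.toDG p.toDG := by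
  refine isExactSeq_of_sections _ _ ?_ ?_ ?_ ?_
  · refine hom_ext_cx₀ (M := N.mod) fun U x => ?_
    refine (toDG_app p U ((i.toDG.hom.f 0).app U x)).trans ?_
    rw [toDG_app i U x, LieSheaf.proj_incl, hzero, map_zero]
    rfl
  · intro n U x hx
    by_cases hn : n = 0
    · subst hn
      have := hinj U _ (LieSheaf.incl_injective M.mod ((toDG_app i U x).symm.trans hx))
      rw [← LieSheaf.incl_proj L.mod 0 x, this]
      exact map_zero ((LieSheaf.incl L.mod 0).app U).hom
    · exact LieSheaf.single_eq_zero L.mod hn x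
  · intro n U x hx
    by_cases hn : n = 0
    · subst hn
      obtain ⟨y, hy⟩ := hker U _ (LieSheaf.incl_injective N.mod ((toDG_app p U x).symm.trans hx))
      refine ⟨(LieSheaf.incl L.mod 0).app U y, (toDG_app i U _).trans ?_⟩
      rw [LieSheaf.proj_incl, hy]
      exact LieSheaf.incl_proj M.mod 0 x
    · exact ⟨0, (map_zero _).trans (LieSheaf.single_eq_zero M.mod hn x).symm⟩
  · intro n U x q hq
    by_cases hn : n = 0
    · subst hn
      obtain ⟨V, hV, hqV, y, hy⟩ := hsurj U ((LieSheaf.proj N.mod 0).app U x) q hq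
      refine ⟨V, hV, hqV, (LieSheaf.incl M.mod 0).app V y, (toDG_app p V _).trans ?_⟩
      rw [LieSheaf.proj_incl, hy]
      refine Eq.trans ?_ (LieSheaf.incl_proj N.mod 0 _)
      exact congrArg ((LieSheaf.incl N.mod 0).app V) (LieSheaf.res_hom (LieSheaf.proj N.mod 0) hV x)
    · exact ⟨U, le_rfl, hq, 0, (map_zero _).trans (LieSheaf.single_eq_zero N.mod hn _).symm⟩

/-- Invertibility is what makes the kernel of the anchor equal to the functions: linear operators
are scalars, uniquely. Lifts of `h` exist locally by sending a generator to zero. -/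
theorem isExactSeq_scalarIncl_pairAnchor {M : X.Modules} (hM : IsInvertible M) :
    IsExactSeq (scalarIncl f M).toDG (pairAnchor f M).toDG := by
  refine isExactSeq_toDG _ _ (fun U x => rfl) (fun U x hx => ?_) (fun U x hx => ?_)
    (fun U x q hq => ?_)
  · have e : scalarDer f M (fn U x) = scalarDer f M 0 := by
      refine Eq.trans hx (Eq.symm (Subtype.ext (Prod.ext rfl ?_)))
      exact zero_smul Γ(X, U) (Op.ofHom (𝟙 M) U)
    exact scalarDer_injective hM e
  · obtain ⟨c, hc⟩ := exists_eq_scalarDer (f := f) hM (z := (show PairDer f M U from x))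
      (congrArg Subtype.val hx)
    exact ⟨(fn U).symm c, hc.symm⟩
  · obtain ⟨V, hV, e, hqV, he⟩ := hM.exists_generator hq
    refine ⟨V, hV, hqV, (he.pair ((thetaData f).r hV x).1 ((thetaData f).r hV x).2 fun _ => 0), ?_⟩
    rfl

end DGPair

end

noncomputable section

namespace DGPair

/-! ### Derivations of finitely generated algebras along a homomorphism -/

section

variable {A B C : Type*} [CommRing A] [CommRing B] [CommRing C]

/-- `D : B → C` is an `A`-linear derivation with values in `C`, viewed as a `B`-module through
`ρ`. -/
structure IsDerAlong (φ : A →+* B) (ρ : B →+* C) (D : B →+ C) : Prop where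
  mul : ∀ b c, D (b * c) = ρ b * D c + ρ c * D b
  base : ∀ a, D (φ a) = 0

open MvPolynomial in
-- This is the chain rule D(p(x)) = ∑ (∂p/∂x_i)(x) D(x_i), proved by induction on the polynomial.
theorem IsDerAlong.map_eq_sum {n : ℕ} {φ : A →+* B} {ρ : B →+* C} {D : B →+ C}
    (hD : IsDerAlong φ ρ D) (x : Fin n → B) (p : MvPolynomial (Fin n) A) :
    D (eval₂Hom φ x p) = ∑ i, ρ (eval₂Hom φ x (pderiv i p)) * D (x i) := by
  classical
  induction p using MvPolynomial.induction_on with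
  | C a => simp [hD.base]
  | add p q hp hq => simp only [map_add, hp, hq, add_mul, Finset.sum_add_distrib]
  | mul_X p j hp =>
    rw [map_mul, hD.mul, hp, eval₂Hom_X']
    simp only [pderiv_mul, map_add, map_mul, add_mul, Finset.sum_add_distrib, eval₂Hom_X',
      pderiv_X, Finset.mul_sum]
    rw [add_comm]
    congr 1
    · exact Finset.sum_congr rfl fun i _ => by ring
    · rw [Finset.sum_eq_single j]
      · simp
      · intro i _ hi; simp [Pi.single_eq_of_ne hi.symm]
      · simp

open MvPolynomial in
/-- The derivations of a finitely generated algebra over a noetherian ring are the solutions of a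
finite system of linear equations. -/
theorem exists_derivation_equations.{v, w, t} {A : Type v} {B : Type w} [CommRing A]
    [IsNoetherianRing A] [CommRing B] (φ : A →+* B) (hφ : φ.FiniteType) :
    ∃ (n m : ℕ) (x : Fin n → B) (T : Fin m → Fin n → B),
      ∀ {C : Type t} [CommRing C] (ρ : B →+* C),
        (∀ D : B →+ C, IsDerAlong φ ρ D → ∀ j, ∑ i, ρ (T j i) * D (x i) = 0) ∧
        (∀ D : B →+ C, IsDerAlong φ ρ D → (∀ i, D (x i) = 0) → D = 0) ∧
        ∀ c : Fin n → C, (∀ j, ∑ i, ρ (T j i) * c i = 0) →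
          ∃ D : B →+ C, IsDerAlong φ ρ D ∧ ∀ i, D (x i) = c i := by
  classical
  let _ := φ.toAlgebra
  have hφ' : Algebra.FiniteType A B := hφ
  obtain ⟨n, g, hg⟩ := Algebra.FiniteType.iff_quotient_mvPolynomial''.1 hφ'
  -- The ideal of relations is finitely generated by Hilbert's basis theorem. The coefficients of
  -- the system are the partial derivatives of its generators.
  obtain ⟨m, p, hp⟩ := Submodule.fg_iff_exists_fin_generating_family.1
    (IsNoetherian.noetherian (RingHom.ker g))
  have hgx : ∀ q, eval₂Hom φ (fun i => g (X i)) q = g q := fun q => by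
    rw [aeval_unique g]
    simp only [aeval_X]
    rfl
  have hpg : ∀ j, g (p j) = 0 := fun j => by
    have : p j ∈ RingHom.ker g := hp ▸ Submodule.subset_span ⟨j, rfl⟩
    exact this
  refine ⟨n, m, fun i => g (X i), fun j i => g (pderiv i (p j)),
    fun {C} _ ρ => ⟨fun D hD j => ?_, fun D hD h => ?_, fun c hc => ?_⟩⟩
  · have := hD.map_eq_sum (fun i => g (X i)) (p j)
    simp only [hgx] at this
    rw [← this, hpg, map_zero]
  · ext b
    obtain ⟨q, rfl⟩ := hg b
    have := hD.map_eq_sum (fun i => g (X i)) q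
    simp only [hgx, h] at this
    rw [this]
    simp
  · let D' : MvPolynomial (Fin n) A →+ C := AddMonoidHom.mk'
      (fun q => ∑ i, ρ (g (pderiv i q)) * c i)
      fun q r => by simp only [map_add, add_mul, Finset.sum_add_distrib]
    have hD' : ∀ q, D' q = ∑ i, ρ (g (pderiv i q)) * c i := fun q => rfl
    have hmul : ∀ q r, D' (q * r) = ρ (g q) * D' r + ρ (g r) * D' q := fun q r => by
      simp only [hD', pderiv_mul, map_add, map_mul, Finset.mul_sum, ← Finset.sum_add_distrib]
      exact Finset.sum_congr rfl fun i _ => by ring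
    -- `D'` is the derivation of the polynomial ring with values `c`. It kills the generators of the
    -- relation ideal by hypothesis, and their multiples because each product rule term contains a
    -- factor that is zero.
    have hker : ∀ q, g q = 0 → D' q = 0 := fun q hq => by
      have : q ∈ Submodule.span (MvPolynomial (Fin n) A) (Set.range p) := by
        rw [hp]; exact hq
      induction this using Submodule.span_induction with
      | mem y hy => obtain ⟨j, rfl⟩ := hy; exact hc j
      | zero => exact map_zero D'
      | add y z hy hz h1 h2 =>
        have h0 : ∀ y ∈ Submodule.span (MvPolynomial (Fin n) A) (Set.range p), g y = 0 :=
          fun y hy => by rw [hp] at hy; exact hy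
        rw [map_add, h1 (h0 y hy), h2 (h0 z hz), add_zero]
      | smul r y hy h1 =>
        have h0 : g y = 0 := by rw [hp] at hy; exact hy
        rw [smul_eq_mul, hmul, h1 h0, h0]
        simp
    have hwd : ∀ q r, g q = g r → D' q = D' r := fun q r h => sub_eq_zero.1 <| by
      rw [← map_sub]; exact hker _ (by rw [map_sub, h, sub_self])
    -- Since `D' q` depends only on `g q`, any set-theoretic section of `g` lets `D'` descend.
    let l := Function.surjInv hg
    have hl : ∀ b, g (l b) = b := Function.surjInv_eq hg
    refine ⟨AddMonoidHom.mk' (fun b => D' (l b)) fun b b' => ?_, ⟨fun b b' => ?_, fun a => ?_⟩,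
      fun i => ?_⟩
    · rw [← map_add]; exact hwd _ _ (by simp only [map_add, hl])
    · simp only [AddMonoidHom.mk'_apply]
      rw [hwd (l (b * b')) (l b * l b') (by simp only [map_mul, hl]), hmul, hl, hl]
    · simp only [AddMonoidHom.mk'_apply]
      rw [hwd (l (φ a)) (MvPolynomial.C a) (by
        rw [hl, ← hgx, eval₂Hom_C]), hD']
      simp
    · simp only [AddMonoidHom.mk'_apply]
      rw [hwd _ (X i) (hl _), hD', Finset.sum_eq_single i]
      · simp
      · intro j _ hj; simp [pderiv_X, Pi.single_eq_of_ne hj.symm]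
      · simp

end

end DGPair

end

noncomputable section

namespace DGPair

variable {X : Scheme.{u}} {A : Type u} [CommRing A] {f : X ⟶ Spec (CommRingCat.of A)}
  {U V W : X.Opens}

/-! ### Derivations of functions on open subsets of an affine scheme -/

/-- A function on an open subset of an affine scheme is locally a fraction. -/
theorem exists_fraction (hV : IsAffineOpen V) (hW : W ≤ V) (g : Γ(X, W)) {p : X} (hp : p ∈ W) :
    ∃ (W' : X.Opens) (h' : W' ≤ W), p ∈ W' ∧ ∃ s b : Γ(X, V), IsUnit (resO (h'.trans hW) s) ∧
      resO (h'.trans hW) s * resO h' g = resO (h'.trans hW) b := by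
  obtain ⟨r, hrW, hpr⟩ := hV.exists_basicOpen_le ⟨p, hp⟩ (hW hp)
  have := hV.isLocalization_basicOpen r
  obtain ⟨⟨b, s⟩, hbs⟩ := IsLocalization.surj (Submonoid.powers r) (resO hrW g)
  exact ⟨X.basicOpen r, hrW, hpr, s, b, IsLocalization.map_units _ s, (mul_comm _ _).trans hbs⟩

/-- A function on an affine scheme that vanishes on an open subset is locally torsion there. -/
theorem exists_mul_eq_zero (hV : IsAffineOpen V) (hW : W ≤ V) {c : Γ(X, V)} (hc : resO hW c = 0)
    {p : X} (hp : p ∈ W) :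
    ∃ (W' : X.Opens) (h' : W' ≤ W), p ∈ W' ∧ ∃ s : Γ(X, V), IsUnit (resO (h'.trans hW) s) ∧
      s * c = 0 := by
  obtain ⟨r, hrW, hpr⟩ := hV.exists_basicOpen_le ⟨p, hp⟩ (hW hp)
  have := hV.isLocalization_basicOpen r
  have h0 : algebraMap Γ(X, V) Γ(X, X.basicOpen r) c = 0 := by
    have := congrArg (resO hrW) hc
    rwa [resO_resO, map_zero] at this
  obtain ⟨s, hs⟩ := (IsLocalization.map_eq_zero_iff (Submonoid.powers r) _ _).1 h0
  exact ⟨X.basicOpen r, hrW, hpr, s, IsLocalization.map_units _ s, hs⟩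

namespace IsDerAlong

variable {hW : W ≤ V} {D : Γ(X, V) →+ Γ(X, W)}

/-- Locally `s c = 0` for some `s` that is invertible there. Applying `D` and using that `c`
restricts to zero leaves `s D(c) = 0`. This makes the quotient rule independent of the fraction. -/
theorem resO_eq_zero (hV : IsAffineOpen V) (hD : IsDerAlong (baseMap f V) (resO hW) D)
    (h : U ≤ W) {c : Γ(X, V)} (hc : resO (h.trans hW) c = 0) : resO h (D c) = 0 := by
  refine resO_ext_local fun p hp => ?_
  obtain ⟨W', h', hp', s, hs, hsc⟩ := exists_mul_eq_zero hV (h.trans hW) hc hp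
  refine ⟨W', h', hp', ?_⟩
  have e := congrArg (resO (h'.trans h)) (hD.mul s c)
  have hc' := congrArg (resO h') hc
  rw [hsc, map_zero, map_zero, map_add, map_mul, map_mul, resO_resO, resO_resO] at e
  rw [resO_resO, map_zero] at hc'
  rw [hc', zero_mul, add_zero] at e
  rw [map_zero, resO_resO]
  exact (hs.mul_right_eq_zero).1 e.symm

end IsDerAlong

/-- Near every point of `U`, the function `g` is a fraction `b / s` of functions on `V`, and the
function `t` is `(D b - g D s) / s`. -/
def IsQuotientRule (hW : W ≤ V) (D : Γ(X, V) →+ Γ(X, W)) (hU : U ≤ W) (g t : Γ(X, U)) : Prop :=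
  ∀ p, p ∈ U → ∃ (U' : X.Opens) (h : U' ≤ U), p ∈ U' ∧ ∃ s b : Γ(X, V),
    IsUnit (resO ((h.trans hU).trans hW) s) ∧
    resO ((h.trans hU).trans hW) s * resO h g = resO ((h.trans hU).trans hW) b ∧
    resO ((h.trans hU).trans hW) s * resO h t + resO h g * resO (h.trans hU) (D s) =
      resO (h.trans hU) (D b)

namespace IsQuotientRule

variable {hW : W ≤ V} {D : Γ(X, V) →+ Γ(X, W)} {hU : U ≤ W} {g g' t t' : Γ(X, U)}

theorem of_fraction {s b : Γ(X, V)} (hs : IsUnit (resO (hU.trans hW) s))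
    (hb : resO (hU.trans hW) s * g = resO (hU.trans hW) b)
    (ht : resO (hU.trans hW) s * t + g * resO hU (D s) = resO hU (D b)) :
    IsQuotientRule hW D hU g t := fun p hp =>
  ⟨U, le_rfl, hp, s, b, hs, by rwa [resO_self], by rwa [resO_self, resO_self]⟩

theorem restrict (h : IsQuotientRule hW D hU g t) {U' : X.Opens} (h' : U' ≤ U) :
    IsQuotientRule hW D (h'.trans hU) (resO h' g) (resO h' t) := fun p hp => by
  obtain ⟨Z, hZ, hpZ, s, b, hs, hb, ht⟩ := h p (h' hp)
  refine ⟨U' ⊓ Z, inf_le_left, ⟨hp, hpZ⟩, s, b, ?_, ?_, ?_⟩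
  · have := hs.map (resO (inf_le_right : U' ⊓ Z ≤ Z))
    rwa [resO_resO] at this
  · have := congrArg (resO (inf_le_right : U' ⊓ Z ≤ Z)) hb
    simpa only [map_mul, resO_resO] using this
  · have := congrArg (resO (inf_le_right : U' ⊓ Z ≤ Z)) ht
    simpa only [map_mul, map_add, resO_resO] using this

theorem of_local (h : ∀ p, p ∈ U → ∃ (Z : X.Opens) (hZ : Z ≤ U), p ∈ Z ∧
    IsQuotientRule hW D (hZ.trans hU) (resO hZ g) (resO hZ t)) : IsQuotientRule hW D hU g t :=
  fun p hp => by
  obtain ⟨Z, hZ, hpZ, hQ⟩ := h p hp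
  obtain ⟨Z', hZ', hpZ', s, b, hs, hb, ht⟩ := hQ p hpZ
  rw [resO_resO] at hb
  rw [resO_resO, resO_resO] at ht
  exact ⟨Z', hZ'.trans hZ, hpZ', s, b, hs, hb, ht⟩

/-- Two quotient rules have common denominators near every point. -/
theorem exists_common (h : IsQuotientRule hW D hU g t) (h' : IsQuotientRule hW D hU g' t') {p : X}
    (hp : p ∈ U) : ∃ (Z : X.Opens) (hZ : Z ≤ U), p ∈ Z ∧ ∃ s b s' b' : Γ(X, V),
      IsUnit (resO ((hZ.trans hU).trans hW) s) ∧
      resO ((hZ.trans hU).trans hW) s * resO hZ g = resO ((hZ.trans hU).trans hW) b ∧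
      resO ((hZ.trans hU).trans hW) s * resO hZ t + resO hZ g * resO (hZ.trans hU) (D s) =
        resO (hZ.trans hU) (D b) ∧
      IsUnit (resO ((hZ.trans hU).trans hW) s') ∧
      resO ((hZ.trans hU).trans hW) s' * resO hZ g' = resO ((hZ.trans hU).trans hW) b' ∧
      resO ((hZ.trans hU).trans hW) s' * resO hZ t' + resO hZ g' * resO (hZ.trans hU) (D s') =
        resO (hZ.trans hU) (D b') := by
  obtain ⟨Z, hZ, hpZ, s, b, hs, hb, ht⟩ := h p hp
  obtain ⟨Z', hZ', hpZ', s', b', hs', hb', ht'⟩ := h' p hp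
  refine ⟨Z ⊓ Z', inf_le_left.trans hZ, ⟨hpZ, hpZ'⟩, s, b, s', b', ?_, ?_, ?_, ?_, ?_, ?_⟩
  · have := hs.map (resO (inf_le_left : Z ⊓ Z' ≤ Z))
    rwa [resO_resO] at this
  · have := congrArg (resO (inf_le_left : Z ⊓ Z' ≤ Z)) hb
    simpa only [map_mul, resO_resO] using this
  · have := congrArg (resO (inf_le_left : Z ⊓ Z' ≤ Z)) ht
    simpa only [map_mul, map_add, resO_resO] using this
  · have := hs'.map (resO (inf_le_right : Z ⊓ Z' ≤ Z'))
    rwa [resO_resO] at this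
  · have := congrArg (resO (inf_le_right : Z ⊓ Z' ≤ Z')) hb'
    simpa only [map_mul, resO_resO] using this
  · have := congrArg (resO (inf_le_right : Z ⊓ Z' ≤ Z')) ht'
    simpa only [map_mul, map_add, resO_resO] using this

theorem unique (hV : IsAffineOpen V) (hD : IsDerAlong (baseMap f V) (resO hW) D)
    (h : IsQuotientRule hW D hU g t) (h' : IsQuotientRule hW D hU g t') : t = t' := by
  refine resO_ext_local fun p hp => ?_
  obtain ⟨Z, hZ, hpZ, s, b, s', b', hs, hb, ht, hs', hb', ht'⟩ := h.exists_common h' hp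
  refine ⟨Z, hZ, hpZ, ?_⟩
  -- The fractions `b / s` and `b' / s'` are the same function, so the cross difference vanishes on
  -- `Z`, and so does its image under `D`. After substitution this says `s s' (t - t') = 0`.
  have h0 : resO ((hZ.trans hU).trans hW) (s' * b - s * b') = 0 := by
    rw [map_sub, map_mul, map_mul, ← hb, ← hb']; ring
  have h1 := hD.resO_eq_zero hV (hZ.trans hU) h0
  rw [map_sub, hD.mul, hD.mul, map_sub, map_add, map_add, map_mul, map_mul, map_mul, map_mul,
    resO_resO, resO_resO, resO_resO, resO_resO, ← hb, ← hb', ← ht, ← ht'] at h1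
  refine hs.mul_left_cancel (hs'.mul_left_cancel ?_)
  linear_combination h1

theorem add (hD : IsDerAlong (baseMap f V) (resO hW) D)
    (h : IsQuotientRule hW D hU g t) (h' : IsQuotientRule hW D hU g' t') :
    IsQuotientRule hW D hU (g + g') (t + t') := fun p hp => by
  obtain ⟨Z, hZ, hpZ, s, b, s', b', hs, hb, ht, hs', hb', ht'⟩ := h.exists_common h' hp
  refine ⟨Z, hZ, hpZ, s * s', s' * b + s * b', ?_, ?_, ?_⟩
  · rw [map_mul]; exact hs.mul hs'
  · simp only [map_mul, map_add, ← hb, ← hb']; ring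
  · rw [map_add D, hD.mul, hD.mul, hD.mul]
    simp only [map_mul, map_add, resO_resO, ← hb, ← hb', ← ht, ← ht']; ring

theorem mul (hD : IsDerAlong (baseMap f V) (resO hW) D)
    (h : IsQuotientRule hW D hU g t) (h' : IsQuotientRule hW D hU g' t') :
    IsQuotientRule hW D hU (g * g') (g * t' + g' * t) := fun p hp => by
  obtain ⟨Z, hZ, hpZ, s, b, s', b', hs, hb, ht, hs', hb', ht'⟩ := h.exists_common h' hp
  refine ⟨Z, hZ, hpZ, s * s', b * b', ?_, ?_, ?_⟩
  · rw [map_mul]; exact hs.mul hs'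
  · simp only [map_mul, ← hb, ← hb']; ring
  · rw [hD.mul, hD.mul]
    simp only [map_mul, map_add, resO_resO, ← hb, ← hb', ← ht, ← ht']; ring

theorem of_resO (hD : IsDerAlong (baseMap f V) (resO hW) D) (b : Γ(X, V)) :
    IsQuotientRule hW D hU (resO (hU.trans hW) b) (resO hU (D b)) := by
  have h1 : D 1 = 0 := by
    have := hD.base 1
    rwa [map_one] at this
  refine of_fraction (s := 1) (b := b) ?_ ?_ ?_
  · rw [map_one]; exact isUnit_one
  · rw [map_one, one_mul]
  · rw [h1, map_one, map_zero, mul_zero, add_zero, one_mul]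

theorem exists_of_isDerAlong (hV : IsAffineOpen V) (hD : IsDerAlong (baseMap f V) (resO hW) D)
    (hU : U ≤ W) (g : Γ(X, U)) : ∃ t, IsQuotientRule hW D hU g t := by
  obtain ⟨t, ht⟩ := exists_fun_of_local (U := U)
    (fun Z hZ t => IsQuotientRule hW D (hZ.trans hU) (resO hZ g) t)
    (fun Z hZ Z' h' t ht => by
      have := ht.restrict h'
      rwa [resO_resO] at this)
    (fun Z hZ s t hs ht => hs.unique hV hD ht) (fun p hp => by
      obtain ⟨Z, hZ, hpZ, s, b, hs, hb⟩ := exists_fraction hV (hU.trans hW) g hp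
      obtain ⟨w, hw⟩ := hs
      -- The witness is the quotient rule `(D b - g D s) / s`.
      refine ⟨Z, hZ, hpZ, ↑w⁻¹ * (resO (hZ.trans hU) (D b) -
        resO hZ g * resO (hZ.trans hU) (D s)), of_fraction (s := s) (b := b) ⟨w, hw⟩ hb ?_⟩
      rw [← hw, Units.mul_inv_cancel_left, sub_add_cancel])
  exact ⟨t, of_local ht⟩

end IsQuotientRule

/-- A derivation of the functions on an affine scheme, with values in the functions on an open
subset, extends to a derivation of functions over the open subset. -/
theorem IsDerAlong.exists_op (hV : IsAffineOpen V) {hW : W ≤ V} {D : Γ(X, V) →+ Γ(X, W)}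
    (hD : IsDerAlong (baseMap f V) (resO hW) D) :
    ∃ h : Op (OO X) (OO X) W, Op.IsDer f h ∧ ∀ b, h.onFun le_rfl (resO hW b) = D b := by
  choose t ht using fun (U : X.Opens) (hU : U ≤ W) (g : Γ(X, U)) =>
    IsQuotientRule.exists_of_isDerAlong hV hD hU g
  -- Additivity and compatibility with restriction follow from uniqueness of the quotient rule, as
  -- do the product rule and the vanishing on `A` below.
  let h : Op (OO X) (OO X) W := ⟨fun U => AddMonoidHom.mk'
    (fun x => (fn U.1).symm (t U.1 U.2 (fn U.1 x)))
    (fun x y => (ht _ _ _).unique hV hD ((ht U.1 U.2 (fn U.1 x)).add hD (ht U.1 U.2 (fn U.1 y)))),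
    fun U U' hU h' x => ((ht U hU (fn U x)).restrict h').unique hV hD (ht _ _ _)⟩
  refine ⟨h, ⟨fun U hU a b => ?_, fun U hU a => ?_⟩, fun b => ?_⟩
  · exact (ht _ _ _).unique hV hD ((ht U hU a).mul hD (ht U hU b))
  · refine (ht _ _ _).unique hV hD (t' := 0) ?_
    have := IsQuotientRule.of_resO (hU := hU) hD (baseMap f V a)
    rwa [resO_baseMap, hD.base, map_zero] at this
  · refine (ht _ _ _).unique hV hD ?_
    have := IsQuotientRule.of_resO (hU := le_rfl) hD b
    rwa [resO_self] at this

/-- The derivation of the functions on `V` given by a derivation of functions over a smaller open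
set. -/
def derAlong (hW : W ≤ V) (h : Op (OO X) (OO X) W) : Γ(X, V) →+ Γ(X, W) :=
  (h.onFun le_rfl).comp (resO hW).toAddMonoidHom

theorem derAlong_apply (hW : W ≤ V) (h : Op (OO X) (OO X) W) (b : Γ(X, V)) :
    derAlong hW h b = h.onFun le_rfl (resO hW b) := rfl

theorem derAlong_smul (hW : W ≤ V) (a : Γ(X, W)) (h : Op (OO X) (OO X) W) (b : Γ(X, V)) :
    derAlong hW (a • h) b = a * derAlong hW h b := by
  rw [derAlong_apply, Op.onFun_smul, resO_self, derAlong_apply]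

theorem derAlong_restrict (hW : W ≤ V) (hU : U ≤ W) (h : Op (OO X) (OO X) W) (b : Γ(X, V)) :
    derAlong (hU.trans hW) (Op.restrict hU h) b = resO hU (derAlong hW h b) := by
  rw [derAlong_apply, derAlong_apply, Op.resO_onFun, resO_resO, Op.onFun_restrict]

theorem isDerAlong_derAlong (hW : W ≤ V) {h : Op (OO X) (OO X) W} (hh : Op.IsDer f h) :
    IsDerAlong (baseMap f V) (resO hW) (derAlong hW h) where
  mul b c := by simp only [derAlong_apply, map_mul, hh.mul]
  base a := by rw [derAlong_apply, resO_baseMap, hh.base]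

/-- Locally `s g = b` with `s` and `b` from `V`. If `h` kills `s` and `b`, then `s h(g) = 0` with
`s` invertible. -/
theorem eq_zero_of_derAlong (hV : IsAffineOpen V) {hW : W ≤ V} {h : Op (OO X) (OO X) W}
    (hh : Op.IsDer f h) (h0 : derAlong hW h = 0) : h = 0 := by
  refine Op.ext fun U hU x => ?_
  refine res_ext_local (OO X) fun p hp => ?_
  obtain ⟨Z, hZ, hpZ, s, b, hs, hb⟩ := exists_fraction hV (hU.trans hW) (fn U x) hp
  refine ⟨Z, hZ, hpZ, ?_⟩
  have key : ∀ c : Γ(X, V), h.onFun (hZ.trans hU) (resO ((hZ.trans hU).trans hW) c) = 0 :=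
    fun c => by
    have e := DFunLike.congr_fun h0 c
    rw [derAlong_apply] at e
    rw [← resO_resO hW (hZ.trans hU), ← Op.resO_onFun h le_rfl (hZ.trans hU), e]
    exact map_zero _
  have e := key b
  rw [← hb, hh.mul, key, mul_zero, add_zero] at e
  have e2 := (hs.mul_right_eq_zero).1 e
  rw [← Op.resO_onFun h hU hZ] at e2
  exact e2.trans (map_zero _).symm

end DGPair

end

noncomputable section

namespace DGPair

variable {X : Scheme.{u}} {A : Type u} [CommRing A] {f : X ⟶ Spec (CommRingCat.of A)}
  {U V W : X.Opens} {M N : X.Modules}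

/-! ### Sheaves that are kernels of matrices -/

theorem IsKerOn.of_subsingleton (h : ∀ W : X.Opens, Subsingleton Γ(M, W)) : IsKerOn M V :=
  ⟨Empty, Empty, inferInstance, inferInstance, fun j => j.elim, fun _ _ => 0,
    fun _ _ _ _ i => i.elim, fun _ _ _ _ _ i => i.elim, fun _ _ _ _ => Subsingleton.elim _ _,
    fun _ _ _ j => j.elim, fun _ _ _ _ => ⟨0, funext fun i => i.elim⟩⟩

theorem IsKerOn.of_bijective (g : M ⟶ N) (hg : ∀ W : X.Opens, Function.Bijective (g.app W))
    (hN : IsKerOn N V) : IsKerOn M V := by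
  obtain ⟨n, m, _, _, T, φ, hsmul, hres, hinj, hker, hsurj⟩ := hN
  refine ⟨n, m, inferInstance, inferInstance, T, fun W h => (φ W h).comp (g.app W).hom,
    fun W h a x i => ?_, fun W h W' h' x i => ?_, fun W h x hx => ?_, fun W h x => hker W h _,
    fun W h b hb => ?_⟩
  · exact (congrArg (fun y => φ W h y i) (Scheme.Modules.Hom.app_smul g a x)).trans
      (hsmul W h a _ i)
  · exact (congrArg (fun y => φ W' (h'.trans h) y i) (LieSheaf.res_hom g h' x).symm).trans
      (hres W h W' h' _ i)
  · refine (hg W).1 ((hinj W h _ hx).trans (map_zero (g.app W).hom).symm)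
  · obtain ⟨y, hy⟩ := hsurj W h b hb
    obtain ⟨x, rfl⟩ := (hg W).2 y
    exact ⟨x, hy⟩

/-- Linear coordinates on the sections of a sheaf of modules over the open subsets of `V`. -/
structure Coord (M : X.Modules) (V : X.Opens) (κ : Type) where
  c : ∀ W : X.Opens, W ≤ V → Γ(M, W) →+ (κ → Γ(X, W))
  smul : ∀ W h (a : Γ(X, W)) x i, c W h (a • x) i = a * c W h x i
  res : ∀ W h W' (h' : W' ≤ W) x i, c W' (h'.trans h) (res M h' x) i = resO h' (c W h x i)

theorem Coord.isKerOn {κ : Type} [Fintype κ] (c : Coord M V κ)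
    (hc : ∀ W h, Function.Bijective (c.c W h)) : IsKerOn M V :=
  ⟨κ, Empty, inferInstance, inferInstance, fun j => j.elim, c.c, c.smul, c.res,
    fun W h _ hx => (hc W h).1 (hx.trans (map_zero _).symm), fun _ _ _ j => j.elim,
    fun W h b _ => (hc W h).2 b⟩

/-- A sheaf with a map to the kernel of a matrix and with free coordinates along this map. -/
theorem IsKerOn.of_coord {κ : Type} [Fintype κ] (hN : IsKerOn N V) (g : M ⟶ N) (c : Coord M V κ)
    (hinj : ∀ W h x, g.app W x = 0 → c.c W h x = 0 → x = 0)
    (hsurj : ∀ W h (y : Γ(N, W)) b, ∃ x, g.app W x = y ∧ c.c W h x = b) : IsKerOn M V := by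
  obtain ⟨n, m, _, _, T, φ, hsmul', hres', hinj', hker', hsurj'⟩ := hN
  -- The free coordinates enter as further unknowns with zero coefficients in every equation.
  refine ⟨n ⊕ κ, m, inferInstance, inferInstance, fun j => Sum.elim (T j) 0,
    fun W h => AddMonoidHom.mk' (fun x => Sum.elim (φ W h (g.app W x)) (c.c W h x))
      fun x y => ?_, fun W h a x i => ?_, fun W h W' h' x i => ?_, fun W h x hx => ?_,
    fun W h x j => ?_, fun W h b hb => ?_⟩
  · rw [map_add, map_add, map_add]
    funext i; rcases i with i | i <;> rfl
  · rcases i with i | i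
    · exact (congrArg (fun y => φ W h y i) (Scheme.Modules.Hom.app_smul g a x)).trans
        (hsmul' W h a _ i)
    · exact c.smul W h a x i
  · rcases i with i | i
    · exact (congrArg (fun y => φ W' (h'.trans h) y i) (LieSheaf.res_hom g h' x).symm).trans
        (hres' W h W' h' _ i)
    · exact c.res W h W' h' x i
  · exact hinj W h x (hinj' W h _ (funext fun i => congrFun hx (Sum.inl i)))
      (funext fun i => congrFun hx (Sum.inr i))
  · rw [Fintype.sum_sum_type]
    simpa using hker' W h (g.app W x) j
  · obtain ⟨y, hy⟩ := hsurj' W h (fun i => b (Sum.inl i)) fun j => by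
      have := hb j
      rw [Fintype.sum_sum_type] at this
      simpa using this
    obtain ⟨x, hx, hx'⟩ := hsurj W h y fun i => b (Sum.inr i)
    refine ⟨x, funext fun i => ?_⟩
    rcases i with i | i
    · exact congrFun ((congrArg (φ W h) hx).trans hy) i
    · exact congrFun hx' i

theorem isKerOn_OO : IsKerOn (OO X) V :=
  Coord.isKerOn (κ := Unit)
    { c := fun W _ => AddMonoidHom.mk' (fun x _ => fn W x) fun _ _ => rfl
      smul := fun _ _ _ _ _ => rfl
      res := fun _ _ _ _ _ _ => rfl }
    fun W _ => ⟨fun _ _ e => congrFun e (), fun b => ⟨(fn W).symm (b ()), rfl⟩⟩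

/-! ### The tangent sheaf -/

theorem finiteType_baseMap [LocallyOfFiniteType f] (hV : IsAffineOpen V) :
    (baseMap f V).FiniteType := by
  have h1 := f.finiteType_appLE (isAffineOpen_top _) hV (by simp)
  have h2 : ((Scheme.ΓSpecIso (CommRingCat.of A)).inv.hom).FiniteType :=
    RingHom.FiniteType.of_surjective _
      ((Scheme.ΓSpecIso (CommRingCat.of A)).symm.commRingCatIsoToRingEquiv.surjective)
  have h3 := h1.comp h2
  have e : baseMap f V =
      (f.appLE ⊤ V (by simp)).hom.comp (Scheme.ΓSpecIso (CommRingCat.of A)).inv.hom := by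
    rfl
  rw [e]
  exact h3

/-- Functions on an affine open set form a finitely generated algebra over the noetherian ring `A`.
-/
theorem isNoetherianRing_of_isAffineOpen [IsNoetherianRing A] [LocallyOfFiniteType f]
    (hV : IsAffineOpen V) : IsNoetherianRing Γ(X, V) := by
  let _ := (baseMap f V).toAlgebra
  have : Algebra.FiniteType A Γ(X, V) := finiteType_baseMap (f := f) hV
  exact Algebra.FiniteType.isNoetherianRing A _

/-- The coordinates of a derivation over `W` are its values on the finitely many algebra generators
of `Γ(X, V)`; the equations are the Jacobian ones. Since `W` need not be affine, derivations along
`Γ(X, V) → Γ(X, W)` mediate: each extends to an operator over `W`, and only one. -/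
theorem isKerOn_theta [IsNoetherianRing A] [LocallyOfFiniteType f] (hV : IsAffineOpen V) :
    IsKerOn (thetaData f).toModules V := by
  obtain ⟨n, m, x, T, hT⟩ := exists_derivation_equations (baseMap f V) (finiteType_baseMap hV)
  refine ⟨Fin n, Fin m, inferInstance, inferInstance, T,
    fun W h => AddMonoidHom.mk' (fun (θ : Der f W) i => derAlong h θ.1 (x i)) fun _ _ => rfl,
    fun W h a θ i => ?_, fun W h W' h' θ i => ?_, fun W h θ hθ => ?_, fun W h θ j => ?_,
    fun W h b hb => ?_⟩
  · exact derAlong_smul h a (show Der f W from θ).1 (x i)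
  · exact derAlong_restrict h h' (show Der f W from θ).1 (x i)
  · exact Subtype.ext (eq_zero_of_derAlong hV (show Der f W from θ).2
      ((hT (resO h)).2.1 _ (isDerAlong_derAlong h (show Der f W from θ).2)
        fun i => congrFun hθ i))
  · exact (hT (resO h)).1 _ (isDerAlong_derAlong h (show Der f W from θ).2) j
  · obtain ⟨D, hD, hDx⟩ := (hT (resO h)).2.2 b hb
    obtain ⟨η, hη, hηD⟩ := hD.exists_op hV
    exact ⟨(⟨η, hη⟩ : Der f W), funext fun i => (hηD (x i)).trans (hDx i)⟩

/-! ### Matrices of operators between free sheaves -/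

section

variable {n m : ℕ} {e : Fin n → Γ(M, V)} {e' : Fin m → Γ(N, V)}

/-- The matrix of an operator between sheaves of modules with frames. -/
def opCoord (e : Fin n → Γ(M, V)) (he' : IsFrame N V e') (h : W ≤ V) :
    Op M N W →+ (Fin n → Fin m → Γ(X, W)) :=
  AddMonoidHom.mk' (fun u s t => (he'.basis h).repr (u.app le_rfl (res M h (e s))) t)
    fun u v => by funext s t; simp

theorem opCoord_apply (he' : IsFrame N V e') (h : W ≤ V) (u : Op M N W) (s : Fin n) (t : Fin m) :
    opCoord e he' h u s t = (he'.basis h).repr (u.app le_rfl (res M h (e s))) t := rfl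

theorem opCoord_smul (he' : IsFrame N V e') (h : W ≤ V) (a : Γ(X, W)) (u : Op M N W) (s : Fin n)
    (t : Fin m) : opCoord e he' h (a • u) s t = a * opCoord e he' h u s t := by
  rw [opCoord_apply, Op.smul_app, map_smul, resO_self]
  rfl

theorem opCoord_restrict (he' : IsFrame N V e') (h : W ≤ V) {W' : X.Opens} (h' : W' ≤ W)
    (u : Op M N W) (s : Fin n) (t : Fin m) :
    opCoord e he' (h'.trans h) (Op.restrict h' u) s t = resO h' (opCoord e he' h u s t) := by
  rw [opCoord_apply, opCoord_apply, ← he'.repr_res, Op.res_app, res_res, Op.restrict_app]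

theorem app_eq_of_opCoord (he' : IsFrame N V e') (h : W ≤ V) {u v : Op M N W}
    (huv : opCoord e he' h u = opCoord e he' h v) (s : Fin n) :
    u.app le_rfl (res M h (e s)) = v.app le_rfl (res M h (e s)) :=
  (he'.basis h).repr.injective (Finsupp.ext fun t => congrFun (congrFun huv s) t)

theorem eq_of_opCoord (he : IsFrame M V e) (he' : IsFrame N V e') (h : W ≤ V) {u v : Op M N W}
    (hu : Op.IsLin u) (hv : Op.IsLin v) (huv : opCoord e he' h u = opCoord e he' h v) : u = v :=
  (he.mono h).ext_lin hu hv (app_eq_of_opCoord he' h huv)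

theorem exists_opCoord (he : IsFrame M V e) (he' : IsFrame N V e') (h : W ≤ V)
    (b : Fin n → Fin m → Γ(X, W)) : ∃ u : Op M N W, Op.IsLin u ∧ opCoord e he' h u = b := by
  refine ⟨_, (he.mono h).isLin_lin fun s => ∑ t, b s t • res N h (e' t), ?_⟩
  funext s t
  have := (he.mono h).lin_app_self (fun s => ∑ t, b s t • res N h (e' t)) le_rfl s
  rw [res_self, res_self] at this
  rw [opCoord_apply, this, he'.repr_sum]

end

/-! ### Derivations of a pair -/

/-- Given a generator `e`, a derivation of the pair amounts to its anchor together with the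
coefficient of `u(e)`, which is arbitrary. So one free unknown is added to the system for the
tangent sheaf. -/
theorem isKerOn_pairData (hθ : IsKerOn (thetaData f).toModules V) {e : Γ(M, V)}
    (he : IsFrame M V (fun _ : Fin 1 => e)) : IsKerOn (pairData f M).toModules V := by
  refine hθ.of_coord (κ := Unit) (pairAnchor f M).hom
    { c := fun W h => AddMonoidHom.mk' (fun (x : PairDer f M W) (_ : Unit) =>
        opCoord (fun _ : Fin 1 => e) he h x.op 0 0) fun x y => ?_
      smul := fun W h a (x : PairDer f M W) i => ?_
      res := fun W h W' h' (x : PairDer f M W) i =>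
        opCoord_restrict (e := fun _ : Fin 1 => e) he h h' x.op 0 0 }
    (fun W h x hx hx' => ?_) (fun W h y b => ?_)
  · funext i
    exact congrFun (congrFun (map_add (opCoord (fun _ : Fin 1 => e) he h)
      (PairDer.op x) (PairDer.op y)) 0) 0
  · change opCoord (fun _ : Fin 1 => e) he h (a • x).op 0 0 =
      a * opCoord (fun _ : Fin 1 => e) he h x.op 0 0
    rw [PairDer.op_smul]
    exact opCoord_smul (e := fun _ : Fin 1 => e) he h a x.op 0 0
  · have h0 : (show PairDer f M W from x).der = 0 := congrArg Subtype.val hx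
    refine PairDer.ext' (x := (show PairDer f M W from x)) (y := 0) h0 ?_
    have hp := (show PairDer f M W from x).2.2
    have hp' : Op.IsPair 0 (show PairDer f M W from x).op := by rw [← h0]; exact hp
    refine eq_of_opCoord he he h (Op.isPair_zero.1 hp') Op.isLin_zero ?_
    refine Eq.trans ?_ (map_zero (opCoord (fun _ : Fin 1 => e) he h)).symm
    funext s t
    rw [Subsingleton.elim s 0, Subsingleton.elim t 0]
    exact congrFun hx' ()
  · generalize hz : (he.mono h).pair (show Der f W from y).1 (show Der f W from y).2
      (fun _ => b () • res M h e) = z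
    have h1 : z.der = (show Der f W from y).1 := by rw [← hz]; rfl
    have h2 : z.op.app le_rfl (res M h e) = b () • res M h e := by
      have := (he.mono h).pair_app_self (f := f) (show Der f W from y).2
        (fun _ => b () • res M h e) le_rfl 0
      rwa [res_self, res_self, hz] at this
    refine ⟨z, Subtype.ext h1, funext fun i => ?_⟩
    have e2 := he.repr_sum h (fun _ => b ()) 0
    rw [Fin.sum_univ_one, ← h2] at e2
    exact e2

end DGPair

end

noncomputable section

namespace DGPair

variable {X : Scheme.{u}} {A : Type u} [CommRing A] {f : X ⟶ Spec (CommRingCat.of A)}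
  {U V W : X.Opens}

/-! ### Matrices of cochains -/

theorem Op.subsingleton_of_isZero {M N : X.Modules} (h : Limits.IsZero M ∨ Limits.IsZero N) :
    Subsingleton (Op M N U) :=
  ⟨fun u v => Op.ext fun V hV x => by
    rcases h with h | h
    · have := DGPair.subsingleton_of_isZero h V
      rw [Subsingleton.elim x 0, map_zero, map_zero]
    · exact (DGPair.subsingleton_of_isZero h V).elim _ _⟩

section

variable {E : CochainComplex X.Modules ℤ} {a : ℤ} {k : ℕ} {r : ℤ → ℕ}
  {e : ∀ j, Fin (r j) → Γ(E.X j, V)}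

/-- Indices for the entries of the matrices of a cochain of degree `i`. -/
abbrev CochIndex (a : ℤ) (k : ℕ) (r : ℤ → ℕ) (i : ℤ) : Type :=
  Σ x : {x : ↥(Finset.Icc a (a + k)) × ↥(Finset.Icc a (a + k)) // (x.1 : ℤ) + i = x.2},
    Fin (r x.1.1) × Fin (r x.1.2)

/-- The entries of the matrices of a cochain. -/
def cochCoord (a : ℤ) (k : ℕ) (he : ∀ j, IsFrame (E.X j) V (e j)) (i : ℤ) (h : W ≤ V) :
    Coch E i W →+ (CochIndex a k r i → Γ(X, W)) :=
  AddMonoidHom.mk' (fun u s => opCoord (e s.1.1.1) (he s.1.1.2) h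
    (Coch.at' u s.1.1.1 s.1.1.2 s.1.2) s.2.1 s.2.2)
    fun u v => funext fun s => congrFun (congrFun (map_add (opCoord (e s.1.1.1) (he s.1.1.2) h)
      (Coch.at' u s.1.1.1 s.1.1.2 s.1.2) (Coch.at' v s.1.1.1 s.1.1.2 s.1.2)) s.2.1) s.2.2

theorem cochCoord_smul (he : ∀ j, IsFrame (E.X j) V (e j)) (i : ℤ) (h : W ≤ V) (c : Γ(X, W))
    (u : Coch E i W) (s : CochIndex a k r i) :
    cochCoord a k he i h (c • u) s = c * cochCoord a k he i h u s :=
  opCoord_smul (he s.1.1.2) h c (Coch.at' u s.1.1.1 s.1.1.2 s.1.2) s.2.1 s.2.2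

theorem cochCoord_restrict (he : ∀ j, IsFrame (E.X j) V (e j)) (i : ℤ) (h : W ≤ V) {W' : X.Opens}
    (h' : W' ≤ W) (u : Coch E i W) (s : CochIndex a k r i) :
    cochCoord a k he i (h'.trans h) (fun x => Op.restrict h' (u x)) s =
      resO h' (cochCoord a k he i h u s) :=
  opCoord_restrict (he s.1.1.2) h h' (Coch.at' u s.1.1.1 s.1.1.2 s.1.2) s.2.1 s.2.2

/-- Finitely many matrices suffice because components from or to a term outside the range act
between sheaves one of which is zero. -/
theorem eq_of_cochCoord (hb : ∀ i, i < a ∨ a + k < i → Limits.IsZero (E.X i))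
    (he : ∀ j, IsFrame (E.X j) V (e j)) (i : ℤ) (h : W ≤ V) {u v : Coch E i W} (hu : u.IsLin)
    (hv : v.IsLin) (huv : cochCoord a k he i h u = cochCoord a k he i h v) : u = v := by
  refine Coch.ext fun p q hpq => ?_
  by_cases hp : p ∈ Finset.Icc a (a + k)
  · by_cases hq : q ∈ Finset.Icc a (a + k)
    · refine eq_of_opCoord (he p) (he q) h (hu p q hpq) (hv p q hpq) ?_
      funext s t
      exact congrFun huv ⟨⟨(⟨p, hp⟩, ⟨q, hq⟩), hpq⟩, (s, t)⟩
    · refine (Op.subsingleton_of_isZero (Or.inr (hb q ?_))).elim _ _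
      rw [Finset.mem_Icc] at hq; omega
  · refine (Op.subsingleton_of_isZero (Or.inl (hb p ?_))).elim _ _
    rw [Finset.mem_Icc] at hp; omega

theorem exists_cochCoord (he : ∀ j, IsFrame (E.X j) V (e j)) (i : ℤ) (h : W ≤ V)
    (b : CochIndex a k r i → Γ(X, W)) :
    ∃ u : Coch E i W, u.IsLin ∧ cochCoord a k he i h u = b := by
  classical
  -- Operators are chosen for every pair of degrees, with the zero matrix where no entry is
  -- prescribed; this avoids choices indexed by dependent data.
  choose u hu huc using fun (p q : ℤ) => exists_opCoord (he p) (he q) h fun s t =>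
    if hpq : (p ∈ Finset.Icc a (a + k) ∧ q ∈ Finset.Icc a (a + k)) ∧ p + i = q then
      b ⟨⟨(⟨p, hpq.1.1⟩, ⟨q, hpq.1.2⟩), hpq.2⟩, (s, t)⟩ else 0
  refine ⟨fun x => u x.1.1 x.1.2, fun p q _ => hu p q, funext fun s => ?_⟩
  obtain ⟨⟨⟨⟨p, hp⟩, ⟨q, hq⟩⟩, hpq⟩, s, t⟩ := s
  refine (congrFun (congrFun (huc p q) s) t).trans ?_
  rw [dif_pos ⟨⟨hp, hq⟩, hpq⟩]

/-- Linear cochains between framed terms are arbitrary matrices: there are unknowns but no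
equations. -/
theorem isKerOn_homData (hb : ∀ i, i < a ∨ a + k < i → Limits.IsZero (E.X i)) (hV : AllFree E V)
    (i : ℤ) : IsKerOn (homData E i).toModules V := by
  choose r e he using hV
  let c : Coord (homData E i).toModules V (CochIndex a k r i) :=
    { c := fun W h => AddMonoidHom.mk' (fun u : (homData E i).S W => cochCoord a k he i h u.1)
        fun u v => map_add (cochCoord a k he i h) u.1 v.1
      smul := fun W h a (u : (homData E i).S W) s => cochCoord_smul he i h a u.1 s
      res := fun W h W' h' (u : (homData E i).S W) s => cochCoord_restrict he i h h' u.1 s }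
  refine c.isKerOn fun W h => ⟨fun u v huv => ?_, fun b => ?_⟩
  · exact Subtype.ext (eq_of_cochCoord hb he i h (show (homData E i).S W from u).2
      (show (homData E i).S W from v).2 huv)
  · obtain ⟨u, hu, hub⟩ := exists_cochCoord he i h b
    exact ⟨(⟨u, hu⟩ : (homData E i).S W), hub⟩

theorem isKerOn_derData_ne (hb : ∀ i, i < a ∨ a + k < i → Limits.IsZero (E.X i))
    (hV : AllFree E V) {i : ℤ} (hi : i ≠ 0) : IsKerOn (derData f E i).toModules V := by
  choose r e he using hV
  let c : Coord (derData f E i).toModules V (CochIndex a k r i) :=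
    { c := fun W h => AddMonoidHom.mk' (fun u : DerCoch f E i W => cochCoord a k he i h u.1.2)
        fun u v => map_add (cochCoord a k he i h) u.1.2 v.1.2
      smul := fun W h a (u : DerCoch f E i W) s => cochCoord_smul he i h a u.1.2 s
      res := fun W h W' h' (u : DerCoch f E i W) s => cochCoord_restrict he i h h' u.1.2 s }
  refine c.isKerOn fun W h => ⟨fun u v huv => ?_, fun b => ?_⟩
  · have hu := (show DerCoch f E i W from u).2
    have hv := (show DerCoch f E i W from v).2
    exact Subtype.ext (Prod.ext ((hu.zero hi).trans (hv.zero hi).symm)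
      (eq_of_cochCoord hb he i h (hu.lin hi) (hv.lin hi) huv))
  · obtain ⟨u, hu, hub⟩ := exists_cochCoord he i h b
    exact ⟨linDer f hu, hub⟩

/-- The coordinates of the anchor are supplemented by the matrix of `u` on the frames. The kernel of
the anchor is described by the matrix alone. -/
theorem isKerOn_derData_zero (hb : ∀ i, i < a ∨ a + k < i → Limits.IsZero (E.X i))
    (hV : AllFree E V) (hθ : IsKerOn (thetaData f).toModules V) :
    IsKerOn (derData f E 0).toModules V := by
  have hW := fun W h => hV.mono (W := W) h
  choose r e he using hV
  let g : (derData f E 0).toModules ⟶ (thetaData f).toModules :=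
    homMk (fun U => AddMonoidHom.mk' (fun x : DerCoch f E 0 U => (⟨x.1.1, x.2.der⟩ : Der f U))
        fun _ _ => rfl)
      (fun U a x => rfl) (fun hV x => rfl)
  let c : Coord (derData f E 0).toModules V (CochIndex a k r 0) :=
    { c := fun W h => AddMonoidHom.mk' (fun u : DerCoch f E 0 W => cochCoord a k he 0 h u.1.2)
        fun u v => map_add (cochCoord a k he 0 h) u.1.2 v.1.2
      smul := fun W h a (u : DerCoch f E 0 W) s => cochCoord_smul he 0 h a u.1.2 s
      res := fun W h W' h' (u : DerCoch f E 0 W) s => cochCoord_restrict he 0 h h' u.1.2 s }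
  refine hθ.of_coord g c (fun W h x hx hx' => ?_) (fun W h y b => ?_)
  · have h0 : (show DerCoch f E 0 W from x).1.1 = 0 := congrArg Subtype.val hx
    have hx2 := (show DerCoch f E 0 W from x).2
    change IsDerCoch f _ _ at hx2
    rw [h0] at hx2
    exact Subtype.ext (Prod.ext h0 (eq_of_cochCoord (v := 0) hb he 0 h hx2.isLin
      (fun _ _ _ => Op.isLin_zero) (hx'.trans (map_zero _).symm)))
  · obtain ⟨x, hx⟩ := exists_derCoch (f := f) (hW W h) (show Der f W from y).2
    -- Any lift `x` of the given derivation is corrected by a linear cochain, which does not affect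
    -- the anchor, to obtain the prescribed matrix `b`.
    obtain ⟨u, hu, hub⟩ := exists_cochCoord he 0 h (b - cochCoord a k he 0 h x.1.2)
    refine ⟨x + linDer f hu, Subtype.ext ?_, ?_⟩
    · refine Eq.trans ?_ hx
      exact add_zero x.1.1
    · refine (map_add (cochCoord a k he 0 h) x.1.2 u).trans ?_
      exact (congrArg (cochCoord a k he 0 h x.1.2 + ·) hub).trans (add_sub_cancel _ _)

end

/-! ### Coherence -/

theorem isZero_of_subsingleton {M : X.Modules} (h : ∀ U : X.Opens, Subsingleton Γ(M, U)) :
    Limits.IsZero M := by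
  rw [Limits.IsZero.iff_id_eq_zero]
  ext U x
  exact (h U).elim _ _

/-- Near every point, a property that holds on small affine open sets holds on a noetherian affine
open set. -/
theorem IsCoherent.of_local [IsNoetherianRing A] (f : X ⟶ Spec (CommRingCat.of A))
    [LocallyOfFiniteType f] {M : X.Modules}
    (h : ∀ p : X, ∃ U : X.Opens, p ∈ U ∧ ∀ V, V ≤ U → IsAffineOpen V → IsKerOn M V) :
    IsCoherent M :=
  .of_isKerOn M fun p => by
    obtain ⟨U, hpU, hU⟩ := h p
    obtain ⟨V, hV, hpV, hVU⟩ := exists_isAffineOpen_mem_and_subset hpU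
    exact ⟨V, hpV, hV, isNoetherianRing_of_isAffineOpen (f := f) hV, hU V hVU hV⟩

theorem LieSheaf.bijective_proj (M : X.Modules) (W : X.Opens) :
    Function.Bijective ((LieSheaf.proj M 0).app W) :=
  ⟨fun x y h => by rw [← LieSheaf.incl_proj M 0 x, h, LieSheaf.incl_proj],
    fun x => ⟨_, LieSheaf.proj_incl M x⟩⟩

theorem coherent_toDG [IsNoetherianRing A] [LocallyOfFiniteType f] (L : LieSheaf f)
    (h : ∀ p : X, ∃ U : X.Opens, p ∈ U ∧ ∀ V, V ≤ U → IsAffineOpen V → IsKerOn L.mod V) :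
    L.toDG.Coherent := by
  refine ⟨fun i => ?_, (Set.finite_singleton (0 : ℤ)).subset fun i hi => ?_⟩
  · by_cases hi : i = 0
    · subst hi
      refine IsCoherent.of_local f fun p => ?_
      obtain ⟨U, hpU, hU⟩ := h p
      exact ⟨U, hpU, fun V hVU hV => IsKerOn.of_bijective (LieSheaf.proj L.mod 0)
        (LieSheaf.bijective_proj L.mod) (hU V hVU hV)⟩
    · exact IsCoherent.of_local f fun p => ⟨⊤, trivial, fun V _ _ =>
        IsKerOn.of_subsingleton fun W => ⟨fun x y =>
          (LieSheaf.single_eq_zero L.mod hi x).trans (LieSheaf.single_eq_zero L.mod hi y).symm⟩⟩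
  · by_contra h0
    exact hi (HomologicalComplex.isZero_single_obj_X (ComplexShape.up ℤ) 0 L.mod i h0)

theorem coherent_theta [IsNoetherianRing A] [LocallyOfFiniteType f] : (theta f).toDG.Coherent :=
  coherent_toDG (theta f) fun _ => ⟨⊤, trivial, fun _ _ hV => isKerOn_theta hV⟩

theorem coherent_trivialLie [IsNoetherianRing A] [LocallyOfFiniteType f] :
    (trivialLie f).toDG.Coherent :=
  coherent_toDG (trivialLie f) fun _ => ⟨⊤, trivial, fun _ _ _ => isKerOn_OO⟩

theorem coherent_pairLie [IsNoetherianRing A] [LocallyOfFiniteType f] {M : X.Modules}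
    (hM : IsInvertible M) : (pairLie f M).toDG.Coherent :=
  coherent_toDG (pairLie f M) fun p => by
    obtain ⟨U, _, e, hpU, he⟩ := hM.exists_generator (U := ⊤) (x := p) trivial
    exact ⟨U, hpU, fun V hVU hV => isKerOn_pairData (isKerOn_theta hV) (he.mono hVU)⟩

section

variable {E : CochainComplex X.Modules ℤ} {a : ℤ} {k : ℕ}

/-- A nonzero component joins two degrees in a, …, a + k, which differ by at most `k`. -/
theorem coch_subsingleton (hb : ∀ i, i < a ∨ a + k < i → Limits.IsZero (E.X i)) {i : ℤ}
    (hi : i ∉ Set.Icc (-k : ℤ) k) : Subsingleton (Coch E i U) :=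
  ⟨fun u v => Coch.ext fun p q hpq => by
    refine (Op.subsingleton_of_isZero ?_).elim _ _
    by_contra! h
    have hp := mt (hb p) h.1
    have hq := mt (hb q) h.2
    refine hi ⟨?_, ?_⟩ <;> omega⟩

theorem coherent_homDG [IsNoetherianRing A] [LocallyOfFiniteType f]
    (hb : ∀ i, i < a ∨ a + k < i → Limits.IsZero (E.X i)) (hE : ∀ i, IsLocallyFree (E.X i)) :
    (homDG f E).Coherent := by
  refine ⟨fun i => IsCoherent.of_local f fun p => ?_,
    (Set.finite_Icc (-k : ℤ) k).subset fun i hi => ?_⟩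
  · obtain ⟨U, _, hpU, hU⟩ := exists_allFree hb hE (U := ⊤) (p := p) trivial
    exact ⟨U, hpU, fun V hVU _ => isKerOn_homData hb (hU.mono hVU) i⟩
  · by_contra h0
    exact hi (isZero_of_subsingleton fun U => ⟨fun x y =>
      Subtype.ext ((coch_subsingleton hb h0).elim _ _)⟩)

theorem coherent_derDG [IsNoetherianRing A] [LocallyOfFiniteType f]
    (hb : ∀ i, i < a ∨ a + k < i → Limits.IsZero (E.X i)) (hE : ∀ i, IsLocallyFree (E.X i)) :
    (derDG f E).Coherent := by
  refine ⟨fun i => IsCoherent.of_local f fun p => ?_,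
    (Set.finite_Icc (-k : ℤ) k).subset fun i hi => ?_⟩
  · obtain ⟨U, _, hpU, hU⟩ := exists_allFree hb hE (U := ⊤) (p := p) trivial
    refine ⟨U, hpU, fun V hVU hV => ?_⟩
    by_cases hi : i = 0
    · subst hi
      exact isKerOn_derData_zero hb (hU.mono hVU) (isKerOn_theta hV)
    · exact isKerOn_derData_ne hb (hU.mono hVU) hi
  · by_contra h0
    have hi0 : i ≠ 0 := by
      rintro rfl
      exact h0 ⟨by omega, by omega⟩
    exact hi (isZero_of_subsingleton fun U => ⟨fun x y =>
      Subtype.ext (Prod.ext (((show DerCoch f E i U from x).2.zero hi0).trans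
        ((show DerCoch f E i U from y).2.zero hi0).symm) ((coch_subsingleton hb h0).elim _ _))⟩)

end

end DGPair

end


/-! ### The commutative diagram with exact rows -/

theorem theorem5p6 {A : Type u} [CommRing A] [IsNoetherianRing A] {X : Scheme.{u}}
    (f : X ⟶ Spec (CommRingCat.of A)) [LocallyOfFiniteType f] [QuasiCompact f]
    (E : CochainComplex X.Modules ℤ) (a : ℤ) (k : ℕ)
    (hbounded : ∀ i, i < a ∨ a + k < i → Limits.IsZero (E.X i))
    (hfree : ∀ i, IsLocallyFree (E.X i)) :
    (homDG f E).Coherent ∧ (derDG f E).Coherent ∧ (theta f).toDG.Coherent ∧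
    (trivialLie f).toDG.Coherent ∧ (pairLie f (detComplex E a k)).toDG.Coherent ∧
    IsExactSeq (homIncl f E) (anchor f E) ∧
    IsExactSeq (scalarIncl f (detComplex E a k)).toDG (pairAnchor f (detComplex E a k)).toDG ∧
    ∃ (tr : (homDG f E).Hom (trivialLie f).toDG)
      (Tr : (derDG f E).Hom (pairLie f (detComplex E a k)).toDG),
      IsTrace f E a k tr ∧ IsTraceMap f E a k Tr ∧
      (homIncl f E).hom ≫ Tr.hom = tr.hom ≫ (scalarIncl f (detComplex E a k)).toDG.hom ∧
      Tr.hom ≫ (pairAnchor f (detComplex E a k)).toDG.hom = (anchor f E).hom :=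
  ⟨coherent_homDG hbounded hfree, coherent_derDG hbounded hfree, coherent_theta,
    coherent_trivialLie, coherent_pairLie (isInvertible_detComplex hfree a k),
    isExactSeq_homIncl_anchor hfree hbounded,
    isExactSeq_scalarIncl_pairAnchor (isInvertible_detComplex hfree a k),
    homTrace f hfree hbounded, derTrace f hfree hbounded, isTrace_homTrace hfree hbounded,
    isTraceMap_derTrace hfree hbounded, homIncl_derTrace hfree hbounded,
    derTrace_pairAnchor hfree hbounded⟩
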